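/- **Superfunctions.** Work over the field $\mathbb{Q}(\beta)$ of rational functions in $\beta$. For $N\ge 0$ let $\mathscr P_N=\mathbb{Q}(\beta)[x_1,\dots,x_N,\theta_1,\dots,\theta_N]$, where the $x_i$ commute with everything and $\theta_i\theta_j=-\theta_j\theta_i$ (so $\theta_i^2=0$). For $\sigma\in S_N$ let $\mathcal K_\sigma$ be the algebra automorphism with $x_i\mapsto x_{\sigma(i)}$, $\theta_i\mapsto\theta_{\sigma(i)}$, and let $K_{jk}$ exchange $x_j$ and $x_k$ only. Let $\mathscr P^{S_\infty}(\beta)$ be the algebra of symmetric superfunctions in infinitely many variables, i.e. of families $F=(F_M)_{M\ge 0}$, $F_M\in\mathscr P_M$, such that every $F_M$ is invariant under all $\mathcal K_\sigma$, $\sigma\in S_M$, such that $F_{M+1}|_{x_{M+1}=\theta_{M+1}=0}=F_M$, and such that the degrees of the $F_M$ in $x$ are bounded. **Scalar product.** Put $p_n=\sum_i x_i^n$ $(n\ge 1)$ and $\tilde p_n=\sum_i\theta_i x_i^n$ $(n\ge 0)$. A superpartition $\Lambda=(\Lambda_1,\dots,\Lambda_m;\Lambda_{m+1},\dots,\Lambda_\ell)$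 consists of integers $\Lambda_1>\dots>\Lambda_m\ge 0$ and a partition $\Lambda_{m+1}\ge\dots\ge\Lambda_\ell\ge 1$; its length is $\ell(\Lambda)=\ell$. Let $n_\Lambda(k)$ be the number of $j>m$ with $\Lambda_j=k$, and let $$p_\Lambda=\tilde p_{\Lambda_1}\cdots\tilde p_{\Lambda_m}\,p_{\Lambda_{m+1}}\cdots p_{\Lambda_\ell},\qquad \overleftarrow{p_\Lambda}=\tilde p_{\Lambda_m}\cdots\tilde p_{\Lambda_1}\,p_{\Lambda_{m+1}}\cdots p_{\Lambda_\ell},\qquad z_\Lambda(\beta)=\beta^{-\ell(\Lambda)}\prod_{k\ge 1}k^{n_\Lambda(k)}\,n_\Lambda(k)!\,.$$ **Operators.** For $1\le j\le N$ let $$\mathcal D_j=x_j\partial_{x_j}+\beta\sum_{k<j}\frac{x_j}{x_j-x_k}(1-K_{jk})+\beta\sum_{k>j}\frac{x_k}{x_j-x_k}(1-K_{jk})-\beta(j-1)$$ be the Dunkl–Cherednik operators on $\mathscr P_N$, let $\mathcal H_r=\sum_{j=1}^N\mathcal D_j^{\,r}$, and let $$\mathcal H^{(N)}=\mathcal H_2+\beta(N-1)\mathcal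 H_1-\tfrac16\beta^2N(N-1)(2-N),\qquad \mathcal I^{(N)}=\mathcal I_1=\frac1{(N-1)!}\sum_{\sigma\in S_N}\mathcal K_\sigma\bigl(\theta_1\partial_{\theta_1}\mathcal D_1\bigr)\mathcal K_\sigma^{-1}$$ (with $\mathcal I^{(0)}=0$). $\mathcal H^{(N)}$ is the stCMS Hamiltonian in $N$ variables; the constant is the one for which $\mathcal H^{(N)}1=0$. Let $E^{(M)}=\sum_{i=1}^M x_i\partial_{x_i}$. On families, $\mathcal I$ acts by $(\mathcal I F)_M=\mathcal I^{(M)}F_M$. Since $\mathcal H^{(M)}$ depends on the number $M$ of variables through the term $\beta M E^{(M)}$, the Hamiltonian with parameter $N$ acts on superfunctions of infinitely many variables by $$(\mathcal H F)_M=\mathcal H^{(M)}F_M+\beta(N-M)E^{(M)}F_M ,$$ so that its component in $N$ variables is $\mathcal H^{(N)}$ itself. **Proposition.** There is exactly one bilinear form $\langle\langle\cdot|\cdot\rangle\rangle_\beta$ on $\mathscr P^{S_\infty}(\beta)$ with $\langle\langle\overleftarrow{p_\Lambda}\,|\,p_\Omega\rangle\rangle_\beta=z_\Lambda(\beta)\,\delta_{\Lambda\Omega}$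 for all superpartitions $\Lambda,\Omega$. For every integer $N\ge 0$, the operators $\mathcal H$ (with parameter $N$) and $\mathcal I$ map $\mathscr P^{S_\infty}(\beta)$ to itself, and they are self-adjoint with respect to this form: for all $F,G\in\mathscr P^{S_\infty}(\beta)$, $$\langle\langle\mathcal H F|G\rangle\rangle_\beta=\langle\langle F|\mathcal H G\rangle\rangle_\beta,\qquad \langle\langle\mathcal I F|G\rangle\rangle_\beta=\langle\langle F|\mathcal I G\rangle\rangle_\beta .$$ -/

import Mathlib

open scoped TensorProduct

noncomputable section

namespace Superspace

/-! ### Superpolynomials in `N` commuting and `N` anticommuting variables -/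

/-- The algebra `K[x₁, …, x_N, θ₁, …, θ_N]` of superpolynomials: the commuting variables `x_i`
generate the polynomial factor, the anticommuting variables `θ_i` generate the Grassmann factor,
and every `x_i` commutes with every `θ_j`. Variables are numbered from `0` by `Fin N`. -/
abbrev Superpoly (K : Type) [Field K] (N : ℕ) : Type :=
  MvPolynomial (Fin N) K ⊗[K] ExteriorAlgebra K (Fin N → K)

/-- The commuting variable `x_i`. -/
def xVar (K : Type) [Field K] {N : ℕ} (i : Fin N) : Superpoly K N :=
  MvPolynomial.X i ⊗ₜ[K] 1

/-- The anticommuting variable `θ_i`. -/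
def thetaVar (K : Type) [Field K] {N : ℕ} (i : Fin N) : Superpoly K N :=
  1 ⊗ₜ[K] ExteriorAlgebra.ι K (Pi.single i 1)

/-- The diagonal action `𝒦_σ` of a permutation: `x_i ↦ x_{σ i}` and `θ_i ↦ θ_{σ i}`. -/
def diagPerm (K : Type) [Field K] {N : ℕ} (σ : Equiv.Perm (Fin N)) :
    Superpoly K N →ₐ[K] Superpoly K N :=
  Algebra.TensorProduct.map (MvPolynomial.rename σ)
    (ExteriorAlgebra.map (LinearMap.funLeft K K σ.symm))

/-- The restriction from `N + 1` to `N` pairs of variables: `x_{N+1} = θ_{N+1} = 0`. -/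
def restrictVars (K : Type) [Field K] (N : ℕ) : Superpoly K (N + 1) →ₐ[K] Superpoly K N :=
  Algebra.TensorProduct.map
    (MvPolynomial.aeval (Fin.lastCases (0 : MvPolynomial (Fin N) K) MvPolynomial.X))
    (ExteriorAlgebra.map (LinearMap.funLeft K K Fin.castSucc))

/-- The superpolynomials of degree at most `d` in the commuting variables. -/
def degreeLE (K : Type) [Field K] (N d : ℕ) : Submodule K (Superpoly K N) :=
  Submodule.span K
    {t | ∃ (f : MvPolynomial (Fin N) K) (g : ExteriorAlgebra K (Fin N → K)),
      f.totalDegree ≤ d ∧ t = f ⊗ₜ[K] g}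

/-! ### Operators in `N` variables -/

theorem X_sub_X_dvd {K : Type} [Field K] {N : ℕ} (j k : Fin N) (f : MvPolynomial (Fin N) K) :
    (MvPolynomial.X j - MvPolynomial.X k : MvPolynomial (Fin N) K) ∣
      f - MvPolynomial.rename (Equiv.swap j k) f := by
  set I : Ideal (MvPolynomial (Fin N) K) :=
    Ideal.span {(MvPolynomial.X j - MvPolynomial.X k : MvPolynomial (Fin N) K)} with hI
  have hjk : Ideal.Quotient.mkₐ K I (MvPolynomial.X j) =
      Ideal.Quotient.mkₐ K I (MvPolynomial.X k) := by
    simp only [Ideal.Quotient.mkₐ_eq_mk]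
    rw [Ideal.Quotient.mk_eq_mk_iff_sub_mem]
    exact Ideal.subset_span rfl
  have h : (Ideal.Quotient.mkₐ K I).comp (MvPolynomial.rename (Equiv.swap j k)) =
      Ideal.Quotient.mkₐ K I := by
    apply MvPolynomial.algHom_ext
    intro i
    simp only [AlgHom.comp_apply, MvPolynomial.rename_X]
    by_cases hij : i = j
    · subst hij; simpa using hjk.symm
    · by_cases hik : i = k
      · subst hik; simpa using hjk
      · rw [Equiv.swap_apply_of_ne_of_ne hij hik]
  rw [← Ideal.mem_span_singleton, ← Ideal.Quotient.mk_eq_mk_iff_sub_mem]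
  exact (DFunLike.congr_fun h f).symm

theorem X_sub_X_ne_zero (K : Type) [Field K] {N : ℕ} {j k : Fin N} (h : j ≠ k) :
    (MvPolynomial.X j - MvPolynomial.X k : MvPolynomial (Fin N) K) ≠ 0 :=
  sub_ne_zero.2 fun e => h (MvPolynomial.X_injective e)

/-- The divided difference `f ↦ (f - K_{jk} f) / (x_j - x_k)` for `j ≠ k`, where `K_{jk}`
exchanges `x_j` and `x_k`; the quotient is the exact one, in the polynomial ring. (For `j = k` it
is set to `0`; this value is never used.) -/
def divDiff (K : Type) [Field K] {N : ℕ} (j k : Fin N) :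
    MvPolynomial (Fin N) K →ₗ[K] MvPolynomial (Fin N) K :=
  if h : j = k then 0 else
  { toFun := fun f => Classical.choose (X_sub_X_dvd j k f)
    map_add' := fun f g => by
      apply mul_left_cancel₀ (X_sub_X_ne_zero K h)
      rw [mul_add, ← Classical.choose_spec (X_sub_X_dvd j k f),
        ← Classical.choose_spec (X_sub_X_dvd j k g),
        ← Classical.choose_spec (X_sub_X_dvd j k (f + g)), map_add]
      ring
    map_smul' := fun c f => by
      apply mul_left_cancel₀ (X_sub_X_ne_zero K h)
      rw [RingHom.id_apply, mul_smul_comm, ← Classical.choose_spec (X_sub_X_dvd j k f),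
        ← Classical.choose_spec (X_sub_X_dvd j k (c • f)), map_smul, smul_sub] }

theorem divDiff_spec (K : Type) [Field K] {N : ℕ} {j k : Fin N} (h : j ≠ k)
    (f : MvPolynomial (Fin N) K) :
    (MvPolynomial.X j - MvPolynomial.X k) * divDiff K j k f =
      f - MvPolynomial.rename (Equiv.swap j k) f := by
  rw [divDiff, dif_neg h]
  exact (Classical.choose_spec (X_sub_X_dvd j k f)).symm

/-- The Dunkl–Cherednik operator on polynomials in `x`,
`𝒟_j = x_j ∂_{x_j} + β ∑_{k<j} x_j/(x_j-x_k) (1-K_{jk}) + β ∑_{k>j} x_k/(x_j-x_k) (1-K_{jk})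
  - β (j-1)`;
since indices start from `0` here, `j - 1` becomes `(j : ℕ)`. -/
def dunklPoly {K : Type} [Field K] (β : K) {N : ℕ} (j : Fin N) :
    MvPolynomial (Fin N) K →ₗ[K] MvPolynomial (Fin N) K :=
  LinearMap.mulLeft K (MvPolynomial.X j) ∘ₗ (MvPolynomial.pderiv j).toLinearMap
    + β • ∑ k ∈ Finset.univ.filter (fun k => k < j),
        LinearMap.mulLeft K (MvPolynomial.X j) ∘ₗ divDiff K j k
    + β • ∑ k ∈ Finset.univ.filter (fun k => j < k),
        LinearMap.mulLeft K (MvPolynomial.X k) ∘ₗ divDiff K j k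
    - (β * ((j : ℕ) : K)) • LinearMap.id

/-- The Dunkl–Cherednik operator `𝒟_j` on superpolynomials; it does not affect the `θ_i`. -/
def dunkl {K : Type} [Field K] (β : K) {N : ℕ} (j : Fin N) :
    Module.End K (Superpoly K N) :=
  (dunklPoly β j).rTensor (ExteriorAlgebra K (Fin N → K))

/-- The operator `θ_i ∂_{θ_i}`; `∂_{θ_i}` is the left derivative, i.e. contraction with the
`i`-th coordinate form. -/
def thetaDTheta (K : Type) [Field K] {N : ℕ} (i : Fin N) : Module.End K (Superpoly K N) :=
  (LinearMap.mulLeft K (ExteriorAlgebra.ι K (Pi.single i (1 : K))) ∘ₗ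
    CliffordAlgebra.contractLeft (LinearMap.proj i)).lTensor (MvPolynomial (Fin N) K)

/-- The Euler operator `∑_i x_i ∂_{x_i}`. -/
def euler (K : Type) [Field K] (N : ℕ) : Module.End K (Superpoly K N) :=
  (∑ i : Fin N, LinearMap.mulLeft K (MvPolynomial.X i) ∘ₗ
    (MvPolynomial.pderiv i).toLinearMap).rTensor (ExteriorAlgebra K (Fin N → K))

/-- `ℋ_r = ∑_j 𝒟_j ^ r`. -/
def chargeH {K : Type} [Field K] (β : K) (N r : ℕ) : Module.End K (Superpoly K N) :=
  ∑ j : Fin N, dunkl β j ^ r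

/-- `ℐ_s = 1/(N-1)! ∑_{σ ∈ S_N} 𝒦_σ (θ₁ ∂_{θ₁} 𝒟₁ ^ s) 𝒦_σ⁻¹` (and `0` if there is no variable). -/
def chargeI {K : Type} [Field K] (β : K) : (N s : ℕ) → Module.End K (Superpoly K N)
  | 0, _ => 0
  | n + 1, s => ((n.factorial : K)⁻¹) • ∑ σ : Equiv.Perm (Fin (n + 1)),
      (diagPerm K σ).toLinearMap ∘ₗ (thetaDTheta K 0 ∘ₗ dunkl β 0 ^ s) ∘ₗ
        (diagPerm K σ⁻¹).toLinearMap

/-- The Hamiltonian `ℋ = ℋ₂ + β (N-1) ℋ₁ - cst` of the stCMS model in `N` variables. The constant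
`cst = β² N (N-1) (2-N) / 6` is the one for which `ℋ 1 = 0`, that is, for which, on symmetric
superpolynomials,
`ℋ = ∑_i (x_i ∂_{x_i})² + β ∑_{i<j} (x_i+x_j)/(x_i-x_j) (x_i ∂_{x_i} - x_j ∂_{x_j})
  - 2 β ∑_{i<j} x_i x_j/(x_i-x_j)² (1-κ_{ij})`. -/
def hamiltonian {K : Type} [Field K] (β : K) (N : ℕ) : Module.End K (Superpoly K N) :=
  chargeH β N 2 + (β * ((N : K) - 1)) • chargeH β N 1
    - (β ^ 2 * (N : K) * ((N : K) - 1) * (2 - (N : K)) / 6) • LinearMap.id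

/-! ### Symmetric superfunctions in infinitely many variables -/

theorem degreeLE_mono (K : Type) [Field K] (N : ℕ) {c d : ℕ} (h : c ≤ d) :
    degreeLE K N c ≤ degreeLE K N d :=
  Submodule.span_mono fun _ ⟨f, g, hf, ht⟩ => ⟨f, g, hf.trans h, ht⟩

theorem mul_mem_degreeLE {K : Type} [Field K] {N c d : ℕ} {a b : Superpoly K N}
    (ha : a ∈ degreeLE K N c) (hb : b ∈ degreeLE K N d) : a * b ∈ degreeLE K N (c + d) := by
  have h : degreeLE K N c * degreeLE K N d ≤ degreeLE K N (c + d) := by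
    rw [degreeLE, degreeLE, Submodule.span_mul_span, Submodule.span_le]
    rintro _ ⟨_, ⟨f, g, hf, rfl⟩, _, ⟨f', g', hf', rfl⟩, rfl⟩
    exact Submodule.subset_span ⟨f * f', g * g',
      (MvPolynomial.totalDegree_mul _ _).trans (add_le_add hf hf'),
      Algebra.TensorProduct.tmul_mul_tmul _ _ _ _⟩
  exact h (Submodule.mul_mem_mul ha hb)

theorem algebraMap_mem_degreeLE {K : Type} [Field K] (N : ℕ) (c : K) :
    algebraMap K (Superpoly K N) c ∈ degreeLE K N 0 :=
  Submodule.subset_span ⟨MvPolynomial.C c, 1, by simp, rfl⟩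

/-- The algebra of symmetric superfunctions in infinitely many variables: families
`F = (F_N)_N` of superpolynomials `F_N(x₁, …, x_N, θ₁, …, θ_N)` that are invariant under the
diagonal action of `S_N`, compatible with restriction of the variables, and of bounded degree. -/
def symmetricSuperfunctions (K : Type) [Field K] : Subalgebra K (∀ N : ℕ, Superpoly K N) where
  carrier := {F | (∀ N (σ : Equiv.Perm (Fin N)), diagPerm K σ (F N) = F N) ∧
    (∀ N, restrictVars K N (F (N + 1)) = F N) ∧
    ∃ d : ℕ, ∀ N, F N ∈ degreeLE K N d}
  mul_mem' := by
    rintro F G ⟨hF, hF', c, hc⟩ ⟨hG, hG', d, hd⟩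
    refine ⟨fun N σ => ?_, fun N => ?_, c + d, fun N => mul_mem_degreeLE (hc N) (hd N)⟩
    · rw [Pi.mul_apply, map_mul, hF, hG]
    · rw [Pi.mul_apply, map_mul, hF', hG', Pi.mul_apply]
  add_mem' := by
    rintro F G ⟨hF, hF', c, hc⟩ ⟨hG, hG', d, hd⟩
    refine ⟨fun N σ => ?_, fun N => ?_, max c d, fun N => add_mem
      (degreeLE_mono K N (le_max_left c d) (hc N)) (degreeLE_mono K N (le_max_right c d) (hd N))⟩
    · rw [Pi.add_apply, map_add, hF, hG]
    · rw [Pi.add_apply, map_add, hF', hG', Pi.add_apply]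
  algebraMap_mem' := fun r =>
    ⟨fun N σ => AlgHom.commutes _ r, fun N => AlgHom.commutes _ r, 0,
      fun N => algebraMap_mem_degreeLE N r⟩

theorem mem_symmetricSuperfunctions {K : Type} [Field K] {F : ∀ N : ℕ, Superpoly K N} :
    F ∈ symmetricSuperfunctions K ↔
      (∀ N (σ : Equiv.Perm (Fin N)), diagPerm K σ (F N) = F N) ∧
      (∀ N, restrictVars K N (F (N + 1)) = F N) ∧
      ∃ d : ℕ, ∀ N, F N ∈ degreeLE K N d :=
  Iff.rfl

theorem diagPerm_xVar (K : Type) [Field K] {N : ℕ} (σ : Equiv.Perm (Fin N)) (i : Fin N) :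
    diagPerm K σ (xVar K i) = xVar K (σ i) := by
  simp [diagPerm, xVar]

theorem diagPerm_thetaVar (K : Type) [Field K] {N : ℕ} (σ : Equiv.Perm (Fin N)) (i : Fin N) :
    diagPerm K σ (thetaVar K i) = thetaVar K (σ i) := by
  have h : LinearMap.funLeft K K σ.symm (Pi.single i (1 : K)) = Pi.single (σ i) 1 := by
    ext j
    simp [LinearMap.funLeft_apply, Pi.single_apply, Equiv.symm_apply_eq]
  simp [diagPerm, thetaVar, h]

theorem restrictVars_xVar_castSucc (K : Type) [Field K] {N : ℕ} (i : Fin N) :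
    restrictVars K N (xVar K i.castSucc) = xVar K i := by
  simp [restrictVars, xVar]

theorem restrictVars_xVar_last (K : Type) [Field K] (N : ℕ) :
    restrictVars K N (xVar K (Fin.last N)) = 0 := by
  simp [restrictVars, xVar]

theorem restrictVars_thetaVar_castSucc (K : Type) [Field K] {N : ℕ} (i : Fin N) :
    restrictVars K N (thetaVar K i.castSucc) = thetaVar K i := by
  have h : LinearMap.funLeft K K Fin.castSucc (Pi.single i.castSucc (1 : K)) = Pi.single i 1 := by
    ext j
    simp [LinearMap.funLeft_apply, Pi.single_apply]
  simp [restrictVars, thetaVar, h]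

theorem restrictVars_thetaVar_last (K : Type) [Field K] (N : ℕ) :
    restrictVars K N (thetaVar K (Fin.last N)) = 0 := by
  have h : LinearMap.funLeft K K Fin.castSucc (Pi.single (Fin.last N) (1 : K)) = 0 := by
    ext j
    simp [LinearMap.funLeft_apply, (Fin.castSucc_lt_last j).ne]
  simp [restrictVars, thetaVar, h]

theorem xVar_mem_degreeLE (K : Type) [Field K] {N : ℕ} (i : Fin N) :
    xVar K i ∈ degreeLE K N 1 :=
  Submodule.subset_span ⟨MvPolynomial.X i, 1, by simp, rfl⟩

theorem thetaVar_mem_degreeLE (K : Type) [Field K] {N : ℕ} (i : Fin N) :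
    thetaVar K i ∈ degreeLE K N 0 :=
  Submodule.subset_span ⟨1, _, by simp, rfl⟩

theorem xVar_pow_mem_degreeLE (K : Type) [Field K] {N : ℕ} (i : Fin N) (n : ℕ) :
    xVar K i ^ n ∈ degreeLE K N n := by
  induction n with
  | zero => rw [pow_zero, ← map_one (algebraMap K (Superpoly K N))]; exact algebraMap_mem_degreeLE N 1
  | succ n ih => rw [pow_succ]; exact mul_mem_degreeLE ih (xVar_mem_degreeLE K i)

/-- The bosonic power sum `p_n = ∑_i x_i ^ n`, for `n ≥ 1`. -/
def bosonicPowerSum (K : Type) [Field K] (n : ℕ+) : symmetricSuperfunctions K :=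
  ⟨fun N => ∑ i : Fin N, xVar K i ^ (n : ℕ), by
    refine mem_symmetricSuperfunctions.2 ⟨fun N σ => ?_, fun N => ?_, n, fun N =>
      sum_mem fun i _ => xVar_pow_mem_degreeLE K i n⟩
    · simp only [map_sum, map_pow, diagPerm_xVar]
      exact Equiv.sum_comp σ (fun i => xVar K i ^ (n : ℕ))
    · rw [Fin.sum_univ_castSucc, map_add, map_sum, map_pow, restrictVars_xVar_last,
        zero_pow n.pos.ne', add_zero]
      simp only [map_pow, restrictVars_xVar_castSucc]⟩

/-- The fermionic power sum `p̃_n = ∑_i θ_i x_i ^ n`, for `n ≥ 0`. -/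
def fermionicPowerSum (K : Type) [Field K] (n : ℕ) : symmetricSuperfunctions K :=
  ⟨fun N => ∑ i : Fin N, thetaVar K i * xVar K i ^ n, by
    refine mem_symmetricSuperfunctions.2 ⟨fun N σ => ?_, fun N => ?_, 0 + n, fun N =>
      sum_mem fun i _ =>
        mul_mem_degreeLE (thetaVar_mem_degreeLE K i) (xVar_pow_mem_degreeLE K i n)⟩
    · simp only [map_sum, map_mul, map_pow, diagPerm_xVar, diagPerm_thetaVar]
      exact Equiv.sum_comp σ (fun i => thetaVar K i * xVar K i ^ n)
    · rw [Fin.sum_univ_castSucc, map_add, map_sum, map_mul, restrictVars_thetaVar_last, zero_mul,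
        add_zero]
      simp only [map_mul, map_pow, restrictVars_xVar_castSucc, restrictVars_thetaVar_castSucc]⟩

/-! ### Superpartitions and the combinatorial scalar product -/

/-- A superpartition `Λ = (Λᵃ; Λˢ)`: the strictly decreasing part `Λᵃ` (non-negative entries) is
given by the set of its entries, the partition `Λˢ` by the multiset of its positive parts. -/
abbrev Superpartition : Type := Finset ℕ × Multiset ℕ+

/-- The length `ℓ(Λ)`: the number of entries of `Λᵃ` plus the number of positive parts of `Λˢ`. -/
def Superpartition.length (L : Superpartition) : ℕ := L.1.card + L.2.card

/-- `z_Λ = ∏_{k ≥ 1} k ^ n(k) · n(k)!`, with `n(k)` the number of parts of `Λˢ` equal to `k`. -/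
def Superpartition.z (L : Superpartition) : ℕ :=
  ∏ k ∈ L.2.toFinset, (k : ℕ) ^ L.2.count k * (L.2.count k).factorial

/-- `p_Λ = p̃_{Λ₁} ⋯ p̃_{Λ_m} p_{Λ_{m+1}} p_{Λ_{m+2}} ⋯` with `Λ₁ > ⋯ > Λ_m` the entries of `Λᵃ`
and `Λ_{m+1} ≥ Λ_{m+2} ≥ ⋯` the parts of `Λˢ`. -/
def powerSum (K : Type) [Field K] (L : Superpartition) : symmetricSuperfunctions K :=
  ((L.1.sort (· ≥ ·)).map (fermionicPowerSum K)).prod *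
    ((L.2.sort (· ≥ ·)).map (bosonicPowerSum K)).prod

/-- `p_Λ` with the order of its anticommuting factors reversed:
`p̃_{Λ_m} ⋯ p̃_{Λ₁} p_{Λ_{m+1}} p_{Λ_{m+2}} ⋯`. -/
def powerSumRev (K : Type) [Field K] (L : Superpartition) : symmetricSuperfunctions K :=
  ((L.1.sort (· ≤ ·)).map (fermionicPowerSum K)).prod *
    ((L.2.sort (· ≥ ·)).map (bosonicPowerSum K)).prod

/-- The defining property of the combinatorial scalar product `⟨⟨·|·⟩⟩_β`: the pairing of the
reversed `p_Λ` with `p_Ω` is `z_Λ(β) δ_{Λ,Ω}`, where `z_Λ(β) = β ^ (-ℓ(Λ)) z_Λ`. -/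
def IsCombinatorialForm {K : Type} [Field K] (β : K)
    (B : LinearMap.BilinForm K (symmetricSuperfunctions K)) : Prop :=
  ∀ L M : Superpartition, B (powerSumRev K L) (powerSum K M) =
    if L = M then (β ^ L.length)⁻¹ * (L.z : K) else 0

/-! ### The operators on symmetric superfunctions -/

/-- The operator `ℐ = ℐ₁` on families: it acts on the `M`-variable component as `ℐ₁` in `M`
variables. -/
def familyI {K : Type} [Field K] (β : K) : Module.End K (∀ M : ℕ, Superpoly K M) :=
  LinearMap.pi fun M => chargeI β M 1 ∘ₗ LinearMap.proj M

/-- The Hamiltonian `ℋ` with parameter `N` on families. The Hamiltonian in `M` variables depends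
on the number of variables through the term `β M ∑_i x_i ∂_{x_i}` (it commutes with restriction of
the variables only up to this term). With this term replaced by `β N ∑_i x_i ∂_{x_i}` in
every component, one obtains the operator on superfunctions of infinitely many variables whose
component in `N` variables is the `N`-variable Hamiltonian itself. -/
def familyH {K : Type} [Field K] (β : K) (N : ℕ) : Module.End K (∀ M : ℕ, Superpoly K M) :=
  LinearMap.pi fun M =>
    (hamiltonian β M + (β * ((N : K) - (M : K))) • euler K M) ∘ₗ LinearMap.proj M

end Superspace

end

/-! The plan is to write both operators in the generators p_n, p̃_n, where self-adjointness can be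
read off term by term, and to show that the p_Λ form a basis, so that nothing is lost in this
description.

The Hamiltonian. Write 𝒟_j = x_j∂_j + β Σ_k A_jk. The relations A_jk + A_kj = -1 and A_jk² + A_kj² =
1, and a relation on three indices (`threeBody_eq_two`), reduce all terms of order β² in ℋ to
constants, which cancel; what remains is Σ_j (x_j∂_j)² plus a two-body part (`hamPoly_eq`). On a
superpolynomial invariant under all 𝒦_σ, the exchange K_jk of x_j, x_k acts as the exchange κ_jk of
θ_j, θ_k, and 1 - κ_jk = (θ_j - θ_k)(∂_{θ_j} - ∂_{θ_k}) is a derivation (`sub_swapTheta`). So the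
two-body part obeys the Leibniz rule on symmetric superpolynomials, and the defect of ℋ from being a
derivation comes only from the second derivatives (`hamiltonian_mul`). The charge ℐ is treated in
the same way (`chargeI_mul`).

These product rules and the values on p_n and p̃_n determine the operators on all p_Λ
(`realize_fockHamiltonian`, `realize_fockCharge`): with a ≥ 1 throughout and with b ≥ 1 for bosonic,
b ≥ 0 for fermionic indices, ℋ = diagonal + β Σ (a+b) p_a p_b ∂_{p_{a+b}} + 2β Σ b p_a p̃_b
∂_{p̃_{a+b}} + Σ ab p_{a+b} ∂_{p_a}∂_{p_b} + 2 Σ ab p̃_{a+b} ∂_{p̃_b}∂_{p_a}, ℐ = diagonal + β Σ p_a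
p̃_b ∂_{p̃_{a+b}} + Σ a p̃_{a+b} ∂_{p̃_b}∂_{p_a}. The correction β(N-M)E^{(M)} makes the first
formula independent of the number M of variables.

For the form with ⟨Λ, Ω⟩ = z_Λ(β) δ_ΛΩ, the adjoint of p_n is (n/β) ∂_{p_n} and that of p̃_n is β⁻¹
∂_{p̃_n}. Taking adjoints therefore exchanges the terms that split a part with those that join two
parts. Reversing the odd factors only introduces a sign depending on their number, which both
operators preserve.

The basis. Split off one pair (x₀, θ₀) of variables: p_k = x₀^k + (p_k in the rest), and likewise
for p̃_k. Taking the coefficient of x₀ⁿ or θ₀x₀ⁿ acts on products of power sums as ∂_{p_n} or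
∂_{p̃_n} modulo shorter products, which gives linear independence by induction on the length
(`realize_injective_of_shorter`). Iterated coefficients, indexed by superpartitions, determine a
symmetric superfunction, and those of weight above d vanish in degree at most d; counting dimensions
shows that the p_Λ span (`expand_surjective`). -/

noncomputable section

namespace Superspace

open MvPolynomial

variable {K : Type} [Field K] {N : ℕ}

/-! ### Exchanges and divided differences -/

/-- The operator exchanging `x_j` and `x_k`. -/
def swapX (K : Type) [Field K] {N : ℕ} (j k : Fin N) : Module.End K (MvPolynomial (Fin N) K) :=
  (rename (Equiv.swap j k)).toLinearMap

/-- The operator `x_j ∂_{x_j}`. -/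
def xDeriv (K : Type) [Field K] {N : ℕ} (j : Fin N) : Module.End K (MvPolynomial (Fin N) K) :=
  LinearMap.mulLeft K (X j) ∘ₗ (pderiv j).toLinearMap

/-- The operator `x_k / (x_j - x_k) (1 - K_{jk})`. -/
def xDivDiff (K : Type) [Field K] {N : ℕ} (j k : Fin N) : Module.End K (MvPolynomial (Fin N) K) :=
  LinearMap.mulLeft K (X k) ∘ₗ divDiff K j k

theorem swapX_apply (j k : Fin N) (f : MvPolynomial (Fin N) K) :
    swapX K j k f = rename (Equiv.swap j k) f := rfl

theorem xDeriv_apply (j : Fin N) (f : MvPolynomial (Fin N) K) :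
    xDeriv K j f = X j * pderiv j f := rfl

theorem xDivDiff_apply (j k : Fin N) (f : MvPolynomial (Fin N) K) :
    xDivDiff K j k f = X k * divDiff K j k f := rfl

theorem divDiff_self (j : Fin N) : divDiff K j j = 0 := by
  rw [divDiff, dif_pos rfl]

theorem rename_divDiff (σ : Equiv.Perm (Fin N)) (j k : Fin N) (f : MvPolynomial (Fin N) K) :
    rename σ (divDiff K j k f) = divDiff K (σ j) (σ k) (rename σ f) := by
  by_cases h : j = k
  · subst h; simp [divDiff_self]
  have h' : σ j ≠ σ k := fun e => h (σ.injective e)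
  apply mul_left_cancel₀ (X_sub_X_ne_zero K h')
  rw [divDiff_spec K h']
  have := congrArg (rename σ) (divDiff_spec K h f)
  rw [map_mul, map_sub, map_sub, rename_X, rename_X, rename_rename] at this
  rw [this, rename_rename]
  congr 3
  ext x
  simp [Equiv.swap_apply_def, apply_ite σ, σ.injective.eq_iff]

theorem rename_xDivDiff (σ : Equiv.Perm (Fin N)) (j k : Fin N) (f : MvPolynomial (Fin N) K) :
    rename σ (xDivDiff K j k f) = xDivDiff K (σ j) (σ k) (rename σ f) := by
  rw [xDivDiff_apply, xDivDiff_apply, map_mul, rename_X, rename_divDiff]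

theorem rename_xDeriv (σ : Equiv.Perm (Fin N)) (j : Fin N) (f : MvPolynomial (Fin N) K) :
    rename σ (xDeriv K j f) = xDeriv K (σ j) (rename σ f) := by
  rw [xDeriv_apply, xDeriv_apply, map_mul, rename_X, pderiv_rename σ.injective]

theorem xDivDiff_spec {j k : Fin N} (h : j ≠ k) (f : MvPolynomial (Fin N) K) :
    (X j - X k) * xDivDiff K j k f = X k * (f - swapX K j k f) := by
  rw [xDivDiff_apply, mul_left_comm, divDiff_spec K h, swapX_apply]

theorem swapX_swapX (j k : Fin N) (f : MvPolynomial (Fin N) K) :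
    swapX K j k (swapX K j k f) = f := by
  rw [swapX_apply, swapX_apply, rename_rename]
  have : (Equiv.swap j k : Fin N → Fin N) ∘ Equiv.swap j k = id := by ext x; simp
  rw [this, rename_id_apply]

theorem swapX_comm (j k : Fin N) : swapX K j k = swapX K k j := by
  rw [swapX, swapX, Equiv.swap_comm]

theorem swapX_mul (j k : Fin N) (f g : MvPolynomial (Fin N) K) :
    swapX K j k (f * g) = swapX K j k f * swapX K j k g :=
  map_mul (rename (Equiv.swap j k)) f g

/-- The third factor is the image of x_k - x_l under K_ij: it clears the denominator of the inner
quotient after the outer exchange has acted. Products of two divided differences thereby become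
polynomial combinations of f and its images under exchanges. -/
theorem xDivDiff_xDivDiff_spec {i j k l : Fin N} (h : i ≠ j) (h' : k ≠ l)
    (f : MvPolynomial (Fin N) K) :
    (X i - X j) * ((X k - X l) * ((X (Equiv.swap i j k) - X (Equiv.swap i j l)) *
      xDivDiff K i j (xDivDiff K k l f))) =
    X j * (X l * (X (Equiv.swap i j k) - X (Equiv.swap i j l)) * (f - swapX K k l f) -
      X (Equiv.swap i j l) * (X k - X l) * (swapX K i j f - swapX K i j (swapX K k l f))) := by
  have h1 := xDivDiff_spec h (xDivDiff K k l f)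
  have h2 := xDivDiff_spec h' f
  have h3 := congrArg (swapX K i j) h2
  simp only [swapX_mul, map_sub] at h3
  simp only [swapX_apply, rename_X] at h1 h2 h3 ⊢
  linear_combination (X k - X l) * (X (Equiv.swap i j k) - X (Equiv.swap i j l)) * h1 +
    X j * (X (Equiv.swap i j k) - X (Equiv.swap i j l)) * h2 - X j * (X k - X l) * h3

theorem swapX_conj (a b c d : Fin N) (f : MvPolynomial (Fin N) K) :
    swapX K a b (swapX K c d f) =
      swapX K (Equiv.swap a b c) (Equiv.swap a b d) (swapX K a b f) := by
  simp only [swapX_apply, rename_rename]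
  congr 2
  ext x
  simp [Equiv.swap_apply_def, apply_ite (Equiv.swap a b)]
  split_ifs <;> simp_all

/-- The relation behind the absence of three-body interactions. After multiplication by the
Vandermonde product in x_a, x_b, x_c it is a linear relation between f, its images under the three
exchanges and under the two 3-cycles, with polynomial coefficients that all vanish. -/
theorem xDivDiff_three_term {a b c : Fin N} (hab : a ≠ b) (hac : a ≠ c) (hbc : b ≠ c)
    (f : MvPolynomial (Fin N) K) :
    2 * xDivDiff K a c f + xDivDiff K a b (xDivDiff K a c f) + xDivDiff K a c (xDivDiff K a b f)
      - xDivDiff K a b (xDivDiff K b c f) - xDivDiff K b c (xDivDiff K a b f)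
      + xDivDiff K a c (xDivDiff K b c f) + xDivDiff K b c (xDivDiff K a c f) = 0 := by
  have hV : ((X a - X b) * ((X a - X c) * (X b - X c)) : MvPolynomial (Fin N) K) ≠ 0 :=
    mul_ne_zero (X_sub_X_ne_zero K hab)
      (mul_ne_zero (X_sub_X_ne_zero K hac) (X_sub_X_ne_zero K hbc))
  apply (mul_eq_zero_iff_left hV).1
  rw [mul_comm]
  have h0 := xDivDiff_spec hac f
  have h1 := xDivDiff_xDivDiff_spec hab hac f
  have h2 := xDivDiff_xDivDiff_spec hac hab f
  have h3 := xDivDiff_xDivDiff_spec hab hbc f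
  have h4 := xDivDiff_xDivDiff_spec hbc hab f
  have h5 := xDivDiff_xDivDiff_spec hac hbc f
  have h6 := xDivDiff_xDivDiff_spec hbc hac f
  have e1 := swapX_conj a b a c f
  have e2 := swapX_conj a b b c f
  have e3 := swapX_conj a c a b f
  have e4 := swapX_conj a c b c f
  have e5 := swapX_conj b c a b f
  have e6 := swapX_conj b c a c f
  simp only [Equiv.swap_apply_left, Equiv.swap_apply_right,
    Equiv.swap_apply_of_ne_of_ne hac.symm hbc.symm,
    Equiv.swap_apply_of_ne_of_ne hab.symm hbc, Equiv.swap_apply_of_ne_of_ne hab hac,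
    swapX_comm c b, swapX_comm b a] at h1 h2 h3 h4 h5 h6 e1 e2 e3 e4 e5 e6
  rw [e1, e5] at h1
  rw [e3] at h2
  rw [e2, e3] at h3
  rw [e5] at h4
  linear_combination 2 * (X a - X b) * (X b - X c) * h0 + h1 - h2 - h3 - h4 - h5 + h6

theorem sq_add_neg_one_sub_sq {R : Type*} [Ring R] {p : R} (h : p * p = -p) :
    p * p + (-1 - p) * (-1 - p) = 1 := by
  have : (-1 - p) * (-1 - p) = 1 + 2 * p + p * p := by noncomm_ring
  rw [this, h]
  noncomm_ring

theorem three_term_aux {R : Type*} [Ring R] {p q r : R}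
    (h : 2 * q + p * q + q * p - p * r - r * p + q * r + r * q = 0) :
    p * q + q * p + ((-1 - p) * r + r * (-1 - p)) + ((-1 - q) * (-1 - r) + (-1 - r) * (-1 - q))
      = 2 := by
  rw [← sub_eq_zero, ← h, ← one_add_one_eq_two]
  noncomm_ring

theorem pair_symm_aux {R : Type*} [Ring R] (d e p : R) :
    (d - e) * p + p * (d - e) + (d - e) =
      (e - d) * (-1 - p) + (-1 - p) * (e - d) + (e - d) := by
  noncomm_ring

/-! ### Two-body and three-body relations of the Dunkl–Cherednik operators -/

/-- The part of the Dunkl–Cherednik operator `𝒟_j` that involves `x_k`, without the factor `β`. -/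
def dunklPart (K : Type) [Field K] {N : ℕ} (j k : Fin N) :
    Module.End K (MvPolynomial (Fin N) K) :=
  xDivDiff K j k - if k < j then swapX K j k else 0

theorem dunklPart_of_lt {j k : Fin N} (h : j < k) : dunklPart K j k = xDivDiff K j k := by
  rw [dunklPart, if_neg h.asymm, sub_zero]

theorem dunklPart_self (j : Fin N) : dunklPart K j j = 0 := by
  rw [dunklPart, if_neg (lt_irrefl j), xDivDiff, divDiff_self, LinearMap.comp_zero, sub_zero]

theorem xDivDiff_add_xDivDiff {j k : Fin N} (h : j ≠ k) :
    xDivDiff K j k + xDivDiff K k j = swapX K k j - 1 := by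
  refine LinearMap.ext fun f => mul_left_cancel₀ (X_sub_X_ne_zero K h) ?_
  have h1 := xDivDiff_spec h f
  have h2 := xDivDiff_spec h.symm f
  rw [swapX_comm j k] at h1
  simp only [LinearMap.add_apply, LinearMap.sub_apply, Module.End.one_apply]
  linear_combination h1 - h2

/-- The constant -β(j-1) of 𝒟_j has been shared among the indices k < j; with this choice the sum of
the two opposite parts does not depend on the order of j and k. -/
theorem dunklPart_add_dunklPart {j k : Fin N} (h : j ≠ k) :
    dunklPart K j k + dunklPart K k j = -1 := by
  have aux : ∀ {j k : Fin N}, j < k → dunklPart K j k + dunklPart K k j = -1 := by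
    intro j k h
    rw [dunklPart_of_lt h, dunklPart, if_pos h, ← add_sub_assoc, xDivDiff_add_xDivDiff h.ne]
    abel
  rcases h.lt_or_gt with h | h
  · exact aux h
  · rw [add_comm]; exact aux h

/-- With c = x_k/(x_j - x_k) and c' its image under K = K_jk, one has (1-K)c(1-K) = (c + c')(1-K),
because K(1-K) = -(1-K), and c + c' = -1. -/
theorem xDivDiff_mul_self {j k : Fin N} (h : j ≠ k) :
    xDivDiff K j k * xDivDiff K j k = -xDivDiff K j k := by
  refine LinearMap.ext fun f => mul_left_cancel₀ (X_sub_X_ne_zero K h)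
    (mul_left_cancel₀ (X_sub_X_ne_zero K h) (mul_left_cancel₀ (X_sub_X_ne_zero K h) ?_))
  have h1 := xDivDiff_xDivDiff_spec h h f
  have h2 := xDivDiff_spec h f
  rw [swapX_swapX] at h1
  simp only [Equiv.swap_apply_left, Equiv.swap_apply_right] at h1
  simp only [Module.End.mul_apply, LinearMap.neg_apply]
  linear_combination -h1 + (X j - X k) ^ 2 * h2

theorem dunklPart_sq_add_sq {j k : Fin N} (h : j ≠ k) :
    dunklPart K j k * dunklPart K j k + dunklPart K k j * dunklPart K k j = 1 := by
  have aux : ∀ {j k : Fin N}, j < k →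
      dunklPart K j k * dunklPart K j k + dunklPart K k j * dunklPart K k j = 1 := by
    intro j k h
    have h1 := dunklPart_add_dunklPart (K := K) h.ne
    have h2 : dunklPart K j k * dunklPart K j k = -dunklPart K j k := by
      rw [dunklPart_of_lt h, xDivDiff_mul_self h.ne]
    rw [eq_sub_of_add_eq' h1]
    exact sq_add_neg_one_sub_sq h2
  rcases h.lt_or_gt with h | h
  · exact aux h
  · rw [add_comm]; exact aux h

/-- The sum over the three-body terms of `∑_j 𝒟_j²` on a triple of indices. -/
def threeBody (K : Type) [Field K] {N : ℕ} (a b c : Fin N) :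
    Module.End K (MvPolynomial (Fin N) K) :=
  dunklPart K a b * dunklPart K a c + dunklPart K a c * dunklPart K a b
    + (dunklPart K b a * dunklPart K b c + dunklPart K b c * dunklPart K b a)
    + (dunklPart K c a * dunklPart K c b + dunklPart K c b * dunklPart K c a)

/-- Replacing the three parts with decreasing indices by -1 minus the opposite ones turns the
expression into the left side of `xDivDiff_three_term` plus 2. Other orders of the indices follow
because the expression is symmetric in them. -/
theorem threeBody_of_lt {a b c : Fin N} (hab : a < b) (hbc : b < c) : threeBody K a b c = 2 := by
  have hac := hab.trans hbc
  have h : 2 * xDivDiff K a c + xDivDiff K a b * xDivDiff K a c + xDivDiff K a c * xDivDiff K a b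
      - xDivDiff K a b * xDivDiff K b c - xDivDiff K b c * xDivDiff K a b
      + xDivDiff K a c * xDivDiff K b c + xDivDiff K b c * xDivDiff K a c = 0 := by
    refine LinearMap.ext fun f => ?_
    simpa [two_mul] using xDivDiff_three_term hab.ne hac.ne hbc.ne f
  rw [threeBody, eq_sub_of_add_eq' (dunklPart_add_dunklPart hab.ne),
    eq_sub_of_add_eq' (dunklPart_add_dunklPart hac.ne),
    eq_sub_of_add_eq' (dunklPart_add_dunklPart hbc.ne), dunklPart_of_lt hab, dunklPart_of_lt hac,
    dunklPart_of_lt hbc]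
  exact three_term_aux h

theorem threeBody_swap_left (a b c : Fin N) : threeBody K b a c = threeBody K a b c := by
  rw [threeBody, threeBody]; abel

theorem threeBody_swap_right (a b c : Fin N) : threeBody K a c b = threeBody K a b c := by
  rw [threeBody, threeBody]; abel

theorem threeBody_eq_two {a b c : Fin N} (hab : a ≠ b) (hac : a ≠ c) (hbc : b ≠ c) :
    threeBody K a b c = 2 := by
  rcases hab.lt_or_gt with h1 | h1 <;> rcases hac.lt_or_gt with h2 | h2 <;>
    rcases hbc.lt_or_gt with h3 | h3
  · exact threeBody_of_lt h1 h3
  · rw [← threeBody_swap_right]; exact threeBody_of_lt h2 h3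
  · exact absurd (h1.trans h3) h2.asymm
  · rw [← threeBody_swap_right, ← threeBody_swap_left]; exact threeBody_of_lt h2 h1
  · rw [← threeBody_swap_left]; exact threeBody_of_lt h1 h2
  · exact absurd (h1.trans h2) h3.asymm
  · rw [← threeBody_swap_left, ← threeBody_swap_right]; exact threeBody_of_lt h3 h2
  · rw [← threeBody_swap_left, ← threeBody_swap_right, ← threeBody_swap_left]
    exact threeBody_of_lt h3 h1

/-- For k < j, x_j/(x_j - x_k) = 1 + x_k/(x_j - x_k), so each such term exceeds its part by 1. The
excess is the number of indices below j, and -βj removes it. -/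
theorem dunklPoly_eq (β : K) (j : Fin N) :
    dunklPoly β j = xDeriv K j + β • ∑ k, dunklPart K j k := by
  have h : ∀ k ∈ Finset.univ.filter (fun k => k < j),
      LinearMap.mulLeft K (X j) ∘ₗ divDiff K j k = dunklPart K j k + 1 := by
    intro k hk
    have hk := (Finset.mem_filter.1 hk).2
    rw [dunklPart, if_pos hk]
    refine LinearMap.ext fun f => ?_
    have := divDiff_spec K hk.ne' f
    simp only [LinearMap.comp_apply, LinearMap.mulLeft_apply, LinearMap.add_apply,
      LinearMap.sub_apply, Module.End.one_apply, xDivDiff_apply, swapX_apply]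
    linear_combination this
  have h' : ∀ k ∈ Finset.univ.filter (fun k => j < k),
      LinearMap.mulLeft K (X k) ∘ₗ divDiff K j k = dunklPart K j k := fun k hk => by
    rw [dunklPart_of_lt (Finset.mem_filter.1 hk).2]; rfl
  have hs : ∑ k, dunklPart K j k = ∑ k ∈ Finset.univ.filter (fun k => k < j), dunklPart K j k
      + ∑ k ∈ Finset.univ.filter (fun k => j < k), dunklPart K j k := by
    rw [Finset.sum_filter, Finset.sum_filter, ← Finset.sum_add_distrib]
    refine Finset.sum_congr rfl fun k _ => ?_
    rcases lt_trichotomy k j with hk | rfl | hk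
    · simp [hk, hk.asymm]
    · simp [dunklPart_self]
    · simp [hk, hk.asymm]
  have hc : (Finset.univ.filter (fun k => k < j)).card = (j : ℕ) := by
    rw [Finset.filter_gt_eq_Iio, Fin.card_Iio]
  rw [dunklPoly, Finset.sum_congr rfl h, Finset.sum_congr rfl h', hs, Finset.sum_add_distrib,
    Finset.sum_const, hc, smul_add, smul_add, mul_smul, Nat.cast_smul_eq_nsmul]
  change xDeriv K j + _ + _ - _ • (j : ℕ) • (1 : Module.End K _) = _
  abel

/-! ### The two-body form of the Hamiltonian -/

/-- The two-body part of the Hamiltonian. -/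
def pairOp (K : Type) [Field K] {N : ℕ} (j k : Fin N) : Module.End K (MvPolynomial (Fin N) K) :=
  if j = k then 0 else
    (xDeriv K j - xDeriv K k) * dunklPart K j k + dunklPart K j k * (xDeriv K j - xDeriv K k)
      + (xDeriv K j - xDeriv K k)

theorem pairOp_self (j : Fin N) : pairOp K j j = 0 := if_pos rfl

/-- Exchanging j and k replaces A_jk by -1 - A_jk; the linear term x_j∂_j - x_k∂_k in `pairOp` is
what compensates for the -1. -/
theorem pairOp_comm (j k : Fin N) : pairOp K j k = pairOp K k j := by
  by_cases h : j = k
  · rw [h]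
  rw [pairOp, pairOp, if_neg h, if_neg (Ne.symm h),
    eq_sub_of_add_eq' (dunklPart_add_dunklPart h)]
  exact pair_symm_aux _ _ _

theorem sum_ne_eq (a : Fin N) (c : K) :
    ∑ b : Fin N, (if a ≠ b then c else 0) = ((N : K) - 1) * c := by
  have h : ∀ b : Fin N, (if a ≠ b then c else 0) = c - if a = b then c else 0 := by
    intro b; split_ifs <;> simp_all
  simp only [h, Finset.sum_sub_distrib, Finset.sum_const, Finset.card_univ, Fintype.card_fin,
    Finset.sum_ite_eq, Finset.mem_univ, if_true, nsmul_eq_mul]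
  ring

theorem sum_ne_ne_eq {a b : Fin N} (hab : a ≠ b) (d : K) :
    ∑ c : Fin N, (if a ≠ c ∧ b ≠ c then d else 0) = ((N : K) - 2) * d := by
  have h : ∀ c : Fin N, (if a ≠ c ∧ b ≠ c then d else 0) =
      d - (if a = c then d else 0) - if b = c then d else 0 := by
    intro c; split_ifs <;> simp_all
  simp only [h, Finset.sum_sub_distrib, Finset.sum_const, Finset.card_univ, Fintype.card_fin,
    Finset.sum_ite_eq, Finset.mem_univ, if_true, nsmul_eq_mul]
  ring

theorem sum_sum_dunklPart [CharZero K] :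
    ∑ j : Fin N, ∑ k, dunklPart K j k =
      (-((N : K) * ((N : K) - 1) / 2)) • (1 : Module.End K (MvPolynomial (Fin N) K)) := by
  have h : ∀ j k : Fin N, dunklPart K j k + dunklPart K k j =
      (if j ≠ k then (-1 : K) else 0) • (1 : Module.End K (MvPolynomial (Fin N) K)) := by
    intro j k
    split_ifs with hjk
    · rw [dunklPart_add_dunklPart hjk]
      exact (neg_one_smul K (1 : Module.End K (MvPolynomial (Fin N) K))).symm
    · rw [not_not] at hjk; subst hjk; simp [dunklPart_self]
  have h2 : (2 : K) • ∑ j : Fin N, ∑ k, dunklPart K j k =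
      (-((N : K) * ((N : K) - 1))) • (1 : Module.End K (MvPolynomial (Fin N) K)) := by
    rw [two_smul]
    nth_rw 2 [Finset.sum_comm]
    simp only [← Finset.sum_add_distrib, h, ← Finset.sum_smul, sum_ne_eq]
    simp only [Finset.sum_const, Finset.card_univ, Fintype.card_fin, nsmul_eq_mul]
    congr 1
    ring
  rw [← smul_right_inj (two_ne_zero : (2 : K) ≠ 0), h2, smul_smul]
  congr 1
  field_simp

theorem sum_dunklPart_sq [CharZero K] :
    ∑ j : Fin N, ∑ k, dunklPart K j k * dunklPart K j k =
      ((N : K) * ((N : K) - 1) / 2) • (1 : Module.End K (MvPolynomial (Fin N) K)) := by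
  have h : ∀ j k : Fin N,
      dunklPart K j k * dunklPart K j k + dunklPart K k j * dunklPart K k j =
      (if j ≠ k then (1 : K) else 0) • (1 : Module.End K (MvPolynomial (Fin N) K)) := by
    intro j k
    split_ifs with hjk
    · rw [dunklPart_sq_add_sq hjk, one_smul]
    · rw [not_not] at hjk; subst hjk; simp [dunklPart_self]
  have h2 : (2 : K) • ∑ j : Fin N, ∑ k, dunklPart K j k * dunklPart K j k =
      ((N : K) * ((N : K) - 1)) • (1 : Module.End K (MvPolynomial (Fin N) K)) := by
    rw [two_smul]
    nth_rw 2 [Finset.sum_comm]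
    simp only [← Finset.sum_add_distrib, h, ← Finset.sum_smul, sum_ne_eq]
    simp only [Finset.sum_const, Finset.card_univ, Fintype.card_fin, nsmul_eq_mul]
    congr 1
    ring
  rw [← smul_right_inj (two_ne_zero : (2 : K) ≠ 0), h2, smul_smul]
  congr 1
  field_simp

theorem six_smul_sum_eq {A ι : Type*} [AddCommGroup A] [Module K A] [Fintype ι]
    (Y : ι → ι → ι → A) :
    (6 : K) • ∑ a, ∑ b, ∑ c, Y a b c = ∑ a, ∑ b, ∑ c,
      (Y a b c + Y a c b + (Y b a c + Y b c a) + (Y c a b + Y c b a)) := by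
  have h1 : ∑ a, ∑ b, ∑ c, Y a c b = ∑ a, ∑ b, ∑ c, Y a b c :=
    Finset.sum_congr rfl fun a _ => Finset.sum_comm
  have h2 : ∑ a, ∑ b, ∑ c, Y b a c = ∑ a, ∑ b, ∑ c, Y a b c := Finset.sum_comm
  have h3 : ∑ a, ∑ b, ∑ c, Y b c a = ∑ a, ∑ b, ∑ c, Y a b c := by
    rw [Finset.sum_comm]
    exact Finset.sum_congr rfl fun a _ => Finset.sum_comm
  have h4 : ∑ a, ∑ b, ∑ c, Y c a b = ∑ a, ∑ b, ∑ c, Y a b c := by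
    calc _ = ∑ a, ∑ c, ∑ b, Y c a b := Finset.sum_congr rfl fun a _ => Finset.sum_comm
      _ = _ := Finset.sum_comm
  have h5 : ∑ a, ∑ b, ∑ c, Y c b a = ∑ a, ∑ b, ∑ c, Y a b c := by
    rw [Finset.sum_comm]
    exact h4
  simp only [Finset.sum_add_distrib, h1, h2, h3, h4, h5]
  module

/-- Symmetrising over the six orders of a triple produces the `threeBody` terms. Each triple of
distinct indices, in any order, contributes 2, and there are N(N-1)(N-2) of them; the total is
divided by 6. -/
theorem sum_dunklPart_mul_of_ne [CharZero K] :
    ∑ j : Fin N, ∑ k, ∑ l, (if k = l then 0 else dunklPart K j k * dunklPart K j l) =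
      ((N : K) * ((N : K) - 1) * ((N : K) - 2) / 3) •
        (1 : Module.End K (MvPolynomial (Fin N) K)) := by
  set Y : Fin N → Fin N → Fin N → Module.End K (MvPolynomial (Fin N) K) :=
    fun j k l => if k = l then 0 else dunklPart K j k * dunklPart K j l with hY
  have h : ∀ a b c : Fin N, Y a b c + Y a c b + (Y b a c + Y b c a) + (Y c a b + Y c b a) =
      (if a ≠ b then (if a ≠ c ∧ b ≠ c then (2 : K) else 0) else 0) •
        (1 : Module.End K (MvPolynomial (Fin N) K)) := by
    intro a b c
    by_cases hab : a = b
    · subst hab; simp [hY, dunklPart_self]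
    by_cases hac : a = c
    · subst hac; simp [hY, dunklPart_self]
    by_cases hbc : b = c
    · subst hbc; simp [hY, dunklPart_self]
    rw [if_pos hab, if_pos ⟨hac, hbc⟩]
    simp only [hY, if_neg hab, if_neg hac, if_neg hbc, if_neg (Ne.symm hab), if_neg (Ne.symm hac),
      if_neg (Ne.symm hbc)]
    refine (threeBody_eq_two hab hac hbc).trans ?_
    rw [two_smul, one_add_one_eq_two]
  have h' : ∀ a b : Fin N, ∑ c, (if a ≠ b then (if a ≠ c ∧ b ≠ c then (2 : K) else 0) else 0) =
      if a ≠ b then ((N : K) - 2) * 2 else 0 := by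
    intro a b
    split_ifs with hab
    · exact sum_ne_ne_eq hab 2
    · simp
  have h6 : (6 : K) • ∑ j, ∑ k, ∑ l, Y j k l = ((N : K) * ((N : K) - 1) * (((N : K) - 2) * 2)) •
        (1 : Module.End K (MvPolynomial (Fin N) K)) := by
    rw [six_smul_sum_eq]
    simp only [h, ← Finset.sum_smul, h', sum_ne_eq]
    simp [mul_assoc]
  rw [← smul_right_inj (by norm_num : (6 : K) ≠ 0), h6, smul_smul]
  congr 1
  ring

theorem anticomm_aux {R : Type*} [Ring R] (e b : R) :
    e * (-1 - b) + (-1 - b) * e = -(e * b + b * e) - (e + e) := by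
  noncomm_ring

/-- Expanding a commutation with x_j∂_j - x_k∂_k gives anticommutators of A_jk with x_j∂_j and with
x_k∂_k. Relabelling and A_kj = -1 - A_jk turn the second kind into the first, at the price of the
term with N - 1. -/
theorem sum_pairOp :
    ∑ j : Fin N, ∑ k, pairOp K j k =
      (2 : K) • ∑ j : Fin N, ∑ k, (xDeriv K j * dunklPart K j k + dunklPart K j k * xDeriv K j)
      + (2 * ((N : K) - 1)) • ∑ j : Fin N, xDeriv K j := by
  have h : ∀ j k : Fin N, pairOp K j k =
      (xDeriv K j * dunklPart K j k + dunklPart K j k * xDeriv K j)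
      - (xDeriv K k * dunklPart K j k + dunklPart K j k * xDeriv K k)
      + (xDeriv K j - xDeriv K k) := by
    intro j k
    rw [pairOp]
    split_ifs with hjk
    · subst hjk; simp
    · simp only [sub_mul, mul_sub]; abel
  have h' : ∀ j k : Fin N, xDeriv K j * dunklPart K k j + dunklPart K k j * xDeriv K j =
      -(xDeriv K j * dunklPart K j k + dunklPart K j k * xDeriv K j)
      - (if j ≠ k then (2 : K) else 0) • xDeriv K j := by
    intro j k
    split_ifs with hjk
    · rw [eq_sub_of_add_eq' (dunklPart_add_dunklPart hjk)]
      have := @two_smul K _ _ _ _ (xDeriv K j)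
      rw [this]
      generalize xDeriv K j = e
      generalize dunklPart K j k = b
      exact anticomm_aux e b
    · rw [not_not] at hjk; subst hjk; simp [dunklPart_self]
  simp only [h, Finset.sum_add_distrib, Finset.sum_sub_distrib]
  rw [Finset.sum_comm (f := fun j k => xDeriv K k * dunklPart K j k),
    Finset.sum_comm (f := fun j k => dunklPart K j k * xDeriv K k),
    Finset.sum_comm (f := fun j k => xDeriv K k), sub_self, add_zero]
  simp only [← Finset.sum_add_distrib, h']
  simp only [Finset.sum_sub_distrib, Finset.sum_neg_distrib, ← Finset.sum_smul, sum_ne_eq]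
  rw [← Finset.smul_sum]
  module

/-- The Hamiltonian on polynomials in the commuting variables. -/
def hamPoly (β : K) (N : ℕ) : Module.End K (MvPolynomial (Fin N) K) :=
  ∑ j : Fin N, dunklPoly β j ^ 2 + (β * ((N : K) - 1)) • ∑ j : Fin N, dunklPoly β j
    - (β ^ 2 * (N : K) * ((N : K) - 1) * (2 - (N : K)) / 6) • LinearMap.id

theorem sq_add_smul_sum {R : Type*} [Ring R] [Algebra K R] (β : K) (e : R) (b : Fin N → R) :
    (e + β • ∑ k, b k) ^ 2 = e * e + β • ∑ k, (e * b k + b k * e)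
      + β ^ 2 • (∑ k, b k * b k + ∑ k, ∑ l, if k = l then 0 else b k * b l) := by
  have h : ∀ k l, (if k = l then 0 else b k * b l) = b k * b l - if k = l then b k * b l else 0 := by
    intro k l; split_ifs <;> simp
  have h' : ∑ k, b k * b k + ∑ k, ∑ l, (if k = l then 0 else b k * b l) =
      (∑ k, b k) * ∑ k, b k := by
    simp only [h, Finset.sum_sub_distrib, Finset.sum_ite_eq, Finset.mem_univ, if_true,
      Finset.sum_mul_sum]
    abel
  rw [h', Finset.sum_add_distrib, ← Finset.mul_sum, ← Finset.sum_mul]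
  generalize ∑ k, b k = s
  rw [pow_two, add_mul, mul_add, mul_add, mul_smul_comm, smul_mul_assoc, smul_mul_smul_comm]
  module

/-- The β² terms are N(N-1)/2 + N(N-1)(N-2)/3 from the squares and -N(N-1)²/2 from β(N-1)ℋ₁; their
sum N(N-1)(2-N)/6 is the constant subtracted in ℋ. Symmetry of the polynomial plays no role up to
here. -/
theorem hamPoly_eq [CharZero K] (β : K) (N : ℕ) :
    hamPoly β N = ∑ j : Fin N, xDeriv K j * xDeriv K j
      + (β / 2) • ∑ j : Fin N, ∑ k, pairOp K j k := by
  have h1 : ∑ j : Fin N, dunklPoly β j = ∑ j : Fin N, xDeriv K j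
      + (-(β * ((N : K) * ((N : K) - 1) / 2))) • (1 : Module.End K (MvPolynomial (Fin N) K)) := by
    simp only [dunklPoly_eq, Finset.sum_add_distrib, ← Finset.smul_sum, sum_sum_dunklPart]
    rw [smul_smul, mul_neg]
  have h2 : ∑ j : Fin N, dunklPoly β j ^ 2 = ∑ j : Fin N, xDeriv K j * xDeriv K j
      + β • ∑ j : Fin N, ∑ k, (xDeriv K j * dunklPart K j k + dunklPart K j k * xDeriv K j)
      + (β ^ 2 * ((N : K) * ((N : K) - 1) / 2 + (N : K) * ((N : K) - 1) * ((N : K) - 2) / 3)) •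
        (1 : Module.End K (MvPolynomial (Fin N) K)) := by
    simp only [dunklPoly_eq, sq_add_smul_sum]
    rw [Finset.sum_add_distrib, Finset.sum_add_distrib, ← Finset.smul_sum, ← Finset.smul_sum,
      Finset.sum_add_distrib (f := fun j => ∑ k, dunklPart K j k * dunklPart K j k),
      sum_dunklPart_sq, sum_dunklPart_mul_of_ne, ← add_smul, smul_smul]
  rw [hamPoly, h1, h2, sum_pairOp]
  change _ - _ • (1 : Module.End K (MvPolynomial (Fin N) K)) = _
  match_scalars <;> (field_simp; try ring)

/-- The exchange K_jk anticommutes with x_j∂_j - x_k∂_k, so derivatives of K_jk f cancel in the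
anticommutator. What is left is (2c + 1)(x_j∂_j - x_k∂_k) f, with c = x_k/(x_j - x_k), and the
derivative of c times f - K_jk f. -/
theorem pairOp_spec {j k : Fin N} (h : j ≠ k) (f : MvPolynomial (Fin N) K) :
    (X j - X k) ^ 2 * pairOp K j k f =
      (X j ^ 2 - X k ^ 2) * (xDeriv K j f - xDeriv K k f)
        - 2 * X j * X k * (f - swapX K j k f) := by
  have aux : ∀ {j k : Fin N}, j < k → (X j - X k) ^ 2 * pairOp K j k f =
      (X j ^ 2 - X k ^ 2) * (xDeriv K j f - xDeriv K k f)
        - 2 * X j * X k * (f - swapX K j k f) := by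
    intro j k h
    have e1 := xDivDiff_spec h.ne f
    have e2 := xDivDiff_spec h.ne (xDeriv K j f - xDeriv K k f)
    have e3 := congrArg (pderiv j) e1
    have e4 := congrArg (pderiv k) e1
    have e5 : swapX K j k (xDeriv K j f) = xDeriv K k (swapX K j k f) := by
      rw [swapX_apply, rename_xDeriv, Equiv.swap_apply_left]; rfl
    have e6 : swapX K j k (xDeriv K k f) = xDeriv K j (swapX K j k f) := by
      rw [swapX_apply, rename_xDeriv, Equiv.swap_apply_right]; rfl
    simp only [map_sub, e5, e6] at e2
    simp only [Derivation.leibniz, map_sub, pderiv_X_self, pderiv_X_of_ne h.ne, smul_eq_mul,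
      pderiv_X_of_ne h.ne'] at e3 e4
    rw [pairOp, if_neg h.ne, dunklPart_of_lt h]
    simp only [LinearMap.add_apply, LinearMap.sub_apply, Module.End.mul_apply, map_sub]
    simp only [xDeriv_apply] at *
    -- Here `e3` and `e4` are the derivatives of the defining relation `e1` of the divided
    -- difference, and `e2` is that relation for (x_j∂_j - x_k∂_k) f.
    linear_combination (X j - X k) * (X j * e3 - X k * e4) + (X j - X k) * e2 - (X j + X k) * e1
  rcases h.lt_or_gt with h | h
  · exact aux h
  · rw [pairOp_comm, swapX_comm]
    linear_combination aux h

theorem hamiltonian_eq_rTensor (β : K) (N : ℕ) :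
    hamiltonian β N = (hamPoly β N).rTensor (ExteriorAlgebra K (Fin N → K)) := by
  have h : ∀ r, chargeH β N r =
      (∑ j : Fin N, dunklPoly β j ^ r).rTensor (ExteriorAlgebra K (Fin N → K)) := by
    intro r
    rw [chargeH, ← LinearMap.coe_rTensorHom, map_sum]
    exact Finset.sum_congr rfl fun j _ => by rw [dunkl, LinearMap.coe_rTensorHom, LinearMap.rTensor_pow]
  rw [hamiltonian, h, h, hamPoly, LinearMap.rTensor_sub, LinearMap.rTensor_add,
    LinearMap.rTensor_smul, LinearMap.rTensor_smul, LinearMap.rTensor_id]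
  simp only [pow_one]

/-! ### Derivations of the algebra of superpolynomials -/

/-- A linear endomorphism satisfying the Leibniz rule. -/
def IsLeibniz {A : Type*} [Ring A] [Algebra K A] (D : Module.End K A) : Prop :=
  ∀ a b, D (a * b) = D a * b + a * D b

namespace IsLeibniz

variable {A : Type*} [Ring A] [Algebra K A] {D D' : Module.End K A}

theorem add (h : IsLeibniz D) (h' : IsLeibniz D') : IsLeibniz (D + D') := fun a b => by
  simp only [LinearMap.add_apply, h a b, h' a b, add_mul, mul_add]; abel

theorem sub (h : IsLeibniz D) (h' : IsLeibniz D') : IsLeibniz (D - D') := fun a b => by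
  simp only [LinearMap.sub_apply, h a b, h' a b, sub_mul, mul_sub]; abel

theorem sum {ι : Type*} {s : Finset ι} {D : ι → Module.End K A} (h : ∀ i ∈ s, IsLeibniz (D i)) :
    IsLeibniz (∑ i ∈ s, D i) := fun a b => by
  simp only [LinearMap.sum_apply, Finset.sum_mul, Finset.mul_sum, ← Finset.sum_add_distrib]
  exact Finset.sum_congr rfl fun i hi => h i hi a b

theorem smul {R : Type*} [CommRing R] [Algebra R A] [SMulCommClass K R A] (h : IsLeibniz D)
    (r : R) : IsLeibniz (r • D) := fun a b => by
  simp only [LinearMap.smul_apply, h a b, smul_add, smul_mul_assoc, mul_smul_comm]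

theorem map_one (h : IsLeibniz D) : D 1 = 0 := by
  have := h 1 1
  simp only [mul_one, one_mul] at this
  simpa using this

theorem rTensor {A B : Type*} [Ring A] [Algebra K A] [Ring B] [Algebra K B] {D : Module.End K A}
    (h : IsLeibniz D) : IsLeibniz (D.rTensor B : Module.End K (A ⊗[K] B)) := fun x y => by
  induction x with
  | zero => simp
  | add x x' hx hx' => simp only [add_mul, map_add, hx, hx']; abel
  | tmul a b =>
    induction y with
    | zero => simp
    | add y y' hy hy' => simp only [mul_add, map_add, hy, hy']; abel
    | tmul a' b' => simp [h a a', TensorProduct.add_tmul]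

theorem lTensor {A B : Type*} [Ring A] [Algebra K A] [Ring B] [Algebra K B] {D : Module.End K B}
    (h : IsLeibniz D) : IsLeibniz (D.lTensor A : Module.End K (A ⊗[K] B)) := fun x y => by
  induction x with
  | zero => simp
  | add x x' hx hx' => simp only [add_mul, map_add, hx, hx']; abel
  | tmul a b =>
    induction y with
    | zero => simp
    | add y y' hy hy' => simp only [mul_add, map_add, hy, hy']; abel
    | tmul a' b' => simp [h b b', TensorProduct.tmul_add]

end IsLeibniz

theorem isLeibniz_xDeriv (j : Fin N) : IsLeibniz (xDeriv K j) := fun a b => by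
  simp only [xDeriv_apply, Derivation.leibniz, smul_eq_mul]; ring

/-! ### Derivatives and exchanges in the Grassmann algebra -/

/-- The Grassmann generator `θ_i`. -/
def theta (K : Type) [Field K] {N : ℕ} (i : Fin N) : ExteriorAlgebra K (Fin N → K) :=
  ExteriorAlgebra.ι K (Pi.single i (1 : K))

/-- The left derivative `∂_{θ_i}`. -/
def thetaDeriv (K : Type) [Field K] {N : ℕ} (i : Fin N) :
    Module.End K (ExteriorAlgebra K (Fin N → K)) :=
  CliffordAlgebra.contractLeft (LinearMap.proj i)

theorem thetaDeriv_ι_mul (i : Fin N) (v : Fin N → K) (w : ExteriorAlgebra K (Fin N → K)) :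
    thetaDeriv K i (ExteriorAlgebra.ι K v * w) =
      v i • w - ExteriorAlgebra.ι K v * thetaDeriv K i w :=
  CliffordAlgebra.contractLeft_ι_mul _ _ _

theorem thetaDeriv_algebraMap (i : Fin N) (r : K) :
    thetaDeriv K i (algebraMap K _ r) = 0 :=
  CliffordAlgebra.contractLeft_algebraMap _ _ _

theorem thetaDeriv_theta_mul_self (i : Fin N) (w : ExteriorAlgebra K (Fin N → K)) :
    thetaDeriv K i (theta K i * w) = w - theta K i * thetaDeriv K i w := by
  rw [theta, thetaDeriv_ι_mul]; simp

theorem thetaDeriv_theta_mul_of_ne {i j : Fin N} (h : i ≠ j)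
    (w : ExteriorAlgebra K (Fin N → K)) :
    thetaDeriv K i (theta K j * w) = -(theta K j * thetaDeriv K i w) := by
  rw [theta, thetaDeriv_ι_mul]; simp [h]

theorem thetaDeriv_comm (i j : Fin N) (w : ExteriorAlgebra K (Fin N → K)) :
    thetaDeriv K i (thetaDeriv K j w) = -thetaDeriv K j (thetaDeriv K i w) :=
  CliffordAlgebra.contractLeft_comm ..

theorem thetaDeriv_self (i : Fin N) (w : ExteriorAlgebra K (Fin N → K)) :
    thetaDeriv K i (thetaDeriv K i w) = 0 :=
  CliffordAlgebra.contractLeft_contractLeft ..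

theorem ι_mul_ι_comm (u v : Fin N → K) :
    ExteriorAlgebra.ι K u * ExteriorAlgebra.ι K v =
      -(ExteriorAlgebra.ι K v * ExteriorAlgebra.ι K u) :=
  eq_neg_of_add_eq_zero_left (ExteriorAlgebra.ι_add_mul_swap u v)

theorem theta_mul_theta (i j : Fin N) : theta K i * theta K j = -(theta K j * theta K i) :=
  ι_mul_ι_comm _ _

theorem theta_mul_self (i : Fin N) : theta K i * theta K i = 0 :=
  ExteriorAlgebra.ι_sq_zero _

/-- The operator `θ_i ∂_{θ_j}` on the Grassmann algebra. -/
def thetaTransfer (K : Type) [Field K] {N : ℕ} (i j : Fin N) :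
    Module.End K (ExteriorAlgebra K (Fin N → K)) :=
  LinearMap.mulLeft K (theta K i) ∘ₗ thetaDeriv K j

theorem thetaTransfer_apply (i j : Fin N) (w : ExteriorAlgebra K (Fin N → K)) :
    thetaTransfer K i j w = theta K i * thetaDeriv K j w := rfl

theorem exteriorAlgebra_induction {P : ExteriorAlgebra K (Fin N → K) → Prop}
    (algebraMap : ∀ r, P (algebraMap K _ r)) (add : ∀ a b, P a → P b → P (a + b))
    (ι_mul : ∀ v a, P a → P (ExteriorAlgebra.ι K v * a)) (a) : P a :=
  CliffordAlgebra.left_induction (Q := (0 : QuadraticForm K (Fin N → K))) algebraMap add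
    (fun x m hx => ι_mul m x hx) a

/-- The sign with which ∂_{θ_j} passes an odd factor is cancelled by the sign with which θ_i passes
it, so the ordinary unsigned Leibniz rule holds. -/
theorem isLeibniz_thetaTransfer (i j : Fin N) : IsLeibniz (thetaTransfer K i j) := fun a b => by
  simp only [thetaTransfer_apply]
  induction a using exteriorAlgebra_induction with
  | algebraMap r =>
    rw [thetaDeriv_algebraMap, mul_zero, zero_mul, zero_add, ← Algebra.smul_def, map_smul,
      mul_smul_comm, ← Algebra.smul_def]
  | add a a' h h' => simp only [add_mul, map_add, mul_add, h, h']; abel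
  | ι_mul v a h =>
    have hs : theta K i * ExteriorAlgebra.ι K v = -(ExteriorAlgebra.ι K v * theta K i) :=
      ι_mul_ι_comm _ _
    rw [mul_assoc, thetaDeriv_ι_mul, thetaDeriv_ι_mul, mul_sub, mul_sub, ← mul_assoc (theta K i), hs,
      ← mul_assoc (theta K i), hs, neg_mul, mul_assoc, h]
    simp only [mul_smul_comm, smul_mul_assoc, mul_add, sub_mul, neg_mul, mul_assoc]
    abel

/-- The exchange of `θ_j` and `θ_k` in the Grassmann algebra. -/
def swapTheta (K : Type) [Field K] {N : ℕ} (j k : Fin N) :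
    ExteriorAlgebra K (Fin N → K) →ₐ[K] ExteriorAlgebra K (Fin N → K) :=
  ExteriorAlgebra.map (LinearMap.funLeft K K (Equiv.swap j k))

theorem swapTheta_ι (j k : Fin N) (v : Fin N → K) :
    swapTheta K j k (ExteriorAlgebra.ι K v) =
      ExteriorAlgebra.ι K v - (v j - v k) • (theta K j - theta K k) := by
  rw [swapTheta, ExteriorAlgebra.map_apply_ι, theta, theta, ← map_sub, ← map_smul, ← map_sub]
  congr 1
  ext i
  simp only [LinearMap.funLeft_apply, Pi.sub_apply, Pi.smul_apply, Pi.single_apply, smul_eq_mul,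
    Equiv.swap_apply_def]
  split_ifs <;> simp_all

/-- The exchange fixes θ_j + θ_k and reverses t = θ_j - θ_k. As t² = 0, the difference 1 - κ_jk is
twice the number operator of t, that is (θ_j - θ_k)(∂_{θ_j} - ∂_{θ_k}): a first-order operator,
hence a derivation. Nothing similar is true for the exchange of commuting variables. -/
theorem sub_swapTheta (j k : Fin N) (w : ExteriorAlgebra K (Fin N → K)) :
    w - swapTheta K j k w = (thetaTransfer K j j + thetaTransfer K k k - thetaTransfer K j k
      - thetaTransfer K k j) w := by
  have hr : (thetaTransfer K j j + thetaTransfer K k k - thetaTransfer K j k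
      - thetaTransfer K k j) w = (theta K j - theta K k) * (thetaDeriv K j w - thetaDeriv K k w) := by
    simp only [LinearMap.add_apply, LinearMap.sub_apply, thetaTransfer_apply, sub_mul, mul_sub]
    abel
  rw [hr, sub_eq_iff_eq_add, ← sub_eq_iff_eq_add', eq_comm]
  clear hr
  induction w using exteriorAlgebra_induction with
  | algebraMap r => simp [thetaDeriv_algebraMap]
  | add a b ha hb => simp only [map_add, ha, hb, mul_add, mul_sub]; abel
  | ι_mul v w h =>
    rw [map_mul, h, swapTheta_ι, thetaDeriv_ι_mul, thetaDeriv_ι_mul]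
    have hd : (theta K j - theta K k) * (theta K j - theta K k) = 0 := by
      rw [theta, theta, ← map_sub]; exact ExteriorAlgebra.ι_sq_zero _
    have hs : (theta K j - theta K k) * ExteriorAlgebra.ι K v =
        -(ExteriorAlgebra.ι K v * (theta K j - theta K k)) := by
      rw [theta, theta, ← map_sub]; exact ι_mul_ι_comm _ _
    generalize theta K j - theta K k = t at *
    have hd' : ∀ u, t * (t * u) = 0 := fun u => by rw [← mul_assoc, hd, zero_mul]
    have hs' : ∀ u, t * (ExteriorAlgebra.ι K v * u) = -(ExteriorAlgebra.ι K v * (t * u)) :=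
      fun u => by rw [← mul_assoc, hs, neg_mul, mul_assoc]
    simp only [sub_mul, mul_sub, smul_mul_assoc, mul_smul_comm, hd', hs', sub_smul]
    simp only [smul_zero]
    abel

/-- In contrast with 1 - κ_jk alone, the product with θ_j∂_{θ_j} has a term of second order,
θ_j∂_{θ_j}θ_k∂_{θ_k}. It is the source of the fermion number term in `chargeI_mul`. -/
theorem thetaTransfer_self_sub_swapTheta {j k : Fin N} (h : j ≠ k)
    (w : ExteriorAlgebra K (Fin N → K)) :
    thetaTransfer K j j (w - swapTheta K j k w) =
      thetaTransfer K j j w - thetaTransfer K j k w + thetaTransfer K j j (thetaTransfer K k k w) := by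
  rw [sub_swapTheta]
  simp only [LinearMap.add_apply, LinearMap.sub_apply, thetaTransfer_apply, map_add, map_sub,
    thetaDeriv_theta_mul_self, thetaDeriv_theta_mul_of_ne h, mul_sub, mul_neg,
    thetaDeriv_self, mul_zero, ← mul_assoc, theta_mul_self, zero_mul]
  abel

/-! ### The Hamiltonian on symmetric superpolynomials -/

/-- The operator `x_j ∂_{x_j}` on superpolynomials. -/
def superXDeriv (K : Type) [Field K] {N : ℕ} (j : Fin N) : Module.End K (Superpoly K N) :=
  (xDeriv K j).rTensor (ExteriorAlgebra K (Fin N → K))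

/-- The operator `θ_i ∂_{θ_j}` on superpolynomials. -/
def superTransfer (K : Type) [Field K] {N : ℕ} (i j : Fin N) : Module.End K (Superpoly K N) :=
  (thetaTransfer K i j).lTensor (MvPolynomial (Fin N) K)

/-- Invariance under the diagonal action of the symmetric group. -/
def IsSymm (F : Superpoly K N) : Prop := ∀ σ, diagPerm K σ F = F

theorem IsSymm.mul {F G : Superpoly K N} (hF : IsSymm F) (hG : IsSymm G) : IsSymm (F * G) :=
  fun σ => by rw [map_mul, hF, hG]

theorem isLeibniz_superXDeriv (j : Fin N) : IsLeibniz (superXDeriv K j) :=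
  (isLeibniz_xDeriv j).rTensor

theorem isLeibniz_superTransfer (i j : Fin N) : IsLeibniz (superTransfer K i j) :=
  (isLeibniz_thetaTransfer i j).lTensor

/-- The diagonal exchange is K_jk κ_jk, a product of commuting involutions; it fixes F, so K_jk F =
κ_jk F. -/
theorem swapX_rTensor_of_isSymm {F : Superpoly K N} (hF : IsSymm F) (j k : Fin N) :
    (swapX K j k).rTensor (ExteriorAlgebra K (Fin N → K)) F =
      (swapTheta K j k).toLinearMap.lTensor (MvPolynomial (Fin N) K) F := by
  have h1 : ∀ G : Superpoly K N, diagPerm K (Equiv.swap j k) ((swapX K j k).rTensor _ G) =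
      (swapTheta K j k).toLinearMap.lTensor _ G := by
    intro G
    induction G using TensorProduct.induction_on with
    | zero => simp
    | add x y hx hy => simp only [map_add, hx, hy]
    | tmul f w =>
      have := swapX_swapX j k f
      rw [swapX_apply] at this
      simp [diagPerm, swapTheta, this]
  have h2 : ∀ G : Superpoly K N, diagPerm K (Equiv.swap j k) ((swapX K j k).rTensor _ G) =
      (swapX K j k).rTensor _ (diagPerm K (Equiv.swap j k) G) := by
    intro G
    induction G using TensorProduct.induction_on with
    | zero => simp
    | add x y hx hy => simp only [map_add, hx, hy]
    | tmul f w => simp [diagPerm, swapX_apply]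
  rw [← h1, h2, hF]

theorem pairOp_rTensor_spec {j k : Fin N} (h : j ≠ k) (F : Superpoly K N) :
    ((X j - X k) ^ 2 : MvPolynomial (Fin N) K) • (pairOp K j k).rTensor _ F =
      (X j ^ 2 - X k ^ 2 : MvPolynomial (Fin N) K) • (superXDeriv K j F - superXDeriv K k F)
      - (2 * X j * X k : MvPolynomial (Fin N) K) • (F - (swapX K j k).rTensor _ F) := by
  induction F using TensorProduct.induction_on with
  | zero => simp
  | add x y hx hy =>
    simp only [map_add, smul_add, hx, hy, smul_sub]; abel
  | tmul f w =>
    simp only [superXDeriv, LinearMap.rTensor_tmul, ← TensorProduct.sub_tmul,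
      TensorProduct.smul_tmul', smul_eq_mul, pairOp_spec h]

/-- The derivation to which `(x_j - x_k)²` times the two-body part of the Hamiltonian reduces on
symmetric superpolynomials. -/
def pairDerivation (K : Type) [Field K] {N : ℕ} (j k : Fin N) : Module.End K (Superpoly K N) :=
  (X j ^ 2 - X k ^ 2 : MvPolynomial (Fin N) K) • (superXDeriv K j - superXDeriv K k)
    - (2 * X j * X k : MvPolynomial (Fin N) K) • (superTransfer K j j + superTransfer K k k
      - superTransfer K j k - superTransfer K k j)

theorem isLeibniz_pairDerivation (j k : Fin N) : IsLeibniz (pairDerivation K j k) :=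
  (((isLeibniz_superXDeriv (K := K) j).sub (isLeibniz_superXDeriv k)).smul _).sub
    (((((isLeibniz_superTransfer (K := K) j j).add (isLeibniz_superTransfer k k)).sub
      (isLeibniz_superTransfer j k)).sub (isLeibniz_superTransfer k j)).smul _)

theorem sub_swapTheta_lTensor (j k : Fin N) (F : Superpoly K N) :
    F - (swapTheta K j k).toLinearMap.lTensor _ F = (superTransfer K j j + superTransfer K k k
      - superTransfer K j k - superTransfer K k j) F := by
  simp only [superTransfer, ← LinearMap.lTensor_add, ← LinearMap.lTensor_sub]
  induction F using TensorProduct.induction_on with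
  | zero => simp
  | add x y hx hy => rw [map_add, map_add, ← hx, ← hy]; abel
  | tmul f w =>
    rw [LinearMap.lTensor_tmul, LinearMap.lTensor_tmul, ← sub_swapTheta, TensorProduct.tmul_sub]
    rfl

theorem pairOp_rTensor_of_isSymm {j k : Fin N} (h : j ≠ k) {F : Superpoly K N} (hF : IsSymm F) :
    ((X j - X k) ^ 2 : MvPolynomial (Fin N) K) • (pairOp K j k).rTensor _ F =
      pairDerivation K j k F := by
  rw [pairOp_rTensor_spec h, swapX_rTensor_of_isSymm hF, sub_swapTheta_lTensor]
  rfl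

theorem smul_left_cancel_superpoly {a : MvPolynomial (Fin N) K} (ha : a ≠ 0) {F G : Superpoly K N}
    (h : a • F = a • G) : F = G := by
  have : Module.IsTorsionFree (MvPolynomial (Fin N) K) (Superpoly K N) := inferInstance
  exact smul_right_injective _ ha h

/-- After multiplication by (x_j - x_k)² the operator coincides with a derivation on F, G and FG,
since all three are symmetric; superpolynomials are torsion-free over the polynomials in x. -/
theorem pairOp_rTensor_mul (j k : Fin N) {F G : Superpoly K N} (hF : IsSymm F) (hG : IsSymm G) :
    (pairOp K j k).rTensor _ (F * G) =
      (pairOp K j k).rTensor _ F * G + F * (pairOp K j k).rTensor _ G := by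
  by_cases h : j = k
  · subst h; simp [pairOp_self]
  apply smul_left_cancel_superpoly (pow_ne_zero 2 (X_sub_X_ne_zero K h))
  rw [pairOp_rTensor_of_isSymm h (hF.mul hG), isLeibniz_pairDerivation j k F G,
    ← pairOp_rTensor_of_isSymm h hF, ← pairOp_rTensor_of_isSymm h hG, smul_add, smul_mul_assoc,
    mul_smul_comm]

theorem hamiltonian_apply [CharZero K] (β : K) (F : Superpoly K N) :
    hamiltonian β N F = ∑ j, superXDeriv K j (superXDeriv K j F)
      + (β / 2) • ∑ j : Fin N, ∑ k, (pairOp K j k).rTensor _ F := by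
  rw [hamiltonian_eq_rTensor, hamPoly_eq, LinearMap.rTensor_add, LinearMap.rTensor_smul,
    ← LinearMap.coe_rTensorHom, map_sum, map_sum]
  simp only [map_sum, LinearMap.add_apply, LinearMap.smul_apply, LinearMap.sum_apply,
    LinearMap.coe_rTensorHom, LinearMap.rTensor_mul, Module.End.mul_apply]
  rfl

/-- Only Σ_i (x_i∂_i)² fails to be a derivation on symmetric superpolynomials; its cross terms are
the last sum, which contains no β. -/
theorem hamiltonian_mul [CharZero K] (β : K) {F G : Superpoly K N} (hF : IsSymm F)
    (hG : IsSymm G) :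
    hamiltonian β N (F * G) = hamiltonian β N F * G + F * hamiltonian β N G
      + (2 : K) • ∑ i, superXDeriv K i F * superXDeriv K i G := by
  have h : ∀ i : Fin N, superXDeriv K i (superXDeriv K i (F * G)) =
      superXDeriv K i (superXDeriv K i F) * G + F * superXDeriv K i (superXDeriv K i G)
      + (2 : K) • (superXDeriv K i F * superXDeriv K i G) := by
    intro i
    rw [isLeibniz_superXDeriv i F G, map_add, isLeibniz_superXDeriv i _ G,
      isLeibniz_superXDeriv i F _]
    module
  simp only [hamiltonian_apply, h, pairOp_rTensor_mul _ _ hF hG, Finset.sum_add_distrib,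
    add_mul, mul_add, smul_mul_assoc, mul_smul_comm, Finset.sum_mul, Finset.mul_sum,
    Finset.smul_sum, smul_add]
  abel

theorem euler_eq_sum (K : Type) [Field K] (N : ℕ) : euler K N = ∑ i, superXDeriv K i := by
  rw [euler, ← LinearMap.coe_rTensorHom, map_sum]
  rfl

/-! ### Values on the power sums -/

/-- The power sum `p_n` in `N` variables, as a polynomial. -/
def psumX (K : Type) [Field K] (N n : ℕ) : MvPolynomial (Fin N) K := ∑ i, X i ^ n

/-- The fermionic power sum `p̃_n` in `N` variables. -/
def psumTheta (K : Type) [Field K] (N n : ℕ) : Superpoly K N :=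
  ∑ i, (X i ^ n : MvPolynomial (Fin N) K) • thetaVar K i

theorem xDeriv_X_pow (i j : Fin N) (n : ℕ) :
    xDeriv K i (X j ^ n) = if i = j then n • X j ^ n else 0 := by
  rw [xDeriv_apply, Derivation.leibniz_pow, pderiv_X]
  split_ifs with h
  · subst h
    rcases n with _ | n
    · simp
    · simp [pow_succ]; ring
  · simp [Ne.symm h]

theorem xDeriv_psumX (i : Fin N) (n : ℕ) : xDeriv K i (psumX K N n) = (n : K) • X i ^ n := by
  simp only [psumX, map_sum, xDeriv_X_pow, Finset.sum_ite_eq, Finset.mem_univ, if_true,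
    Nat.cast_smul_eq_nsmul]

theorem superXDeriv_smul (i : Fin N) (f : MvPolynomial (Fin N) K) (F : Superpoly K N) :
    superXDeriv K i (f • F) = xDeriv K i f • F + f • superXDeriv K i F := by
  induction F using TensorProduct.induction_on with
  | zero => simp
  | add x y hx hy => simp only [smul_add, map_add, hx, hy]; abel
  | tmul g w =>
    simp only [superXDeriv, TensorProduct.smul_tmul', LinearMap.rTensor_tmul, smul_eq_mul,
      isLeibniz_xDeriv i f g, TensorProduct.add_tmul]

theorem superTransfer_smul (i j : Fin N) (f : MvPolynomial (Fin N) K) (F : Superpoly K N) :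
    superTransfer K i j (f • F) = f • superTransfer K i j F := by
  induction F using TensorProduct.induction_on with
  | zero => simp
  | add x y hx hy => simp only [smul_add, map_add, hx, hy]
  | tmul g w =>
    simp only [superTransfer, TensorProduct.smul_tmul', LinearMap.lTensor_tmul]

theorem superXDeriv_thetaVar (i j : Fin N) : superXDeriv K i (thetaVar K j) = 0 := by
  simp [superXDeriv, thetaVar, xDeriv_apply]

theorem superXDeriv_psumTheta (i : Fin N) (n : ℕ) :
    superXDeriv K i (psumTheta K N n) =
      (n : K) • (X i ^ n : MvPolynomial (Fin N) K) • thetaVar K i := by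
  simp only [psumTheta, map_sum, superXDeriv_smul, superXDeriv_thetaVar, smul_zero, add_zero,
    xDeriv_X_pow, ite_smul, zero_smul, Finset.sum_ite_eq, Finset.mem_univ, if_true,
    Nat.cast_smul_eq_nsmul, smul_assoc]

theorem superTransfer_thetaVar (i j k : Fin N) :
    superTransfer K i j (thetaVar K k) = if j = k then thetaVar K i else 0 := by
  simp only [superTransfer, thetaVar, LinearMap.lTensor_tmul, thetaTransfer_apply]
  have := thetaDeriv_ι_mul (K := K) j (Pi.single k 1) 1
  rw [mul_one] at this
  rw [this, thetaDeriv, CliffordAlgebra.contractLeft_one]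
  split_ifs with h
  · subst h; simp [theta]
  · simp [h]

theorem superTransfer_psumTheta (i j : Fin N) (n : ℕ) :
    superTransfer K i j (psumTheta K N n) = (X j ^ n : MvPolynomial (Fin N) K) • thetaVar K i := by
  simp only [psumTheta, map_sum, superTransfer_smul, superTransfer_thetaVar, smul_ite, smul_zero,
    Finset.sum_ite_eq, Finset.mem_univ, if_true]

theorem sub_mul_symm_geom_sum {R : Type*} [CommRing R] (x y : R) (n : ℕ) :
    (x - y) * (2 * ∑ r ∈ Finset.range (n + 1), x ^ r * y ^ (n - r) - x ^ n - y ^ n) =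
      (x + y) * (x ^ n - y ^ n) := by
  have h := (Commute.all x y).geom_sum₂_mul (n + 1)
  simp only [Nat.add_sub_cancel] at h
  linear_combination 2 * h

/-- The right side, with x = x_j and y = x_k, is the coefficient of θ_j when the two-body derivation
is applied to p̃_n. Induction on n: passing to n + 1 multiplies the weighted sum by x and adds x
times an ordinary geometric sum. -/
theorem sub_sq_mul_weighted_geom_sum {R : Type*} [CommRing R] (x y : R) (n : ℕ) :
    (x - y) ^ 2 * (2 * ∑ r ∈ Finset.range (n + 1), ((n - r : ℕ) : R) * (y ^ r * x ^ (n - r))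
      - n * x ^ n) = n * (x ^ 2 - y ^ 2) * x ^ n - 2 * x * y * (x ^ n - y ^ n) := by
  induction n with
  | zero => simp
  | succ n ih =>
    have h := (Commute.all y x).geom_sum₂_mul (n + 1)
    simp only [Nat.add_sub_cancel] at h
    have hs : ∑ r ∈ Finset.range (n + 1 + 1), ((n + 1 - r : ℕ) : R) * (y ^ r * x ^ (n + 1 - r)) =
        x * ∑ r ∈ Finset.range (n + 1), ((n - r : ℕ) : R) * (y ^ r * x ^ (n - r))
        + x * ∑ r ∈ Finset.range (n + 1), y ^ r * x ^ (n - r) := by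
      rw [Finset.sum_range_succ, Nat.sub_self, Nat.cast_zero, zero_mul, add_zero, Finset.mul_sum,
        Finset.mul_sum, ← Finset.sum_add_distrib]
      refine Finset.sum_congr rfl fun r hr => ?_
      have hr : r ≤ n := Nat.lt_succ_iff.1 (Finset.mem_range.1 hr)
      rw [Nat.succ_sub hr, Nat.cast_succ, pow_succ]
      ring
    rw [hs]
    push_cast
    linear_combination x * ih - 2 * x * (x - y) * h

theorem psumX_zero : psumX K N 0 = (N : MvPolynomial (Fin N) K) := by simp [psumX]

theorem rename_psumX (σ : Equiv.Perm (Fin N)) (n : ℕ) : rename σ (psumX K N n) = psumX K N n := by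
  simp only [psumX, map_sum, map_pow, rename_X]
  exact Equiv.sum_comp σ (fun i => (X i : MvPolynomial (Fin N) K) ^ n)

/-- As p_n is invariant under K_jk, only the derivative term contributes, with value n(x_j +
x_k)(x_jⁿ - x_kⁿ)/(x_j - x_k). -/
theorem pairOp_psumX {j k : Fin N} (h : j ≠ k) (n : ℕ) :
    pairOp K j k (psumX K N n) = (n : MvPolynomial (Fin N) K) *
      (2 * ∑ r ∈ Finset.range (n + 1), X j ^ r * X k ^ (n - r) - X j ^ n - X k ^ n) := by
  apply mul_left_cancel₀ (pow_ne_zero 2 (X_sub_X_ne_zero K h))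
  rw [pairOp_spec h, swapX_apply, rename_psumX, xDeriv_psumX, xDeriv_psumX]
  have := sub_mul_symm_geom_sum (X j : MvPolynomial (Fin N) K) (X k) n
  simp only [Nat.cast_smul_eq_nsmul, nsmul_eq_mul]
  linear_combination -(n : MvPolynomial (Fin N) K) * (X j - X k) * this

theorem sum_pairOp_psumX [CharZero K] (m : ℕ) :
    ∑ j : Fin N, ∑ k, pairOp K j k (psumX K N (m + 1)) = 2 * ((m + 1 : ℕ) : MvPolynomial (Fin N) K) *
      (∑ a ∈ Finset.range m, psumX K N (a + 1) * psumX K N (m - a)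
        + ((N : MvPolynomial (Fin N) K) - ((m + 1 : ℕ) : MvPolynomial (Fin N) K))
          * psumX K N (m + 1)) := by
  -- The formula for j ≠ k is used for all pairs and its value on the diagonal is subtracted; the
  -- unrestricted double sum then factors into products of power sums.
  have h : ∀ j k : Fin N, pairOp K j k (psumX K N (m + 1)) =
      ((m + 1 : ℕ) : MvPolynomial (Fin N) K) * (2 * ∑ r ∈ Finset.range (m + 2),
        X j ^ r * X k ^ (m + 1 - r) - X j ^ (m + 1) - X k ^ (m + 1))
      - if j = k then ((m + 1 : ℕ) : MvPolynomial (Fin N) K) *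
        (2 * ((m + 1 : ℕ) : MvPolynomial (Fin N) K) * X j ^ (m + 1)) else 0 := by
    intro j k
    split_ifs with hjk
    · subst hjk
      have hs : ∀ r ∈ Finset.range (m + 2),
          (X j ^ r * X j ^ (m + 1 - r) : MvPolynomial (Fin N) K) = X j ^ (m + 1) := by
        intro r hr
        rw [← pow_add, Nat.add_sub_cancel' (Nat.lt_succ_iff.1 (Finset.mem_range.1 hr))]
      rw [pairOp_self, LinearMap.zero_apply, Finset.sum_congr rfl hs, Finset.sum_const,
        Finset.card_range, nsmul_eq_mul]
      push_cast
      ring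
    · rw [pairOp_psumX hjk, sub_zero]
  have hs : ∑ j : Fin N, ∑ k : Fin N, ∑ r ∈ Finset.range (m + 2),
      (X j ^ r * X k ^ (m + 1 - r) : MvPolynomial (Fin N) K) =
      ∑ r ∈ Finset.range (m + 2), psumX K N r * psumX K N (m + 1 - r) := by
    simp only [psumX, Finset.sum_mul_sum]
    calc _ = ∑ j : Fin N, ∑ r ∈ Finset.range (m + 2), ∑ k : Fin N,
          (X j ^ r * X k ^ (m + 1 - r) : MvPolynomial (Fin N) K) :=
          Finset.sum_congr rfl fun j _ => Finset.sum_comm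
      _ = _ := Finset.sum_comm
  simp only [h, Finset.sum_sub_distrib, Finset.sum_ite_eq, Finset.mem_univ, if_true,
    ← Finset.mul_sum, hs, Finset.sum_const, Finset.card_univ, Fintype.card_fin]
  -- The two extreme summands contain p_0 = N; they are split off and supply the multiple of N
  -- p_{m+1}.
  rw [Finset.sum_range_succ, Finset.sum_range_succ']
  simp only [Nat.add_sub_add_right, Nat.sub_self, psumX_zero, Nat.sub_zero, nsmul_eq_mul]
  have hp : ∀ n, ∑ i, (X i : MvPolynomial (Fin N) K) ^ n = psumX K N n := fun _ => rfl
  simp only [← Finset.mul_sum, hp]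
  push_cast
  ring

theorem hamiltonian_psumX [CharZero K] (β : K) (m : ℕ) :
    hamiltonian β N (psumX K N (m + 1) • 1) =
      (((m : K) + 1) ^ 2 + β * ((m : K) + 1) * ((N : K) - ((m : K) + 1))) •
        (psumX K N (m + 1) • (1 : Superpoly K N))
      + (β * ((m : K) + 1)) • ∑ a ∈ Finset.range m,
        psumX K N (a + 1) • psumX K N (m - a) • (1 : Superpoly K N) := by
  have hr : ∀ (D : Module.End K (MvPolynomial (Fin N) K)) (f : MvPolynomial (Fin N) K),
      D.rTensor _ (f • (1 : Superpoly K N)) = D f • (1 : Superpoly K N) := by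
    intro D f
    rw [Algebra.TensorProduct.one_def, TensorProduct.smul_tmul', LinearMap.rTensor_tmul,
      TensorProduct.smul_tmul', smul_eq_mul, smul_eq_mul, mul_one, mul_one]
  have hp : ∀ n, ∑ i, (X i : MvPolynomial (Fin N) K) ^ n = psumX K N n := fun _ => rfl
  rw [hamiltonian_apply]
  simp only [superXDeriv, hr, ← Finset.sum_smul, sum_pairOp_psumX, xDeriv_psumX, map_smul,
    xDeriv_X_pow, if_true, ← Finset.smul_sum, smul_smul, hp]
  simp only [← smul_assoc, ← add_smul]
  congr 1
  simp only [MvPolynomial.smul_eq_C_mul, nsmul_eq_mul, map_add, map_mul, map_pow, map_sub, map_natCast,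
    Nat.cast_succ, map_one]
  have h2 : (C (β / 2) * 2 : MvPolynomial (Fin N) K) = C β := by
    rw [← map_ofNat C 2, ← map_mul]; congr 1; field_simp
  linear_combination ((m : MvPolynomial (Fin N) K) + 1) * (∑ a ∈ Finset.range m, psumX K N (a + 1) * psumX K N (m - a)
        + ((N : MvPolynomial (Fin N) K) - ((m : MvPolynomial (Fin N) K) + 1))
          * psumX K N (m + 1)) * h2

/-- The polynomial `n xⁿ + 2 ∑_{r=1}^{n-1} (n-r) yʳ xⁿ⁻ʳ`. -/
def weightedGeomSum {R : Type*} [CommRing R] (n : ℕ) (x y : R) : R :=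
  2 * ∑ r ∈ Finset.range (n + 1), ((n - r : ℕ) : R) * (y ^ r * x ^ (n - r)) - n * x ^ n

theorem weightedGeomSum_self {R : Type*} [CommRing R] (n : ℕ) (x : R) :
    weightedGeomSum n x x = (n : R) ^ 2 * x ^ n := by
  have h : ∀ r ∈ Finset.range (n + 1), ((n - r : ℕ) : R) * (x ^ r * x ^ (n - r)) =
      ((n - r : ℕ) : R) * x ^ n := fun r hr => by
    rw [← pow_add, Nat.add_sub_cancel' (Nat.lt_succ_iff.1 (Finset.mem_range.1 hr))]
  have h' : ∑ r ∈ Finset.range (n + 1), ((n - r : ℕ) : R) = ∑ r ∈ Finset.range (n + 1), (r : R) := by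
    rw [← Finset.sum_range_reflect]
    refine Finset.sum_congr rfl fun r hr => ?_
    have := Finset.mem_range.1 hr
    congr 1
    omega
  have h'' : (∑ r ∈ Finset.range (n + 1), (r : R)) * 2 = (n + 1) * n := by
    have := congrArg (Nat.cast : ℕ → R) (Finset.sum_range_id_mul_two (n + 1))
    push_cast at this
    simpa using this
  rw [weightedGeomSum, Finset.sum_congr rfl h, ← Finset.sum_mul, h']
  linear_combination x ^ n * h''

theorem pairOp_psumTheta {j k : Fin N} (h : j ≠ k) (n : ℕ) (hs : IsSymm (psumTheta K N n)) :
    (pairOp K j k).rTensor _ (psumTheta K N n) =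
      weightedGeomSum n (X j : MvPolynomial (Fin N) K) (X k) • thetaVar K j
      + weightedGeomSum n (X k : MvPolynomial (Fin N) K) (X j) • thetaVar K k := by
  apply smul_left_cancel_superpoly (pow_ne_zero 2 (X_sub_X_ne_zero K h))
  rw [pairOp_rTensor_of_isSymm h hs]
  have h1 := sub_sq_mul_weighted_geom_sum (X j : MvPolynomial (Fin N) K) (X k) n
  have h2 := sub_sq_mul_weighted_geom_sum (X k : MvPolynomial (Fin N) K) (X j) n
  rw [← weightedGeomSum] at h1 h2
  rw [smul_add, smul_smul, smul_smul, h1, ← neg_sub (X k) (X j), neg_sq, h2]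
  simp only [pairDerivation, LinearMap.sub_apply, LinearMap.add_apply, LinearMap.smul_apply,
    superXDeriv_psumTheta, superTransfer_psumTheta, Nat.cast_smul_eq_nsmul]
  module

/-- Summing over k turns x_k^r into p_r, then summing over j turns θ_j x_j^{n-r} into p̃_{n-r}. The
summand r = 0 gives N; the others are indexed by r = a + 1. -/
theorem sum_weightedGeomSum (n : ℕ) :
    ∑ j : Fin N, ∑ k : Fin N, weightedGeomSum n (X j : MvPolynomial (Fin N) K) (X k) • thetaVar K j =
      (n * N : MvPolynomial (Fin N) K) • psumTheta K N n + (2 : MvPolynomial (Fin N) K) •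
        ∑ a ∈ Finset.range n, ((n - (a + 1) : ℕ) : MvPolynomial (Fin N) K) •
          psumX K N (a + 1) • psumTheta K N (n - (a + 1)) := by
  have h : ∀ j : Fin N, ∑ k : Fin N, weightedGeomSum n (X j : MvPolynomial (Fin N) K) (X k) =
      (n * N : MvPolynomial (Fin N) K) * X j ^ n + 2 * ∑ a ∈ Finset.range n,
        ((n - (a + 1) : ℕ) : MvPolynomial (Fin N) K) * psumX K N (a + 1) * X j ^ (n - (a + 1)) := by
    intro j
    have h1 : ∑ k : Fin N, ∑ r ∈ Finset.range (n + 1), ((n - r : ℕ) : MvPolynomial (Fin N) K) *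
        (X k ^ r * X j ^ (n - r)) = ∑ r ∈ Finset.range (n + 1),
          ((n - r : ℕ) : MvPolynomial (Fin N) K) * psumX K N r * X j ^ (n - r) := by
      rw [Finset.sum_comm]
      refine Finset.sum_congr rfl fun r _ => ?_
      simp only [psumX, Finset.mul_sum, Finset.sum_mul]
      exact Finset.sum_congr rfl fun k _ => by ring
    simp only [weightedGeomSum, Finset.sum_sub_distrib, ← Finset.mul_sum, h1, Finset.sum_const,
      Finset.card_univ, Fintype.card_fin, nsmul_eq_mul]
    rw [Finset.sum_range_succ', psumX_zero]
    simp only [Nat.sub_zero]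
    ring
  simp only [← Finset.sum_smul, h, add_smul, Finset.sum_add_distrib, mul_smul, Finset.mul_sum]
  simp only [psumTheta, Finset.smul_sum, Finset.sum_smul, mul_smul]
  congr 1
  exact Finset.sum_comm

theorem sum_pairOp_psumTheta (n : ℕ) (hs : IsSymm (psumTheta K N n)) :
    ∑ j : Fin N, ∑ k, (pairOp K j k).rTensor _ (psumTheta K N n) =
      (2 : MvPolynomial (Fin N) K) • ((n * N : MvPolynomial (Fin N) K) • psumTheta K N n
        + (2 : MvPolynomial (Fin N) K) •
        ∑ a ∈ Finset.range n, ((n - (a + 1) : ℕ) : MvPolynomial (Fin N) K) •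
          psumX K N (a + 1) • psumTheta K N (n - (a + 1))
        - (n ^ 2 : MvPolynomial (Fin N) K) • psumTheta K N n) := by
  have h : ∀ j k : Fin N, (pairOp K j k).rTensor _ (psumTheta K N n) =
      weightedGeomSum n (X j : MvPolynomial (Fin N) K) (X k) • thetaVar K j
      + weightedGeomSum n (X k : MvPolynomial (Fin N) K) (X j) • thetaVar K k
      - if j = k then ((2 * n ^ 2 : MvPolynomial (Fin N) K) * X j ^ n) • thetaVar K j else 0 := by
    intro j k
    split_ifs with hjk
    · subst hjk
      rw [pairOp_self, LinearMap.rTensor_zero, LinearMap.zero_apply, weightedGeomSum_self]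
      module
    · rw [pairOp_psumTheta hjk n hs, sub_zero]
  simp only [h, Finset.sum_sub_distrib, Finset.sum_add_distrib, Finset.sum_ite_eq, Finset.mem_univ,
    if_true]
  rw [Finset.sum_comm (f := fun j k =>
    weightedGeomSum n (X k : MvPolynomial (Fin N) K) (X j) • thetaVar K k), sum_weightedGeomSum]
  simp only [mul_smul, ← Finset.smul_sum]
  rw [← psumTheta]
  module

theorem hamiltonian_psumTheta [CharZero K] (β : K) (n : ℕ) (hs : IsSymm (psumTheta K N n)) :
    hamiltonian β N (psumTheta K N n) =
      ((n : K) ^ 2 + β * (n : K) * ((N : K) - (n : K))) • psumTheta K N n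
      + (2 * β) • ∑ a ∈ Finset.range n, ((n - (a + 1) : ℕ) : K) •
          psumX K N (a + 1) • psumTheta K N (n - (a + 1)) := by
  have h : ∑ j, superXDeriv K j (superXDeriv K j (psumTheta K N n)) =
      ((n : K) ^ 2) • psumTheta K N n := by
    simp only [superXDeriv_psumTheta, map_smul, superXDeriv_smul, superXDeriv_thetaVar, smul_zero,
      add_zero, xDeriv_X_pow, if_true]
    simp only [psumTheta, Finset.smul_sum, ← Nat.cast_smul_eq_nsmul K, smul_assoc, smul_smul,
      pow_two]
  rw [hamiltonian_apply, h, sum_pairOp_psumTheta n hs]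
  have hn : ∀ (m : ℕ) (F : Superpoly K N), (m : MvPolynomial (Fin N) K) • F = (m : K) • F := by
    intro m F
    rw [Nat.cast_smul_eq_nsmul, Nat.cast_smul_eq_nsmul]
  have h2 : ∀ (F : Superpoly K N), (2 : MvPolynomial (Fin N) K) • F = (2 : K) • F := fun F => by
    simpa using hn 2 F
  simp only [← Nat.cast_mul, ← Nat.cast_pow, hn, h2]
  push_cast
  match_scalars <;> field_simp

/-! ### The charge `ℐ` on symmetric superpolynomials -/

theorem map_thetaDeriv (σ : Equiv.Perm (Fin N)) (i : Fin N) (w : ExteriorAlgebra K (Fin N → K)) :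
    ExteriorAlgebra.map (LinearMap.funLeft K K σ.symm) (thetaDeriv K i w) =
      thetaDeriv K (σ i) (ExteriorAlgebra.map (LinearMap.funLeft K K σ.symm) w) := by
  induction w using exteriorAlgebra_induction with
  | algebraMap r => rw [AlgHom.commutes, thetaDeriv_algebraMap, thetaDeriv_algebraMap, map_zero]
  | add a b ha hb => simp only [map_add, ha, hb]
  | ι_mul v w h =>
    rw [thetaDeriv_ι_mul, map_sub, map_smul, map_mul, h, map_mul, ExteriorAlgebra.map_apply_ι,
      thetaDeriv_ι_mul, LinearMap.funLeft_apply, Equiv.symm_apply_apply]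

theorem map_theta (σ : Equiv.Perm (Fin N)) (i : Fin N) :
    ExteriorAlgebra.map (LinearMap.funLeft K K σ.symm) (theta K i) = theta K (σ i) := by
  rw [theta, theta, ExteriorAlgebra.map_apply_ι]
  congr 1
  ext j
  simp [LinearMap.funLeft_apply, Pi.single_apply, Equiv.symm_apply_eq]

theorem diagPerm_superTransfer (σ : Equiv.Perm (Fin N)) (i j : Fin N) (F : Superpoly K N) :
    diagPerm K σ (superTransfer K i j F) = superTransfer K (σ i) (σ j) (diagPerm K σ F) := by
  induction F using TensorProduct.induction_on with
  | zero => simp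
  | add x y hx hy => simp only [map_add, hx, hy]
  | tmul f w =>
    simp only [diagPerm, superTransfer, LinearMap.lTensor_tmul, Algebra.TensorProduct.map_tmul,
      thetaTransfer_apply, map_mul, map_thetaDeriv, map_theta]

theorem diagPerm_rTensor (σ : Equiv.Perm (Fin N)) {D D' : Module.End K (MvPolynomial (Fin N) K)}
    (h : ∀ f, rename σ (D f) = D' (rename σ f)) (F : Superpoly K N) :
    diagPerm K σ (D.rTensor _ F) = D'.rTensor _ (diagPerm K σ F) := by
  induction F using TensorProduct.induction_on with
  | zero => simp
  | add x y hx hy => simp only [map_add, hx, hy]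
  | tmul f w =>
    simp only [diagPerm, LinearMap.rTensor_tmul, Algebra.TensorProduct.map_tmul, h]

/-- The permutation-covariant version `x_j ∂_{x_j} + β ∑_{k ≠ j} x_k / (x_j - x_k) (1 - K_{jk})` of
the Dunkl operators. -/
def covariantDunkl (β : K) (j : Fin N) : Module.End K (MvPolynomial (Fin N) K) :=
  xDeriv K j + β • ∑ k, xDivDiff K j k

theorem rename_covariantDunkl (β : K) (σ : Equiv.Perm (Fin N)) (j : Fin N)
    (f : MvPolynomial (Fin N) K) :
    rename σ (covariantDunkl β j f) = covariantDunkl β (σ j) (rename σ f) := by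
  simp only [covariantDunkl, LinearMap.add_apply, LinearMap.smul_apply, LinearMap.sum_apply,
    map_add, map_smul, map_sum, rename_xDeriv, rename_xDivDiff]
  rw [Equiv.sum_comp σ (fun k => xDivDiff K (σ j) k (rename σ f))]

/-- Only the first Dunkl–Cherednik operator has no indices k < j, hence no exchange correction. Its
conjugates under 𝒦_σ are therefore the covariant operators. -/
theorem dunklPoly_zero (β : K) (n : ℕ) :
    dunklPoly β (0 : Fin (n + 1)) = covariantDunkl β 0 := by
  rw [dunklPoly_eq, covariantDunkl]
  congr 2
  exact Finset.sum_congr rfl fun k _ => by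
    rw [dunklPart, if_neg (Fin.not_lt_zero k), sub_zero]

theorem sum_perm_apply_zero {A : Type*} [AddCommMonoid A] (n : ℕ) (g : Fin (n + 1) → A) :
    ∑ σ : Equiv.Perm (Fin (n + 1)), g (σ 0) = n.factorial • ∑ i, g i := by
  rw [← Equiv.sum_comp Equiv.Perm.decomposeFin.symm, Fintype.sum_prod_type]
  simp [Fintype.card_perm, Finset.smul_sum]

theorem chargeI_apply [CharZero K] (β : K) {F : Superpoly K N} (hF : IsSymm F) :
    chargeI β N 1 F = ∑ i, superTransfer K i i ((covariantDunkl β i).rTensor _ F) := by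
  rcases N with _ | n
  · simp [chargeI]
  have h : ∀ σ : Equiv.Perm (Fin (n + 1)), ((diagPerm K σ).toLinearMap ∘ₗ
      (thetaDTheta K 0 ∘ₗ dunkl β 0 ^ 1) ∘ₗ (diagPerm K σ⁻¹).toLinearMap) F =
      superTransfer K (σ 0) (σ 0) ((covariantDunkl β (σ 0)).rTensor _ F) := by
    intro σ
    rw [LinearMap.comp_apply, LinearMap.comp_apply, AlgHom.toLinearMap_apply,
      AlgHom.toLinearMap_apply, hF, pow_one, dunkl, dunklPoly_zero]
    change diagPerm K σ (superTransfer K 0 0 _) = _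
    rw [diagPerm_superTransfer, diagPerm_rTensor σ (rename_covariantDunkl β σ 0), hF]
  rw [chargeI, LinearMap.smul_apply, LinearMap.sum_apply, Finset.sum_congr rfl fun σ _ => h σ,
    sum_perm_apply_zero n fun i => superTransfer K i i ((covariantDunkl β i).rTensor _ F),
    ← Nat.cast_smul_eq_nsmul K, smul_smul,
    inv_mul_cancel₀ (Nat.cast_ne_zero.2 n.factorial_ne_zero), one_smul]

theorem superTransfer_self_superTransfer_self (i : Fin N) (F : Superpoly K N) :
    superTransfer K i i (superTransfer K i i F) = superTransfer K i i F := by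
  induction F using TensorProduct.induction_on with
  | zero => simp
  | add x y hx hy => simp only [map_add, hx, hy]
  | tmul f w =>
    simp only [superTransfer, LinearMap.lTensor_tmul, thetaTransfer_apply,
      thetaDeriv_theta_mul_self, thetaDeriv_self, mul_zero, sub_zero]

theorem superTransfer_self_comm (i k : Fin N) (F : Superpoly K N) :
    superTransfer K i i (superTransfer K k k F) = superTransfer K k k (superTransfer K i i F) := by
  by_cases h : i = k
  · rw [h]
  induction F using TensorProduct.induction_on with
  | zero => simp
  | add x y hx hy => simp only [map_add, hx, hy]
  | tmul f w =>
    simp only [superTransfer, LinearMap.lTensor_tmul, thetaTransfer_apply,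
      thetaDeriv_theta_mul_of_ne h, thetaDeriv_theta_mul_of_ne (Ne.symm h), thetaDeriv_comm i k,
      mul_neg, ← mul_assoc, theta_mul_theta i k, neg_mul, neg_neg]

/-- For a derivation D with D² = D, comparing D²(FG) with D(FG) leaves 2 (DF)(DG) = 0. -/
theorem superTransfer_self_mul_superTransfer_self [CharZero K] (i : Fin N) (F G : Superpoly K N) :
    superTransfer K i i F * superTransfer K i i G = 0 := by
  have h := superTransfer_self_superTransfer_self i (F * G)
  rw [isLeibniz_superTransfer i i F G, map_add, isLeibniz_superTransfer i i _ G,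
    isLeibniz_superTransfer i i F _, superTransfer_self_superTransfer_self,
    superTransfer_self_superTransfer_self] at h
  have h2 : (2 : K) • (superTransfer K i i F * superTransfer K i i G) = 0 := by
    rw [two_smul, ← sub_eq_zero.2 h]; abel
  exact (smul_eq_zero.1 h2).resolve_left two_ne_zero

/-- The fermion number operator `∑_i θ_i ∂_{θ_i}`. -/
def fermionNumber (K : Type) [Field K] (N : ℕ) : Module.End K (Superpoly K N) :=
  ∑ i, superTransfer K i i

/-- The two-body part of the charge `ℐ`. -/
def pairCharge (K : Type) [Field K] {N : ℕ} (i k : Fin N) : Module.End K (Superpoly K N) :=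
  superTransfer K i i ∘ₗ (xDivDiff K i k).rTensor _ +
    superTransfer K k k ∘ₗ (xDivDiff K k i).rTensor _

theorem pairCharge_self (i : Fin N) : pairCharge K i i = 0 := by
  simp [pairCharge, xDivDiff, divDiff_self]

theorem chargeI_eq_pairCharge [CharZero K] (β : K) {F : Superpoly K N} (hF : IsSymm F) :
    chargeI β N 1 F = ∑ i, superTransfer K i i (superXDeriv K i F)
      + (β / 2) • ∑ i, ∑ k, pairCharge K i k F := by
  have h : ∑ i, ∑ k, pairCharge K i k F =
      (2 : K) • ∑ i, ∑ k, superTransfer K i i ((xDivDiff K i k).rTensor _ F) := by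
    simp only [pairCharge, LinearMap.add_apply, LinearMap.comp_apply, Finset.sum_add_distrib]
    rw [two_smul]
    congr 1
    exact Finset.sum_comm
  rw [chargeI_apply β hF, h, smul_smul, div_mul_cancel₀ β two_ne_zero, Finset.smul_sum,
    ← Finset.sum_add_distrib]
  refine Finset.sum_congr rfl fun i _ => ?_
  rw [covariantDunkl, LinearMap.rTensor_add, LinearMap.rTensor_smul, ← LinearMap.coe_rTensorHom,
    map_sum]
  simp only [LinearMap.add_apply, LinearMap.smul_apply, LinearMap.sum_apply, map_add, map_smul,
    map_sum, LinearMap.coe_rTensorHom]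
  rfl

theorem xDivDiff_rTensor_spec {j k : Fin N} (h : j ≠ k) {F : Superpoly K N} (hF : IsSymm F) :
    (X j - X k : MvPolynomial (Fin N) K) • (xDivDiff K j k).rTensor _ F =
      (X k : MvPolynomial (Fin N) K) • (F - (swapTheta K j k).toLinearMap.lTensor _ F) := by
  rw [← swapX_rTensor_of_isSymm hF]
  clear hF
  induction F using TensorProduct.induction_on with
  | zero => simp
  | add x y hx hy => simp only [map_add, smul_add, hx, hy, smul_sub]; abel
  | tmul f w =>
    simp only [LinearMap.rTensor_tmul, ← TensorProduct.sub_tmul, TensorProduct.smul_tmul',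
      smul_eq_mul, xDivDiff_spec h]

theorem superTransfer_self_sub_swapTheta {j k : Fin N} (h : j ≠ k) (F : Superpoly K N) :
    superTransfer K j j (F - (swapTheta K j k).toLinearMap.lTensor _ F) =
      superTransfer K j j F - superTransfer K j k F + superTransfer K j j (superTransfer K k k F) := by
  induction F using TensorProduct.induction_on with
  | zero => simp
  | add x y hx hy =>
    rw [map_sub] at hx hy ⊢
    simp only [map_add]
    rw [add_sub_add_comm, hx, hy]
    abel
  | tmul f w =>
    rw [LinearMap.lTensor_tmul, ← TensorProduct.tmul_sub, AlgHom.toLinearMap_apply, superTransfer,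
      LinearMap.lTensor_tmul, thetaTransfer_self_sub_swapTheta h, TensorProduct.tmul_add,
      TensorProduct.tmul_sub]
    rfl

/-- The derivation that occurs in the two-body part of `ℐ`. -/
def chargeDerivation (K : Type) [Field K] {N : ℕ} (i k : Fin N) : Module.End K (Superpoly K N) :=
  (X k : MvPolynomial (Fin N) K) • (superTransfer K i i - superTransfer K i k)
    - (X i : MvPolynomial (Fin N) K) • (superTransfer K k k - superTransfer K k i)

theorem isLeibniz_chargeDerivation (i k : Fin N) : IsLeibniz (chargeDerivation K i k) :=
  (((isLeibniz_superTransfer (K := K) i i).sub (isLeibniz_superTransfer i k)).smul _).sub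
    (((isLeibniz_superTransfer (K := K) k k).sub (isLeibniz_superTransfer k i)).smul _)

/-- With n_i = θ_i∂_{θ_i}, the second-order term n_i n_k occurs with factor x_k in one summand and
-x_i in the other. Its total factor is -(x_i - x_k), so adding n_i n_k to `pairCharge` leaves a
derivation divided by x_i - x_k. -/
theorem pairCharge_spec {i k : Fin N} (h : i ≠ k) {F : Superpoly K N} (hF : IsSymm F) :
    (X i - X k : MvPolynomial (Fin N) K) •
      (pairCharge K i k F + superTransfer K i i (superTransfer K k k F)) =
      chargeDerivation K i k F := by
  have h1 := congrArg (superTransfer K i i) (xDivDiff_rTensor_spec h hF)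
  have h2 := congrArg (superTransfer K k k) (xDivDiff_rTensor_spec h.symm hF)
  rw [superTransfer_smul, superTransfer_smul, superTransfer_self_sub_swapTheta h] at h1
  rw [superTransfer_smul, superTransfer_smul, superTransfer_self_sub_swapTheta h.symm,
    superTransfer_self_comm k i] at h2
  have h3 : ∀ H : Superpoly K N, (X i - X k : MvPolynomial (Fin N) K) • H =
      -((X k - X i : MvPolynomial (Fin N) K) • H) := fun H => by module
  rw [pairCharge, LinearMap.add_apply, smul_add, smul_add, LinearMap.comp_apply,
    LinearMap.comp_apply, h1, h3 (superTransfer K k k _), h2]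
  simp only [chargeDerivation, LinearMap.sub_apply, LinearMap.smul_apply]
  module

theorem pairCharge_mul {i k : Fin N} (h : i ≠ k) {F G : Superpoly K N} (hF : IsSymm F)
    (hG : IsSymm G) :
    pairCharge K i k (F * G) = pairCharge K i k F * G + F * pairCharge K i k G
      - (superTransfer K i i F * superTransfer K k k G
        + superTransfer K k k F * superTransfer K i i G) := by
  have key : pairCharge K i k (F * G) + superTransfer K i i (superTransfer K k k (F * G)) =
      (pairCharge K i k F + superTransfer K i i (superTransfer K k k F)) * G
      + F * (pairCharge K i k G + superTransfer K i i (superTransfer K k k G)) := by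
    apply smul_left_cancel_superpoly (X_sub_X_ne_zero K h)
    rw [pairCharge_spec h (hF.mul hG), isLeibniz_chargeDerivation i k F G, ← pairCharge_spec h hF,
      ← pairCharge_spec h hG, smul_mul_assoc, mul_smul_comm, ← smul_add]
  rw [isLeibniz_superTransfer k k F G, map_add, isLeibniz_superTransfer i i _ G,
    isLeibniz_superTransfer i i F _, add_mul, mul_add, ← eq_sub_iff_add_eq] at key
  rw [key]
  abel

/-- The last term collects the cross terms of the products n_i n_k, n_i = θ_i∂_{θ_i}. Because (n_i
F)(n_i G) = 0, the missing diagonal may be added, and the double sum factors into two total fermion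
numbers. -/
theorem chargeI_mul [CharZero K] (β : K) {F G : Superpoly K N} (hF : IsSymm F) (hG : IsSymm G) :
    chargeI β N 1 (F * G) = chargeI β N 1 F * G + F * chargeI β N 1 G
      + ∑ i, (superTransfer K i i F * superXDeriv K i G + superXDeriv K i F * superTransfer K i i G)
      - β • (fermionNumber K N F * fermionNumber K N G) := by
  have h1 : ∀ i : Fin N, superTransfer K i i (superXDeriv K i (F * G)) =
      superTransfer K i i (superXDeriv K i F) * G + F * superTransfer K i i (superXDeriv K i G)
      + (superTransfer K i i F * superXDeriv K i G
        + superXDeriv K i F * superTransfer K i i G) := by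
    intro i
    rw [isLeibniz_superXDeriv i F G, map_add, isLeibniz_superTransfer i i _ G,
      isLeibniz_superTransfer i i F _]
    abel
  have h2 : ∀ i k : Fin N, pairCharge K i k (F * G) =
      pairCharge K i k F * G + F * pairCharge K i k G
      - (superTransfer K i i F * superTransfer K k k G
        + superTransfer K k k F * superTransfer K i i G) := by
    intro i k
    by_cases h : i = k
    · subst h
      simp [pairCharge_self, superTransfer_self_mul_superTransfer_self]
    · exact pairCharge_mul h hF hG
  have h3 : ∑ i : Fin N, ∑ k : Fin N, (superTransfer K i i F * superTransfer K k k G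
        + superTransfer K k k F * superTransfer K i i G) =
      (2 : K) • (fermionNumber K N F * fermionNumber K N G) := by
    simp only [fermionNumber, LinearMap.sum_apply, Finset.sum_mul_sum, two_smul,
      Finset.sum_add_distrib]
    congr 1
    exact Finset.sum_comm
  rw [chargeI_eq_pairCharge β (hF.mul hG), chargeI_eq_pairCharge β hF, chargeI_eq_pairCharge β hG]
  simp only [h1, h2, Finset.sum_sub_distrib]
  rw [h3]
  simp only [Finset.sum_add_distrib, ← Finset.sum_mul, ← Finset.mul_sum, add_mul, mul_add,
    smul_mul_assoc, mul_smul_comm]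
  module

theorem superTransfer_smul_one (i j : Fin N) (f : MvPolynomial (Fin N) K) :
    superTransfer K i j (f • 1) = 0 := by
  rw [superTransfer_smul, (isLeibniz_superTransfer (K := K) i j).map_one, smul_zero]

theorem chargeI_smul_one [CharZero K] (β : K) (f : MvPolynomial (Fin N) K)
    (hf : IsSymm (f • (1 : Superpoly K N))) : chargeI β N 1 (f • 1) = 0 := by
  rw [chargeI_apply β hf]
  refine Finset.sum_eq_zero fun i _ => ?_
  rw [Algebra.TensorProduct.one_def, TensorProduct.smul_tmul', LinearMap.rTensor_tmul]
  have := superTransfer_smul_one (K := K) i i (covariantDunkl β i f)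
  rw [Algebra.TensorProduct.one_def, TensorProduct.smul_tmul'] at this
  simpa using this

theorem pairCharge_psumTheta {i k : Fin N} (h : i ≠ k) (n : ℕ) (hs : IsSymm (psumTheta K N n)) :
    pairCharge K i k (psumTheta K N n) = (∑ a ∈ Finset.range n,
        X k ^ (a + 1) * X i ^ (n - (a + 1)) : MvPolynomial (Fin N) K) • thetaVar K i
      + (∑ a ∈ Finset.range n,
        X i ^ (a + 1) * X k ^ (n - (a + 1)) : MvPolynomial (Fin N) K) • thetaVar K k := by
  have hg : ∀ i k : Fin N, (X k - X i) * (∑ a ∈ Finset.range n,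
      X k ^ (a + 1) * X i ^ (n - (a + 1)) : MvPolynomial (Fin N) K) =
      X k * (X k ^ n - X i ^ n) := by
    intro i k
    have := (Commute.all (X k : MvPolynomial (Fin N) K) (X i)).geom_sum₂_mul n
    rw [← this, Finset.sum_mul, Finset.mul_sum, Finset.mul_sum]
    refine Finset.sum_congr rfl fun a _ => ?_
    rw [Nat.sub_sub, add_comm 1 a]
    ring
  have h0 : superTransfer K i i (superTransfer K k k (psumTheta K N n)) = 0 := by
    rw [superTransfer_psumTheta, superTransfer_smul, superTransfer_thetaVar, if_neg h, smul_zero]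
  apply smul_left_cancel_superpoly (X_sub_X_ne_zero K h)
  have h1 := pairCharge_spec h hs
  rw [h0, add_zero] at h1
  rw [h1, smul_add, smul_smul, smul_smul, hg k i, ← neg_sub (X k) (X i), neg_mul, hg i k]
  simp only [chargeDerivation, LinearMap.sub_apply, LinearMap.smul_apply, superTransfer_psumTheta]
  module

theorem chargeI_psumTheta [CharZero K] (β : K) (n : ℕ) (hs : IsSymm (psumTheta K N n)) :
    chargeI β N 1 (psumTheta K N n) = ((n : K) * (1 - β)) • psumTheta K N n
      + β • ∑ a ∈ Finset.range n, psumX K N (a + 1) • psumTheta K N (n - (a + 1)) := by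
  have h0 : ∑ i, superTransfer K i i (superXDeriv K i (psumTheta K N n)) =
      (n : K) • psumTheta K N n := by
    simp only [superXDeriv_psumTheta, map_smul, superTransfer_smul, superTransfer_thetaVar, if_true]
    rw [psumTheta, Finset.smul_sum]
  have h : ∀ i k : Fin N, pairCharge K i k (psumTheta K N n) = (∑ a ∈ Finset.range n,
        X k ^ (a + 1) * X i ^ (n - (a + 1)) : MvPolynomial (Fin N) K) • thetaVar K i
      + (∑ a ∈ Finset.range n,
        X i ^ (a + 1) * X k ^ (n - (a + 1)) : MvPolynomial (Fin N) K) • thetaVar K k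
      - if i = k then (2 : ℕ) • (n : K) • (X i ^ n : MvPolynomial (Fin N) K) • thetaVar K i
        else 0 := by
    intro i k
    split_ifs with hik
    · subst hik
      have : ∀ a ∈ Finset.range n,
          (X i ^ (a + 1) * X i ^ (n - (a + 1)) : MvPolynomial (Fin N) K) = X i ^ n := by
        intro a ha
        rw [← pow_add, Nat.add_sub_cancel' (Finset.mem_range.1 ha)]
      rw [pairCharge_self, LinearMap.zero_apply, Finset.sum_congr rfl this, Finset.sum_const,
        Finset.card_range, ← Nat.cast_smul_eq_nsmul K, smul_assoc]
      module
    · rw [pairCharge_psumTheta hik n hs, sub_zero]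
  have h1 : ∑ i : Fin N, ∑ k : Fin N, (∑ a ∈ Finset.range n,
        X k ^ (a + 1) * X i ^ (n - (a + 1)) : MvPolynomial (Fin N) K) • thetaVar K i =
      ∑ a ∈ Finset.range n, psumX K N (a + 1) • psumTheta K N (n - (a + 1)) := by
    simp only [psumX, psumTheta, Finset.smul_sum, Finset.sum_smul, mul_smul]
    calc _ = ∑ i : Fin N, ∑ a ∈ Finset.range n, ∑ k : Fin N,
          (X k ^ (a + 1) : MvPolynomial (Fin N) K) •
            (X i ^ (n - (a + 1)) : MvPolynomial (Fin N) K) • thetaVar K i :=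
          Finset.sum_congr rfl fun j _ => Finset.sum_comm
      _ = _ := Finset.sum_comm
  rw [chargeI_eq_pairCharge β hs, h0]
  simp only [h, Finset.sum_sub_distrib, Finset.sum_add_distrib, Finset.sum_ite_eq, Finset.mem_univ,
    if_true]
  rw [Finset.sum_comm (f := fun i k => (∑ a ∈ Finset.range n,
        X i ^ (a + 1) * X k ^ (n - (a + 1)) : MvPolynomial (Fin N) K) • thetaVar K k), h1,
    ← Finset.smul_sum, ← Finset.smul_sum]
  have hp : ∑ i : Fin N, (X i ^ n : MvPolynomial (Fin N) K) • thetaVar K i = psumTheta K N n := rfl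
  rw [hp]
  match_scalars <;> field_simp <;> ring

section fock

/-! ### Products of power sums in finitely many variables -/

theorem thetaVar_mul_thetaVar (i j : Fin N) :
    thetaVar K i * thetaVar K j = -(thetaVar K j * thetaVar K i) := by
  rw [thetaVar, thetaVar, Algebra.TensorProduct.tmul_mul_tmul, Algebra.TensorProduct.tmul_mul_tmul,
    ι_mul_ι_comm, TensorProduct.tmul_neg]

theorem psumTheta_mul_psumTheta (m n : ℕ) :
    psumTheta K N m * psumTheta K N n = -(psumTheta K N n * psumTheta K N m) := by
  simp only [psumTheta, Finset.sum_mul_sum]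
  rw [Finset.sum_comm]
  simp only [← Finset.sum_neg_distrib]
  refine Finset.sum_congr rfl fun i _ => Finset.sum_congr rfl fun j _ => ?_
  rw [smul_mul_smul_comm, smul_mul_smul_comm, thetaVar_mul_thetaVar, smul_neg, mul_comm (X j ^ m)]

theorem thetaVar_mul_self (i : Fin N) : thetaVar K i * thetaVar K i = 0 := by
  rw [thetaVar, Algebra.TensorProduct.tmul_mul_tmul, ExteriorAlgebra.ι_sq_zero,
    TensorProduct.tmul_zero]

theorem psumTheta_mul_psumTheta_mul (m n : ℕ) (F : Superpoly K N) :
    psumTheta K N m * (psumTheta K N n * F) = -(psumTheta K N n * (psumTheta K N m * F)) := by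
  rw [← mul_assoc, psumTheta_mul_psumTheta, ← mul_assoc]
  exact neg_mul (psumTheta K N n * psumTheta K N m) F

theorem bosonicPowerSum_apply (n : ℕ+) (N : ℕ) :
    (bosonicPowerSum K n : ∀ N, Superpoly K N) N = psumX K N n • (1 : Superpoly K N) := by
  simp only [bosonicPowerSum, psumX, Finset.sum_smul]
  refine Finset.sum_congr rfl fun i _ => ?_
  rw [xVar, Algebra.TensorProduct.tmul_pow, one_pow, Algebra.TensorProduct.one_def,
    TensorProduct.smul_tmul', smul_eq_mul, mul_one]

theorem X_pow_smul_thetaVar (i : Fin N) (n : ℕ) :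
    (X i ^ n : MvPolynomial (Fin N) K) • thetaVar K i = thetaVar K i * xVar K i ^ n := by
  rw [xVar, thetaVar, Algebra.TensorProduct.tmul_pow, one_pow, TensorProduct.smul_tmul',
    Algebra.TensorProduct.tmul_mul_tmul]
  simp

theorem fermionicPowerSum_apply (n N : ℕ) :
    (fermionicPowerSum K n : ∀ N, Superpoly K N) N = psumTheta K N n := by
  simp only [fermionicPowerSum, psumTheta, X_pow_smul_thetaVar]

theorem isSymm_apply (F : symmetricSuperfunctions K) (N : ℕ) :
    IsSymm ((F : ∀ N, Superpoly K N) N) :=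
  (mem_symmetricSuperfunctions.1 F.2).1 N

theorem isSymm_psumTheta (n : ℕ) : IsSymm (psumTheta K N n) := by
  rw [← fermionicPowerSum_apply]
  exact isSymm_apply _ _

theorem isSymm_psumX_smul_one (n : ℕ+) : IsSymm (psumX K N n • (1 : Superpoly K N)) := by
  rw [← bosonicPowerSum_apply]
  exact isSymm_apply _ _

/-! ### Ordered products of anticommuting elements -/

/-- The product of the `p̃_n`, `n ∈ S`, in decreasing order. -/
def psumThetaProd (K : Type) [Field K] (N : ℕ) (S : Finset ℕ) : Superpoly K N :=
  ((S.sort (· ≥ ·)).map (psumTheta K N)).prod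

theorem psumThetaProd_empty : psumThetaProd K N ∅ = 1 := by simp [psumThetaProd]

theorem sort_insert_max {S : Finset ℕ} {k : ℕ} (h : ∀ x ∈ S, x < k) :
    (insert k S).sort (· ≥ ·) = k :: S.sort (· ≥ ·) :=
  Finset.sort_insert (· ≥ ·) (fun x hx => (h x hx).le) fun hk => lt_irrefl k (h k hk)

theorem psumThetaProd_insert_max {S : Finset ℕ} {k : ℕ} (h : ∀ x ∈ S, x < k) :
    psumThetaProd K N (insert k S) = psumTheta K N k * psumThetaProd K N S := by
  rw [psumThetaProd, sort_insert_max h, List.map_cons, List.prod_cons, psumThetaProd]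

/-- The sign `(-1) ^ #{k ∈ S | n < k}`. -/
def orderSign (K : Type) [Field K] (n : ℕ) (S : Finset ℕ) : K :=
  (-1) ^ (S.filter (n < ·)).card

theorem orderSign_mul_self (n : ℕ) (S : Finset ℕ) : orderSign K n S * orderSign K n S = 1 := by
  rw [orderSign, ← mul_pow]; simp

theorem orderSign_of_forall_lt {S : Finset ℕ} {k : ℕ} (h : ∀ x ∈ S, x < k) :
    orderSign K k S = 1 := by
  rw [orderSign, Finset.filter_false_of_mem fun x hx => (h x hx).asymm, Finset.card_empty, pow_zero]

theorem orderSign_insert_of_lt {S : Finset ℕ} {n k : ℕ} (hk : k ∉ S) (h : n < k) :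
    orderSign K n (insert k S) = -orderSign K n S := by
  rw [orderSign, Finset.filter_insert, if_pos h, Finset.card_insert_of_notMem, pow_succ, orderSign]
  · ring
  · simp [hk]

theorem orderSign_insert_self (n : ℕ) (S : Finset ℕ) :
    orderSign K n (insert n S) = orderSign K n S := by
  rw [orderSign, Finset.filter_insert, if_neg (lt_irrefl n), orderSign]

theorem orderSign_erase_self (n : ℕ) (S : Finset ℕ) :
    orderSign K n (S.erase n) = orderSign K n S := by
  rw [orderSign, orderSign]
  congr 2
  ext x
  simp only [Finset.mem_filter, Finset.mem_erase]
  constructor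
  · rintro ⟨⟨_, h⟩, h'⟩; exact ⟨h, h'⟩
  · rintro ⟨h, h'⟩; exact ⟨⟨h'.ne', h⟩, h'⟩

section anticommute

variable {A : Type*} [Semiring A] [Algebra K A] (f : ℕ → A)

theorem list_prod_mul_of_anticommute (h : ∀ m n, f m * f n = (-1 : K) • (f n * f m)) (a : ℕ)
    (l : List ℕ) :
    (l.map f).prod * f a = ((-1 : K) ^ l.length) • (f a * (l.map f).prod) := by
  induction l with
  | nil => simp
  | cons b l ih =>
    rw [List.map_cons, List.prod_cons, mul_assoc, ih, List.length_cons, pow_succ, mul_smul_comm,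
      ← mul_assoc, h b a, ← mul_assoc (f a), mul_smul, smul_mul_assoc]

theorem list_prod_reverse_of_anticommute (h : ∀ m n, f m * f n = (-1 : K) • (f n * f m))
    (l : List ℕ) :
    (l.reverse.map f).prod = ((-1 : K) ^ (l.length * (l.length - 1) / 2)) • (l.map f).prod := by
  induction l with
  | nil => simp
  | cons a l ih =>
    rw [List.reverse_cons, List.map_append, List.prod_append, ih, List.map_singleton,
      List.prod_singleton, smul_mul_assoc, list_prod_mul_of_anticommute f h, smul_smul, ← pow_add, List.map_cons,
      List.prod_cons, List.length_cons, Nat.add_sub_cancel]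
    congr 2
    rcases Nat.eq_zero_or_pos l.length with h0 | h0
    · simp [h0]
    · obtain ⟨m, hm⟩ : ∃ m, l.length = m + 1 := ⟨l.length - 1, by omega⟩
      rw [hm, Nat.add_sub_cancel, show (m + 1 + 1) * (m + 1) = (m + 1) * m + (m + 1) * 2 by ring,
        Nat.add_mul_div_right _ _ two_pos]

/-- Moving f n to its place passes exactly the larger elements, with one sign each; a repeated
element gives 0. The algebra is arbitrary because the rule serves both the p̃_n and the coefficient
operators `lowerTheta`. -/
theorem mul_sort_prod_of_anticommute [CharZero K]
    (h : ∀ m n, f m * f n = (-1 : K) • (f n * f m)) (n : ℕ) (S : Finset ℕ) :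
    f n * ((S.sort (· ≥ ·)).map f).prod =
      if n ∈ S then 0 else orderSign K n S • (((insert n S).sort (· ≥ ·)).map f).prod := by
  have hs : ∀ m, f m * f m = 0 := fun m => by
    have h2 : (2 : K) • (f m * f m) = 0 := by
      have h1 : (1 : K) • (f m * f m) + (-1 : K) • (f m * f m) = 0 := by
        rw [← add_smul, add_neg_cancel, zero_smul]
      rwa [← h m m, ← one_smul K (f m * f m), smul_smul, ← add_smul, one_mul,
        one_add_one_eq_two] at h1
    rw [← one_smul K (f m * f m), ← inv_mul_cancel₀ (two_ne_zero (α := K)), mul_smul, h2, smul_zero]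
  induction S using Finset.induction_on_max with
  | empty =>
    rw [if_neg (Finset.notMem_empty n), orderSign_of_forall_lt (by simp), one_smul,
      sort_insert_max (by simp), List.map_cons, List.prod_cons]
  | insert k S hS ih =>
    have hk : k ∉ S := fun h => lt_irrefl k (hS k h)
    rw [sort_insert_max hS, List.map_cons, List.prod_cons, ← mul_assoc]
    rcases lt_trichotomy n k with hnk | rfl | hnk
    · rw [h, smul_mul_assoc, mul_assoc, ih]
      simp only [Finset.mem_insert, hnk.ne, false_or]
      split_ifs with hn
      · rw [mul_zero, smul_zero]
      · rw [orderSign_insert_of_lt hk hnk, Finset.insert_comm, sort_insert_max (k := k),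
          List.map_cons, List.prod_cons, mul_smul_comm, smul_smul, neg_one_mul]
        intro x hx
        rcases Finset.mem_insert.1 hx with rfl | hx
        exacts [hnk, hS x hx]
    · rw [if_pos (Finset.mem_insert_self _ _), hs, zero_mul]
    · have hn : ∀ x ∈ insert k S, x < n := by
        intro x hx
        rcases Finset.mem_insert.1 hx with rfl | hx
        exacts [hnk, (hS x hx).trans hnk]
      rw [if_neg fun h' => lt_irrefl n (hn n h'), orderSign_of_forall_lt hn, one_smul,
        sort_insert_max hn, List.map_cons, List.prod_cons, sort_insert_max hS, List.map_cons,
        List.prod_cons, mul_assoc]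

end anticommute

theorem psumTheta_mul_psumThetaProd [CharZero K] (n : ℕ) (S : Finset ℕ) :
    psumTheta K N n * psumThetaProd K N S =
      if n ∈ S then 0 else orderSign K n S • psumThetaProd K N (insert n S) :=
  mul_sort_prod_of_anticommute (psumTheta K N) (fun m n => (psumTheta_mul_psumTheta m n).trans
    (neg_one_smul K (psumTheta K N n * psumTheta K N m)).symm) n S

theorem powerSum_apply (L : Superpartition) (N : ℕ) :
    (powerSum K L : ∀ N, Superpoly K N) N =
      (L.2.map fun n : ℕ+ => psumX K N n).prod • psumThetaProd K N L.1 := by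
  have h1 : ∀ l : List ℕ, ((l.map (fermionicPowerSum K)).prod : ∀ N, Superpoly K N) N =
      (l.map (psumTheta K N)).prod := by
    intro l
    induction l with
    | nil => rfl
    | cons a l ih =>
      rw [List.map_cons, List.prod_cons, List.map_cons, List.prod_cons, ← ih,
        ← fermionicPowerSum_apply]
      rfl
  have h2 : ∀ l : List ℕ+, ((l.map (bosonicPowerSum K)).prod : ∀ N, Superpoly K N) N =
      (l.map fun n : ℕ+ => psumX K N n).prod • (1 : Superpoly K N) := by
    intro l
    induction l with
    | nil => simp
    | cons a l ih =>
      rw [List.map_cons, List.prod_cons, List.map_cons, List.prod_cons, mul_smul, ← ih,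
        ← one_mul (((l.map (bosonicPowerSum K)).prod : ∀ N, Superpoly K N) N), ← smul_mul_assoc,
        ← bosonicPowerSum_apply]
      rfl
  have h3 : (L.2.map fun n : ℕ+ => psumX K N n).prod =
      ((L.2.sort (· ≥ ·)).map fun n : ℕ+ => psumX K N n).prod := by
    conv_lhs => rw [← L.2.sort_eq (· ≥ ·), Multiset.map_coe, Multiset.prod_coe]
  rw [h3, powerSum]
  change ((L.1.sort (· ≥ ·)).map (fermionicPowerSum K)).prod.1 N *
    ((L.2.sort (· ≥ ·)).map (bosonicPowerSum K)).prod.1 N = _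
  rw [h1, h2, mul_smul_comm, mul_one, psumThetaProd]

/-! ### The Fock space -/

/-- The space with basis the superpartitions. -/
abbrev Fock (K : Type) [Field K] : Type := Superpartition →₀ K

/-- The linear map sending the basis vector of a superpartition `Λ` to `p_Λ` in `N` variables. -/
def realize (K : Type) [Field K] (N : ℕ) : Fock K →ₗ[K] Superpoly K N :=
  Finsupp.linearCombination K fun L => (powerSum K L : ∀ N, Superpoly K N) N

/-- The basis vector of the Fock space. -/
abbrev ket (K : Type) [Field K] (S : Finset ℕ) (μ : Multiset ℕ+) : Fock K :=
  Finsupp.single (S, μ) 1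

theorem realize_ket (S : Finset ℕ) (μ : Multiset ℕ+) :
    realize K N (ket K S μ) =
      (μ.map fun n : ℕ+ => psumX K N n).prod • psumThetaProd K N S := by
  rw [realize, Finsupp.linearCombination_single, one_smul, powerSum_apply]

theorem fock_hom_ext {A : Type*} [AddCommGroup A] [Module K A] {f g : Fock K →ₗ[K] A}
    (h : ∀ S μ, f (ket K S μ) = g (ket K S μ)) : f = g :=
  Finsupp.lhom_ext' fun L => LinearMap.ext_ring (h L.1 L.2)

/-- Multiplication by `p_n` on the Fock space. -/
def mulBoson (K : Type) [Field K] (n : ℕ+) : Module.End K (Fock K) :=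
  Finsupp.linearCombination K fun L => ket K L.1 (n ::ₘ L.2)

/-- The derivative `∂_{p_n}` on the Fock space. -/
def derivBoson (K : Type) [Field K] (n : ℕ+) : Module.End K (Fock K) :=
  Finsupp.linearCombination K fun L => (L.2.count n : K) • ket K L.1 (L.2.erase n)

/-- Multiplication by `p̃_n` on the Fock space. -/
def mulFermion (K : Type) [Field K] (n : ℕ) : Module.End K (Fock K) :=
  Finsupp.linearCombination K fun L =>
    if n ∈ L.1 then 0 else orderSign K n L.1 • ket K (insert n L.1) L.2

/-- The derivative `∂_{p̃_n}` on the Fock space. -/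
def derivFermion (K : Type) [Field K] (n : ℕ) : Module.End K (Fock K) :=
  Finsupp.linearCombination K fun L =>
    if n ∈ L.1 then orderSign K n L.1 • ket K (L.1.erase n) L.2 else 0

/-- The diagonal operator with eigenvalues `c Λ`. -/
def diagonal (c : Superpartition → K) : Module.End K (Fock K) :=
  Finsupp.linearCombination K fun L => c L • ket K L.1 L.2

variable (S : Finset ℕ) (μ : Multiset ℕ+)

theorem mulBoson_ket (n : ℕ+) : mulBoson K n (ket K S μ) = ket K S (n ::ₘ μ) := by
  rw [mulBoson, Finsupp.linearCombination_single, one_smul]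

theorem derivBoson_ket (n : ℕ+) :
    derivBoson K n (ket K S μ) = (μ.count n : K) • ket K S (μ.erase n) := by
  rw [derivBoson, Finsupp.linearCombination_single, one_smul]

theorem mulFermion_ket (n : ℕ) : mulFermion K n (ket K S μ) =
    if n ∈ S then 0 else orderSign K n S • ket K (insert n S) μ := by
  rw [mulFermion, Finsupp.linearCombination_single, one_smul]

theorem derivFermion_ket (n : ℕ) : derivFermion K n (ket K S μ) =
    if n ∈ S then orderSign K n S • ket K (S.erase n) μ else 0 := by
  rw [derivFermion, Finsupp.linearCombination_single, one_smul]

theorem diagonal_ket (c : Superpartition → K) :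
    diagonal c (ket K S μ) = c (S, μ) • ket K S μ := by
  rw [diagonal, Finsupp.linearCombination_single, one_smul]

variable {S μ}

theorem realize_mulBoson (n : ℕ+) (v : Fock K) :
    realize K N (mulBoson K n v) = psumX K N n • realize K N v := by
  have : realize K N ∘ₗ mulBoson K n =
      Module.toModuleEnd K (S := MvPolynomial (Fin N) K) (Superpoly K N) (psumX K N n) ∘ₗ
        realize K N := by
    refine fock_hom_ext fun S μ => ?_
    rw [LinearMap.comp_apply, LinearMap.comp_apply, mulBoson_ket, realize_ket, realize_ket,
      Multiset.map_cons, Multiset.prod_cons, mul_smul]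
    rfl
  exact LinearMap.congr_fun this v

theorem realize_mulFermion [CharZero K] (n : ℕ) (v : Fock K) :
    realize K N (mulFermion K n v) = psumTheta K N n * realize K N v := by
  have : realize K N ∘ₗ mulFermion K n =
      LinearMap.mulLeft K (psumTheta K N n) ∘ₗ realize K N := by
    refine fock_hom_ext fun S μ => ?_
    rw [LinearMap.comp_apply, LinearMap.comp_apply, mulFermion_ket, LinearMap.mulLeft_apply,
      realize_ket, mul_smul_comm, psumTheta_mul_psumThetaProd]
    split_ifs with h
    · rw [map_zero, smul_zero]
    · rw [map_smul, realize_ket, smul_comm]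
  exact LinearMap.congr_fun this v

theorem derivBoson_mulBoson (m n : ℕ+) (v : Fock K) :
    derivBoson K m (mulBoson K n v) =
      mulBoson K n (derivBoson K m v) + if m = n then v else 0 := by
  have : derivBoson K m ∘ₗ mulBoson K n =
      mulBoson K n ∘ₗ derivBoson K m + if m = n then LinearMap.id else 0 := by
    refine fock_hom_ext fun S μ => ?_
    rw [LinearMap.add_apply, LinearMap.comp_apply, LinearMap.comp_apply, mulBoson_ket,
      derivBoson_ket, derivBoson_ket, map_smul, mulBoson_ket]
    split_ifs with h
    · subst h
      rw [Multiset.count_cons_self, Multiset.erase_cons_head, LinearMap.id_apply, Nat.cast_succ,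
        add_smul, one_smul]
      by_cases hm : m ∈ μ
      · rw [Multiset.cons_erase hm]
      · rw [Multiset.count_eq_zero_of_notMem hm, Nat.cast_zero, zero_smul, zero_smul]
    · rw [Multiset.count_cons_of_ne h, Multiset.erase_cons_tail _ (Ne.symm h), LinearMap.zero_apply,
        add_zero]
  have h2 := LinearMap.congr_fun this v
  split_ifs with h <;> simpa [h] using h2

theorem derivFermion_mulBoson (m : ℕ) (n : ℕ+) (v : Fock K) :
    derivFermion K m (mulBoson K n v) = mulBoson K n (derivFermion K m v) := by
  have : derivFermion K m ∘ₗ mulBoson K n = mulBoson K n ∘ₗ derivFermion K m := by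
    refine fock_hom_ext fun S μ => ?_
    rw [LinearMap.comp_apply, LinearMap.comp_apply, mulBoson_ket, derivFermion_ket,
      derivFermion_ket]
    split_ifs with h
    · rw [map_smul, mulBoson_ket]
    · rw [map_zero]
  exact LinearMap.congr_fun this v

theorem derivBoson_mulFermion (m : ℕ+) (n : ℕ) (v : Fock K) :
    derivBoson K m (mulFermion K n v) = mulFermion K n (derivBoson K m v) := by
  have : derivBoson K m ∘ₗ mulFermion K n = mulFermion K n ∘ₗ derivBoson K m := by
    refine fock_hom_ext fun S μ => ?_
    rw [LinearMap.comp_apply, LinearMap.comp_apply, mulFermion_ket, derivBoson_ket, map_smul,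
      mulFermion_ket]
    split_ifs with h
    · rw [map_zero, smul_zero]
    · rw [map_smul, derivBoson_ket, smul_comm]
  exact LinearMap.congr_fun this v

theorem ket_insert_max {k : ℕ} (h : ∀ x ∈ S, x < k) :
    ket K (insert k S) μ = mulFermion K k (ket K S μ) := by
  rw [mulFermion_ket, if_neg fun hk => lt_irrefl k (h k hk), orderSign_of_forall_lt h, one_smul]

/-- A new largest part goes to the front without a sign. This case of the anticommutation relation
suffices, since `ket_induction` always adds a new largest odd part. -/
theorem derivFermion_mulFermion_of_max {k : ℕ} (h : ∀ x ∈ S, x < k) (m : ℕ) :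
    derivFermion K m (mulFermion K k (ket K S μ)) =
      -mulFermion K k (derivFermion K m (ket K S μ)) + if m = k then ket K S μ else 0 := by
  have hk : k ∉ S := fun hk => lt_irrefl k (h k hk)
  rw [← ket_insert_max h, derivFermion_ket, derivFermion_ket]
  by_cases h1 : m = k
  · subst h1
    rw [if_pos (Finset.mem_insert_self _ _), if_neg hk, if_pos rfl, orderSign_insert_self,
      orderSign_of_forall_lt h, Finset.erase_insert hk]
    simp
  by_cases h2 : m ∈ S
  · have hmk : m < k := h m h2
    rw [if_pos (Finset.mem_insert_of_mem h2), if_pos h2, if_neg h1, map_smul,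
      ← ket_insert_max (fun x hx => h x (Finset.mem_of_mem_erase hx)),
      orderSign_insert_of_lt hk hmk, Finset.erase_insert_of_ne hmk.ne']
    simp
  · rw [if_neg (by simp [h1, h2]), if_neg h2, if_neg h1]
    simp

/-- Induction over the basis vectors of the Fock space, by their parts. -/
theorem ket_induction {P : Finset ℕ → Multiset ℕ+ → Prop} (empty : P ∅ 0)
    (fermion : ∀ k S, (∀ x ∈ S, x < k) → P S 0 → P (insert k S) 0)
    (boson : ∀ k S μ, P S μ → P S (k ::ₘ μ)) (S : Finset ℕ) (μ : Multiset ℕ+) : P S μ := by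
  induction μ using Multiset.induction_on with
  | empty =>
    induction S using Finset.induction_on_max with
    | empty => exact empty
    | insert k S hS ih => exact fermion k S hS ih
  | cons k μ ih => exact boson k S μ ih

end fock

theorem isSymm_psumX_succ_smul_one (m : ℕ) : IsSymm (psumX K N (m + 1) • (1 : Superpoly K N)) :=
  isSymm_psumX_smul_one (Nat.succPNat m)

/-! ### Vector fields on superspace -/

/-- The vector field `∑_i x_iⁿ x_i ∂_{x_i}`. -/
def vectorField (K : Type) [Field K] (N n : ℕ) : Module.End K (Superpoly K N) :=
  ∑ i, (X i ^ n : MvPolynomial (Fin N) K) • superXDeriv K i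

/-- The odd vector field `∑_i θ_i x_iⁿ x_i ∂_{x_i}`. -/
def oddVectorField (K : Type) [Field K] (N n : ℕ) : Module.End K (Superpoly K N) :=
  ∑ i, (X i ^ n : MvPolynomial (Fin N) K) • LinearMap.mulLeft K (thetaVar K i) ∘ₗ superXDeriv K i

/-- The vector field `∑_i x_iⁿ θ_i ∂_{θ_i}`. -/
def thetaVectorField (K : Type) [Field K] (N n : ℕ) : Module.End K (Superpoly K N) :=
  ∑ i, (X i ^ n : MvPolynomial (Fin N) K) • superTransfer K i i

theorem vectorField_apply (n : ℕ) (F : Superpoly K N) : vectorField K N n F =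
    ∑ i, (X i ^ n : MvPolynomial (Fin N) K) • superXDeriv K i F := by
  simp [vectorField]

theorem oddVectorField_apply (n : ℕ) (F : Superpoly K N) : oddVectorField K N n F =
    ∑ i, (X i ^ n : MvPolynomial (Fin N) K) • (thetaVar K i * superXDeriv K i F) := by
  simp [oddVectorField]

theorem thetaVectorField_apply (n : ℕ) (F : Superpoly K N) : thetaVectorField K N n F =
    ∑ i, (X i ^ n : MvPolynomial (Fin N) K) • superTransfer K i i F := by
  simp [thetaVectorField]

theorem isLeibniz_vectorField (n : ℕ) : IsLeibniz (vectorField K N n) :=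
  IsLeibniz.sum fun i _ => (isLeibniz_superXDeriv (K := K) i).smul _

theorem isLeibniz_thetaVectorField (n : ℕ) : IsLeibniz (thetaVectorField K N n) :=
  IsLeibniz.sum fun i _ => (isLeibniz_superTransfer (K := K) i i).smul _

theorem vectorField_psumTheta (n k : ℕ) :
    vectorField K N n (psumTheta K N k) = (k : K) • psumTheta K N (n + k) := by
  rw [vectorField_apply, psumTheta.eq_1 K N (n + k), Finset.smul_sum]
  refine Finset.sum_congr rfl fun i _ => ?_
  rw [superXDeriv_psumTheta, smul_comm, smul_smul, ← pow_add]

theorem thetaVectorField_psumTheta (n k : ℕ) :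
    thetaVectorField K N n (psumTheta K N k) = psumTheta K N (n + k) := by
  rw [thetaVectorField_apply, psumTheta.eq_1 K N (n + k)]
  refine Finset.sum_congr rfl fun i _ => ?_
  rw [superTransfer_psumTheta, smul_smul, ← pow_add]

theorem vectorField_psumX_smul (n k : ℕ) (F : Superpoly K N) :
    vectorField K N n (psumX K N k • F) =
      (k : K) • psumX K N (n + k) • F + psumX K N k • vectorField K N n F := by
  simp only [vectorField_apply, superXDeriv_smul, smul_add, Finset.sum_add_distrib, xDeriv_psumX]
  congr 1
  · rw [psumX, Finset.sum_smul, Finset.smul_sum]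
    refine Finset.sum_congr rfl fun i _ => ?_
    rw [smul_assoc, smul_comm, smul_smul, ← pow_add]
  · rw [Finset.smul_sum]
    exact Finset.sum_congr rfl fun i _ => smul_comm _ _ _

theorem thetaVectorField_psumX_smul (n k : ℕ) (F : Superpoly K N) :
    thetaVectorField K N n (psumX K N k • F) = psumX K N k • thetaVectorField K N n F := by
  simp only [thetaVectorField_apply, superTransfer_smul, Finset.smul_sum]
  exact Finset.sum_congr rfl fun i _ => smul_comm _ _ _

theorem oddVectorField_psumX_smul (n k : ℕ) (F : Superpoly K N) :
    oddVectorField K N n (psumX K N k • F) =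
      (k : K) • (psumTheta K N (n + k) * F) + psumX K N k • oddVectorField K N n F := by
  simp only [oddVectorField_apply, superXDeriv_smul, mul_add, smul_add, Finset.sum_add_distrib,
    xDeriv_psumX]
  congr 1
  · rw [psumTheta, Finset.sum_mul, Finset.smul_sum]
    refine Finset.sum_congr rfl fun i _ => ?_
    rw [smul_assoc, mul_smul_comm, mul_smul_comm, smul_comm, smul_smul, ← pow_add, smul_mul_assoc]
  · rw [Finset.smul_sum]
    exact Finset.sum_congr rfl fun i _ => by rw [mul_smul_comm, smul_comm]

theorem thetaVar_mul_psumTheta (i : Fin N) (k : ℕ) :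
    thetaVar K i * psumTheta K N k = -(psumTheta K N k * thetaVar K i) := by
  simp only [psumTheta, Finset.mul_sum, Finset.sum_mul, ← Finset.sum_neg_distrib]
  refine Finset.sum_congr rfl fun j _ => ?_
  rw [mul_smul_comm, smul_mul_assoc, thetaVar_mul_thetaVar, smul_neg]

/-- The derivative of p̃_k along x_i is a multiple of θ_i, which the factor θ_i of the field
annihilates. Only the term differentiating F survives, with the sign of moving θ_i past p̃_k. -/
theorem oddVectorField_psumTheta_mul (n k : ℕ) (F : Superpoly K N) :
    oddVectorField K N n (psumTheta K N k * F) =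
      -(psumTheta K N k * oddVectorField K N n F) := by
  simp only [oddVectorField_apply, Finset.mul_sum, ← Finset.sum_neg_distrib]
  refine Finset.sum_congr rfl fun i _ => ?_
  rw [isLeibniz_superXDeriv i _ F, superXDeriv_psumTheta, mul_add, smul_mul_assoc, smul_mul_assoc,
    mul_smul_comm, mul_smul_comm, ← mul_assoc, thetaVar_mul_self, ← mul_assoc,
    thetaVar_mul_psumTheta]
  have : -(psumTheta K N k * thetaVar K i) * superXDeriv K i F =
      -(psumTheta K N k * (thetaVar K i * superXDeriv K i F)) := by
    rw [← mul_assoc]; exact neg_mul (psumTheta K N k * thetaVar K i) _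
  rw [this, mul_smul_comm, zero_mul, smul_zero, smul_zero, zero_add]
  exact smul_neg (X i ^ n : MvPolynomial (Fin N) K)
    (psumTheta K N k * (thetaVar K i * superXDeriv K i F))

theorem thetaVar_mul_superTransfer_self (i : Fin N) (F : Superpoly K N) :
    thetaVar K i * superTransfer K i i F = 0 := by
  induction F using TensorProduct.induction_on with
  | zero => simp
  | add x y hx hy => rw [map_add, mul_add, hx, hy, add_zero]
  | tmul f w =>
    rw [superTransfer, LinearMap.lTensor_tmul, thetaTransfer_apply, thetaVar,
      Algebra.TensorProduct.tmul_mul_tmul, ← mul_assoc]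
    change _ ⊗ₜ[K] (theta K i * theta K i * _) = 0
    rw [theta_mul_self, zero_mul, TensorProduct.tmul_zero]

theorem vectorField_psumTheta_mul (n k : ℕ) (F : Superpoly K N) :
    vectorField K N n (psumTheta K N k * F) =
      (k : K) • (psumTheta K N (n + k) * F) + psumTheta K N k * vectorField K N n F := by
  rw [isLeibniz_vectorField n _ F, vectorField_psumTheta, smul_mul_assoc]

theorem thetaVectorField_psumTheta_mul (n k : ℕ) (F : Superpoly K N) :
    thetaVectorField K N n (psumTheta K N k * F) =
      psumTheta K N (n + k) * F + psumTheta K N k * thetaVectorField K N n F := by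
  rw [isLeibniz_thetaVectorField n _ F, thetaVectorField_psumTheta]

/-- This rule and the next three are the recursions that determine ℋ and ℐ on products of power
sums. The cross terms of the product rules appear as vector fields, whose action on such products is
known from the chain rule. -/
theorem hamiltonian_psumX_smul [CharZero K] (β : K) (m : ℕ) {F : Superpoly K N} (hF : IsSymm F) :
    hamiltonian β N (psumX K N (m + 1) • F) =
      (((m : K) + 1) ^ 2 + β * ((m : K) + 1) * ((N : K) - ((m : K) + 1))) • psumX K N (m + 1) • F
      + (β * ((m : K) + 1)) • ∑ a ∈ Finset.range m, psumX K N (a + 1) • psumX K N (m - a) • F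
      + psumX K N (m + 1) • hamiltonian β N F
      + (2 * ((m : K) + 1)) • vectorField K N (m + 1) F := by
  have h1 : ∀ (f : MvPolynomial (Fin N) K) (G : Superpoly K N), f • G = (f • 1) * G :=
    fun f G => by rw [smul_mul_assoc, one_mul]
  have h2 : ∑ i, superXDeriv K i (psumX K N (m + 1) • 1) * superXDeriv K i F =
      ((m : K) + 1) • vectorField K N (m + 1) F := by
    rw [vectorField_apply, Finset.smul_sum]
    refine Finset.sum_congr rfl fun i _ => ?_
    rw [superXDeriv_smul, (isLeibniz_superXDeriv (K := K) i).map_one, smul_zero, add_zero,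
      smul_mul_assoc, one_mul, xDeriv_psumX, smul_assoc, Nat.cast_succ]
  rw [h1 (psumX K N (m + 1)) F, hamiltonian_mul β (isSymm_psumX_succ_smul_one m) hF,
    hamiltonian_psumX, h2]
  simp only [add_mul, smul_mul_assoc, one_mul, Finset.sum_mul]
  module

theorem hamiltonian_psumTheta_mul [CharZero K] (β : K) (k : ℕ) {F : Superpoly K N}
    (hF : IsSymm F) :
    hamiltonian β N (psumTheta K N k * F) =
      ((k : K) ^ 2 + β * (k : K) * ((N : K) - (k : K))) • (psumTheta K N k * F)
      + (2 * β) • ∑ a ∈ Finset.range k, ((k - (a + 1) : ℕ) : K) •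
          psumX K N (a + 1) • (psumTheta K N (k - (a + 1)) * F)
      + psumTheta K N k * hamiltonian β N F
      + (2 * (k : K)) • oddVectorField K N k F := by
  have h2 : ∑ i, superXDeriv K i (psumTheta K N k) * superXDeriv K i F =
      (k : K) • oddVectorField K N k F := by
    rw [oddVectorField_apply, Finset.smul_sum]
    refine Finset.sum_congr rfl fun i _ => ?_
    rw [superXDeriv_psumTheta, smul_mul_assoc, smul_mul_assoc]
  rw [hamiltonian_mul β (isSymm_psumTheta k) hF, hamiltonian_psumTheta β k (isSymm_psumTheta k), h2]
  simp only [add_mul, smul_mul_assoc, Finset.sum_mul]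
  module

theorem chargeI_psumX_smul [CharZero K] (β : K) (m : ℕ) {F : Superpoly K N} (hF : IsSymm F) :
    chargeI β N 1 (psumX K N (m + 1) • F) = psumX K N (m + 1) • chargeI β N 1 F
      + ((m : K) + 1) • thetaVectorField K N (m + 1) F := by
  have h1 : ∀ (f : MvPolynomial (Fin N) K) (G : Superpoly K N), f • G = (f • 1) * G :=
    fun f G => by rw [smul_mul_assoc, one_mul]
  have hs := isSymm_psumX_succ_smul_one (K := K) (N := N) m
  have h2 : ∑ i, (superTransfer K i i (psumX K N (m + 1) • 1) * superXDeriv K i F +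
      superXDeriv K i (psumX K N (m + 1) • 1) * superTransfer K i i F) =
      ((m : K) + 1) • thetaVectorField K N (m + 1) F := by
    rw [thetaVectorField_apply, Finset.smul_sum]
    refine Finset.sum_congr rfl fun i _ => ?_
    rw [superTransfer_smul_one, superXDeriv_smul, (isLeibniz_superXDeriv (K := K) i).map_one,
      smul_zero, add_zero, smul_mul_assoc, one_mul, xDeriv_psumX, smul_assoc, Nat.cast_succ,
      zero_mul, zero_add]
  have h3 : fermionNumber K N (psumX K N (m + 1) • 1) = 0 := by
    simp only [fermionNumber, LinearMap.sum_apply, superTransfer_smul_one, Finset.sum_const_zero]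
  rw [h1 (psumX K N (m + 1)) F, chargeI_mul β hs hF, h2, h3]
  rw [chargeI_smul_one β _ hs, zero_mul, zero_mul, smul_zero, zero_add, sub_zero, smul_mul_assoc, one_mul]

theorem chargeI_psumTheta_mul [CharZero K] (β : K) (k : ℕ) {F : Superpoly K N} (hF : IsSymm F) :
    chargeI β N 1 (psumTheta K N k * F) = ((k : K) * (1 - β)) • (psumTheta K N k * F)
      + β • ∑ a ∈ Finset.range k, psumX K N (a + 1) • (psumTheta K N (k - (a + 1)) * F)
      + psumTheta K N k * chargeI β N 1 F + oddVectorField K N k F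
      - β • (psumTheta K N k * fermionNumber K N F) := by
  have h2 : ∑ i, (superTransfer K i i (psumTheta K N k) * superXDeriv K i F +
      superXDeriv K i (psumTheta K N k) * superTransfer K i i F) = oddVectorField K N k F := by
    rw [oddVectorField_apply]
    refine Finset.sum_congr rfl fun i _ => ?_
    rw [superTransfer_psumTheta, superXDeriv_psumTheta, smul_mul_assoc, smul_mul_assoc,
      smul_mul_assoc, thetaVar_mul_superTransfer_self, smul_zero, smul_zero, add_zero]
  have h3 : fermionNumber K N (psumTheta K N k) = psumTheta K N k := by
    have := thetaVectorField_psumTheta (K := K) (N := N) 0 k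
    simpa [thetaVectorField_apply, fermionNumber] using this
  rw [chargeI_mul β (isSymm_psumTheta k) hF, h2, h3, chargeI_psumTheta β k (isSymm_psumTheta k)]
  simp only [add_mul, smul_mul_assoc, Finset.sum_mul]

/-! ### The operators on the Fock space -/

theorem sum_sum_ite_add_eq {A : Type*} [AddCommMonoid A] (f : ℕ → ℕ → A) {k d e : ℕ}
    (hd : k ≤ d) (he : k ≤ e) :
    ∑ a ∈ Finset.range d, ∑ b ∈ Finset.range e, (if a + 1 + b = k then f a b else 0) =
      ∑ a ∈ Finset.range k, f a (k - (a + 1)) := by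
  rw [← Finset.sum_subset (Finset.range_subset_range.2 hd)]
  · refine Finset.sum_congr rfl fun a ha => ?_
    have ha := Finset.mem_range.1 ha
    rw [Finset.sum_eq_single (k - (a + 1)), if_pos (by omega)]
    · intro b _ hb
      rw [if_neg (by omega)]
    · intro h
      exact absurd (Finset.mem_range.2 (by omega)) h
  · intro a _ ha
    have ha : k ≤ a := by simpa using ha
    exact Finset.sum_eq_zero fun b _ => if_neg (by omega)

/-- The parts of a superpartition are at most `d`. -/
def PartsLE (d : ℕ) (S : Finset ℕ) (μ : Multiset ℕ+) : Prop :=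
  (∀ n ∈ S, n ≤ d) ∧ ∀ n ∈ μ, (n : ℕ) ≤ d

theorem PartsLE.of_insert {d k : ℕ} {S : Finset ℕ} {μ : Multiset ℕ+}
    (h : PartsLE d (insert k S) μ) : k ≤ d ∧ PartsLE d S μ :=
  ⟨h.1 k (Finset.mem_insert_self _ _), fun n hn => h.1 n (Finset.mem_insert_of_mem hn), h.2⟩

theorem PartsLE.of_cons {d : ℕ} {k : ℕ+} {S : Finset ℕ} {μ : Multiset ℕ+}
    (h : PartsLE d S (k ::ₘ μ)) : (k : ℕ) ≤ d ∧ PartsLE d S μ :=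
  ⟨h.2 k (Multiset.mem_cons_self _ _), h.1, fun n hn => h.2 n (Multiset.mem_cons_of_mem hn)⟩

theorem ket_cons (k : ℕ+) (S : Finset ℕ) (μ : Multiset ℕ+) :
    ket K S (k ::ₘ μ) = mulBoson K k (ket K S μ) := (mulBoson_ket S μ k).symm

theorem realize_derivBoson_mulBoson (m n : ℕ+) (v : Fock K) :
    realize K N (derivBoson K m (mulBoson K n v)) =
      psumX K N n • realize K N (derivBoson K m v) + if m = n then realize K N v else 0 := by
  rw [derivBoson_mulBoson, map_add, realize_mulBoson]
  split_ifs <;> simp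

theorem realize_derivFermion_mulBoson (m : ℕ) (n : ℕ+) (v : Fock K) :
    realize K N (derivFermion K m (mulBoson K n v)) =
      psumX K N n • realize K N (derivFermion K m v) := by
  rw [derivFermion_mulBoson, realize_mulBoson]

theorem realize_derivBoson_mulFermion [CharZero K] (m : ℕ+) (n : ℕ) (v : Fock K) :
    realize K N (derivBoson K m (mulFermion K n v)) =
      psumTheta K N n * realize K N (derivBoson K m v) := by
  rw [derivBoson_mulFermion, realize_mulFermion]

theorem psumTheta_mul_realize_derivFermion [CharZero K] {k : ℕ} {S : Finset ℕ}
    {μ : Multiset ℕ+} (h : ∀ x ∈ S, x < k) (a b : ℕ) :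
    psumTheta K N a * realize K N (derivFermion K b (mulFermion K k (ket K S μ))) =
      psumTheta K N k * (psumTheta K N a * realize K N (derivFermion K b (ket K S μ)))
      + if b = k then psumTheta K N a * realize K N (ket K S μ) else 0 := by
  rw [derivFermion_mulFermion_of_max h, map_add, map_neg, realize_mulFermion, mul_add,
    psumTheta_mul_psumTheta_mul k a]
  congr 1
  · exact mul_neg (psumTheta K N a) _
  · split_ifs <;> simp

theorem psumTheta_mul_realize_derivFermion_derivBoson [CharZero K] {k : ℕ} {S : Finset ℕ}
    {μ : Multiset ℕ+} (h : ∀ x ∈ S, x < k) (a b : ℕ) (c : ℕ+) :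
    psumTheta K N a * realize K N (derivFermion K b (derivBoson K c (mulFermion K k (ket K S μ)))) =
      psumTheta K N k *
        (psumTheta K N a * realize K N (derivFermion K b (derivBoson K c (ket K S μ))))
      + if b = k then psumTheta K N a * realize K N (derivBoson K c (ket K S μ)) else 0 := by
  rw [derivBoson_mulFermion, derivBoson_ket]
  simp only [map_smul, mul_smul_comm, psumTheta_mul_realize_derivFermion h, smul_add, smul_ite,
    smul_zero]

/-- The chain rule in the variables p_a, p̃_b: the field maps p_a to a p_{n+a} and p̃_b to b
p̃_{n+b}. Truncation at d loses nothing, because derivatives with respect to larger generators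
vanish. -/
theorem realize_vectorField [CharZero K] (n d : ℕ) (S : Finset ℕ) (μ : Multiset ℕ+)
    (h : PartsLE d S μ) :
    vectorField K N n (realize K N (ket K S μ)) =
      ∑ a ∈ Finset.range d, ((a : K) + 1) • psumX K N (n + (a + 1)) •
        realize K N (derivBoson K (Nat.succPNat a) (ket K S μ))
      + ∑ b ∈ Finset.range (d + 1), (b : K) •
        (psumTheta K N (n + b) * realize K N (derivFermion K b (ket K S μ))) := by
  induction S, μ using ket_induction with
  | empty =>
    have h1 : vectorField K N n 1 = 0 := (isLeibniz_vectorField n).map_one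
    simp [derivBoson_ket, derivFermion_ket, realize_ket, psumThetaProd_empty, h1]
  | fermion k S hS ih =>
    obtain ⟨hk, h'⟩ := h.of_insert
    rw [ket_insert_max hS, realize_mulFermion, vectorField_psumTheta_mul, ih h']
    simp only [realize_derivBoson_mulFermion, psumTheta_mul_realize_derivFermion hS, smul_add,
      smul_ite, smul_zero, Finset.sum_add_distrib, Finset.sum_ite_eq', Finset.mem_range,
      Nat.lt_succ_iff, if_pos hk, mul_add, Finset.mul_sum, mul_smul_comm]
    abel
  | boson k S μ ih =>
    obtain ⟨hk, h'⟩ := h.of_cons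
    obtain ⟨m, rfl⟩ : ∃ m, k = Nat.succPNat m := ⟨k.natPred, by simp⟩
    -- Bosonic indices are shifted: a ranges over a < d and stands for the part a + 1 ≤ d.
    have hk : m < d := hk
    have e1 : ∀ a : ℕ, ((a : K) + 1) • psumX K N (n + (a + 1)) •
        realize K N (derivBoson K (Nat.succPNat a) (ket K S (Nat.succPNat m ::ₘ μ))) =
        psumX K N (m + 1) • ((a : K) + 1) • psumX K N (n + (a + 1)) •
          realize K N (derivBoson K (Nat.succPNat a) (ket K S μ))
        + if a = m then ((m : K) + 1) • psumX K N (n + (m + 1)) • realize K N (ket K S μ)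
          else 0 := by
      intro a
      rw [ket_cons, realize_derivBoson_mulBoson]
      by_cases ha : a = m
      · subst ha; simp only [if_true, Nat.succPNat_coe, Nat.succ_eq_add_one]; module
      · simp only [Nat.succPNat_inj, if_neg ha, Nat.succPNat_coe, Nat.succ_eq_add_one]; module
    have e2 : ∀ b : ℕ, (b : K) • (psumTheta K N (n + b) *
        realize K N (derivFermion K b (ket K S (Nat.succPNat m ::ₘ μ)))) =
        psumX K N (m + 1) • (b : K) • (psumTheta K N (n + b) *
          realize K N (derivFermion K b (ket K S μ))) := by
      intro b
      rw [ket_cons, realize_derivFermion_mulBoson, mul_smul_comm, smul_comm]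
      rfl
    simp only [e1, e2, Finset.sum_add_distrib, Finset.sum_ite_eq', Finset.mem_range, if_pos hk,
      ← Finset.smul_sum]
    rw [ket_cons, realize_mulBoson]
    simp only [Nat.succPNat_coe, Nat.succ_eq_add_one]
    rw [vectorField_psumX_smul, ih h', Nat.cast_succ]
    module

theorem realize_oddVectorField [CharZero K] (n d : ℕ) (S : Finset ℕ) (μ : Multiset ℕ+)
    (h : PartsLE d S μ) :
    oddVectorField K N n (realize K N (ket K S μ)) =
      ∑ a ∈ Finset.range d, ((a : K) + 1) • (psumTheta K N (n + (a + 1)) *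
        realize K N (derivBoson K (Nat.succPNat a) (ket K S μ))) := by
  induction S, μ using ket_induction with
  | empty =>
    have h1 : oddVectorField K N n 1 = 0 := by
      simp [oddVectorField_apply, fun i : Fin N => (isLeibniz_superXDeriv (K := K) i).map_one]
    simp [derivBoson_ket, realize_ket, psumThetaProd_empty, h1]
  | fermion k S hS ih =>
    obtain ⟨hk, h'⟩ := h.of_insert
    rw [ket_insert_max hS, realize_mulFermion, oddVectorField_psumTheta_mul, ih h', Finset.mul_sum,
      ← Finset.sum_neg_distrib]
    refine Finset.sum_congr rfl fun a _ => ?_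
    rw [realize_derivBoson_mulFermion, mul_smul_comm, psumTheta_mul_psumTheta_mul (n + (a + 1)) k]
    module
  | boson k S μ ih =>
    obtain ⟨hk, h'⟩ := h.of_cons
    obtain ⟨m, rfl⟩ : ∃ m, k = Nat.succPNat m := ⟨k.natPred, by simp⟩
    have hk : m < d := hk
    have e1 : ∀ a : ℕ, ((a : K) + 1) • (psumTheta K N (n + (a + 1)) *
        realize K N (derivBoson K (Nat.succPNat a) (ket K S (Nat.succPNat m ::ₘ μ)))) =
        psumX K N (m + 1) • ((a : K) + 1) • (psumTheta K N (n + (a + 1)) *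
          realize K N (derivBoson K (Nat.succPNat a) (ket K S μ)))
        + if a = m then ((m : K) + 1) • (psumTheta K N (n + (m + 1)) * realize K N (ket K S μ))
          else 0 := by
      intro a
      rw [ket_cons, realize_derivBoson_mulBoson, mul_add, mul_smul_comm]
      by_cases ha : a = m
      · subst ha; simp only [if_true, Nat.succPNat_coe, Nat.succ_eq_add_one]; module
      · simp only [Nat.succPNat_inj, if_neg ha, Nat.succPNat_coe, Nat.succ_eq_add_one, mul_zero]
        module
    simp only [e1, Finset.sum_add_distrib, Finset.sum_ite_eq', Finset.mem_range, if_pos hk,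
      ← Finset.smul_sum]
    rw [ket_cons, realize_mulBoson]
    simp only [Nat.succPNat_coe, Nat.succ_eq_add_one]
    rw [oddVectorField_psumX_smul, ih h', Nat.cast_succ]
    module

theorem realize_thetaVectorField [CharZero K] (n d : ℕ) (S : Finset ℕ) (μ : Multiset ℕ+)
    (h : PartsLE d S μ) :
    thetaVectorField K N n (realize K N (ket K S μ)) =
      ∑ b ∈ Finset.range (d + 1),
        psumTheta K N (n + b) * realize K N (derivFermion K b (ket K S μ)) := by
  induction S, μ using ket_induction with
  | empty =>
    have h1 : thetaVectorField K N n 1 = 0 := (isLeibniz_thetaVectorField n).map_one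
    simp [derivFermion_ket, realize_ket, psumThetaProd_empty, h1]
  | fermion k S hS ih =>
    obtain ⟨hk, h'⟩ := h.of_insert
    rw [ket_insert_max hS, realize_mulFermion, thetaVectorField_psumTheta_mul, ih h']
    simp only [psumTheta_mul_realize_derivFermion hS, Finset.sum_add_distrib, Finset.sum_ite_eq',
      Finset.mem_range, Nat.lt_succ_iff, if_pos hk, ← Finset.mul_sum]
    abel
  | boson k S μ ih =>
    obtain ⟨hk, h'⟩ := h.of_cons
    obtain ⟨m, rfl⟩ : ∃ m, k = Nat.succPNat m := ⟨k.natPred, by simp⟩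
    rw [ket_cons, realize_mulBoson]
    simp only [Nat.succPNat_coe, Nat.succ_eq_add_one]
    rw [thetaVectorField_psumX_smul, ih h', Finset.smul_sum]
    refine Finset.sum_congr rfl fun b _ => ?_
    rw [realize_derivFermion_mulBoson, mul_smul_comm]
    rfl

theorem fermionNumber_realize (S : Finset ℕ) (μ : Multiset ℕ+) :
    fermionNumber K N (realize K N (ket K S μ)) = (S.card : K) • realize K N (ket K S μ) := by
  have h : fermionNumber K N = thetaVectorField K N 0 := by simp [fermionNumber, thetaVectorField]
  rw [h, realize_ket]
  have hp : thetaVectorField K N 0 (psumThetaProd K N S) = (S.card : K) • psumThetaProd K N S := by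
    induction S using Finset.induction_on_max with
    | empty =>
      have h1 : thetaVectorField K N 0 1 = 0 := (isLeibniz_thetaVectorField 0).map_one
      simp [psumThetaProd_empty, h1]
    | insert k S hS ih =>
      rw [psumThetaProd_insert_max hS, thetaVectorField_psumTheta_mul, ih,
        Finset.card_insert_of_notMem fun hk => lt_irrefl k (hS k hk), zero_add, mul_smul_comm,
        Nat.cast_succ]
      module
  have hs : ∀ (f : MvPolynomial (Fin N) K) (F : Superpoly K N),
      thetaVectorField K N 0 (f • F) = f • thetaVectorField K N 0 F := by
    intro f F
    simp only [thetaVectorField_apply, superTransfer_smul, Finset.smul_sum]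
    exact Finset.sum_congr rfl fun i _ => smul_comm _ _ _
  rw [hs, hp, smul_comm]

/-- The eigenvalue `n² + β n (c - n)` of the diagonal part of the Hamiltonian on a part `n`. -/
def partEnergy (β c : K) (n : ℕ) : K := (n : K) ^ 2 + β * (n : K) * (c - (n : K))

/-- The eigenvalue of the diagonal part of the Hamiltonian. -/
def energy (β c : K) (L : Superpartition) : K :=
  ∑ n ∈ L.1, partEnergy β c n + (L.2.map fun n : ℕ+ => partEnergy β c n).sum

/-- The terms `p_a p_b ∂_{p_{a+b}}`. -/
def splitBoson (K : Type) [Field K] (d : ℕ) : Module.End K (Fock K) :=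
  ∑ a ∈ Finset.range d, ∑ b ∈ Finset.range d, ((a : K) + 1 + (b + 1)) •
    (mulBoson K (Nat.succPNat a) ∘ₗ mulBoson K (Nat.succPNat b) ∘ₗ
      derivBoson K (Nat.succPNat (a + 1 + b)))

/-- The terms `b p_a p̃_b ∂_{p̃_{a+b}}`. -/
def splitFermion (c : ℕ → K) (d : ℕ) : Module.End K (Fock K) :=
  ∑ a ∈ Finset.range d, ∑ b ∈ Finset.range (d + 1), c b •
    (mulBoson K (Nat.succPNat a) ∘ₗ mulFermion K b ∘ₗ derivFermion K (a + 1 + b))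

/-- The terms `a b p_{a+b} ∂_{p_a} ∂_{p_b}`. -/
def joinBoson (K : Type) [Field K] (d : ℕ) : Module.End K (Fock K) :=
  ∑ a ∈ Finset.range d, ∑ b ∈ Finset.range d, (((a : K) + 1) * ((b : K) + 1)) •
    (mulBoson K (Nat.succPNat (a + 1 + b)) ∘ₗ derivBoson K (Nat.succPNat a) ∘ₗ
      derivBoson K (Nat.succPNat b))

/-- The terms `a b p̃_{a+b} ∂_{p̃_b} ∂_{p_a}`, with `b` replaced by a general function of `b`. -/
def joinFermion (c : ℕ → K) (d : ℕ) : Module.End K (Fock K) :=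
  ∑ a ∈ Finset.range d, ∑ b ∈ Finset.range (d + 1), (((a : K) + 1) * c b) •
    (mulFermion K (a + 1 + b) ∘ₗ derivFermion K b ∘ₗ derivBoson K (Nat.succPNat a))

/-- The Hamiltonian on the Fock space, truncated to parts at most `d`. -/
def fockHamiltonian (β c : K) (d : ℕ) : Module.End K (Fock K) :=
  diagonal (energy β c) + β • splitBoson K d + (2 * β) • splitFermion (fun b => (b : K)) d
    + joinBoson K d + (2 : K) • joinFermion (fun b => (b : K)) d

/-- The eigenvalue of the diagonal part of `ℐ`. -/
def chargeEigenvalue (β : K) (L : Superpartition) : K :=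
  ∑ n ∈ L.1, (n : K) * (1 - β) - β / 2 * ((L.1.card : K) * ((L.1.card : K) - 1))

/-- The charge `ℐ` on the Fock space, truncated to parts at most `d`. -/
def fockCharge (β : K) (d : ℕ) : Module.End K (Fock K) :=
  diagonal (chargeEigenvalue β) + β • splitFermion (fun _ => 1) d + joinFermion (fun _ => 1) d

/-! ### Recursions for the splitting and joining terms -/

section realize

variable (c : ℕ → K) (d : ℕ)

theorem realize_splitBoson (v : Fock K) : realize K N (splitBoson K d v) =
    ∑ a ∈ Finset.range d, ∑ b ∈ Finset.range d, ((a : K) + 1 + (b + 1)) • psumX K N (a + 1) •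
      psumX K N (b + 1) • realize K N (derivBoson K (Nat.succPNat (a + 1 + b)) v) := by
  simp only [splitBoson, LinearMap.sum_apply, LinearMap.smul_apply, LinearMap.comp_apply, map_sum,
    map_smul, realize_mulBoson, Nat.succPNat_coe, Nat.succ_eq_add_one]

theorem realize_splitFermion [CharZero K] (v : Fock K) : realize K N (splitFermion c d v) =
    ∑ a ∈ Finset.range d, ∑ b ∈ Finset.range (d + 1), c b • psumX K N (a + 1) •
      (psumTheta K N b * realize K N (derivFermion K (a + 1 + b) v)) := by
  simp only [splitFermion, LinearMap.sum_apply, LinearMap.smul_apply, LinearMap.comp_apply, map_sum,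
    map_smul, realize_mulBoson, realize_mulFermion, Nat.succPNat_coe, Nat.succ_eq_add_one]

theorem realize_joinBoson (v : Fock K) : realize K N (joinBoson K d v) =
    ∑ a ∈ Finset.range d, ∑ b ∈ Finset.range d, (((a : K) + 1) * ((b : K) + 1)) •
      psumX K N (a + 1 + b + 1) •
        realize K N (derivBoson K (Nat.succPNat a) (derivBoson K (Nat.succPNat b) v)) := by
  simp only [joinBoson, LinearMap.sum_apply, LinearMap.smul_apply, LinearMap.comp_apply, map_sum,
    map_smul, realize_mulBoson, Nat.succPNat_coe, Nat.succ_eq_add_one]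

theorem realize_joinFermion [CharZero K] (v : Fock K) : realize K N (joinFermion c d v) =
    ∑ a ∈ Finset.range d, ∑ b ∈ Finset.range (d + 1), (((a : K) + 1) * c b) •
      (psumTheta K N (a + 1 + b) *
        realize K N (derivFermion K b (derivBoson K (Nat.succPNat a) v))) := by
  simp only [joinFermion, LinearMap.sum_apply, LinearMap.smul_apply, LinearMap.comp_apply, map_sum,
    map_smul, realize_mulFermion]

variable {d}

/-- Commuting ∂_{p_{a+b}} past the new factor leaves the splittings of that factor alone: the
quadratic terms in the value of ℋ on p_{m+1}. -/
theorem realize_splitBoson_mulBoson {m : ℕ} (hm : m < d) (v : Fock K) :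
    realize K N (splitBoson K d (mulBoson K (Nat.succPNat m) v)) =
      psumX K N (m + 1) • realize K N (splitBoson K d v) + ((m : K) + 1) •
        ∑ a ∈ Finset.range m, psumX K N (a + 1) • psumX K N (m - a) • realize K N v := by
  have e : ∀ a b : ℕ, ((a : K) + 1 + (b + 1)) • psumX K N (a + 1) • psumX K N (b + 1) •
      realize K N (derivBoson K (Nat.succPNat (a + 1 + b)) (mulBoson K (Nat.succPNat m) v)) =
      psumX K N (m + 1) • ((a : K) + 1 + (b + 1)) • psumX K N (a + 1) • psumX K N (b + 1) •
        realize K N (derivBoson K (Nat.succPNat (a + 1 + b)) v)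
      + if a + 1 + b = m then ((m : K) + 1) • psumX K N (a + 1) • psumX K N (b + 1) •
        realize K N v else 0 := by
    intro a b
    rw [realize_derivBoson_mulBoson]
    by_cases h : a + 1 + b = m
    · subst h
      simp only [if_true, Nat.succPNat_coe, Nat.succ_eq_add_one]
      push_cast
      module
    · simp only [Nat.succPNat_inj, if_neg h, Nat.succPNat_coe, Nat.succ_eq_add_one]; module
  simp only [realize_splitBoson, e, Finset.sum_add_distrib, ← Finset.smul_sum]
  rw [sum_sum_ite_add_eq _ hm.le hm.le, Finset.smul_sum (s := Finset.range m)]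
  congr 1
  refine Finset.sum_congr rfl fun a ha => ?_
  have ha := Finset.mem_range.1 ha
  rw [show m - (a + 1) + 1 = m - a by omega]

theorem realize_splitBoson_mulFermion [CharZero K] (k : ℕ) (v : Fock K) :
    realize K N (splitBoson K d (mulFermion K k v)) =
      psumTheta K N k * realize K N (splitBoson K d v) := by
  simp only [realize_splitBoson, realize_derivBoson_mulFermion, Finset.mul_sum, mul_smul_comm]

theorem realize_splitFermion_mulBoson [CharZero K] (m : ℕ) (v : Fock K) :
    realize K N (splitFermion c d (mulBoson K (Nat.succPNat m) v)) =
      psumX K N (m + 1) • realize K N (splitFermion c d v) := by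
  simp only [realize_splitFermion, realize_derivFermion_mulBoson, Finset.smul_sum]
  refine Finset.sum_congr rfl fun a _ => Finset.sum_congr rfl fun b _ => ?_
  rw [mul_smul_comm, Nat.succPNat_coe]
  module

theorem realize_splitFermion_mulFermion [CharZero K] {k : ℕ} (hk : k ≤ d) {S : Finset ℕ} {μ : Multiset ℕ+}
    (hS : ∀ x ∈ S, x < k) :
    realize K N (splitFermion c d (mulFermion K k (ket K S μ))) =
      psumTheta K N k * realize K N (splitFermion c d (ket K S μ))
      + ∑ a ∈ Finset.range k, c (k - (a + 1)) • psumX K N (a + 1) •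
        (psumTheta K N (k - (a + 1)) * realize K N (ket K S μ)) := by
  simp only [realize_splitFermion, psumTheta_mul_realize_derivFermion hS, smul_add, smul_ite,
    smul_zero, Finset.sum_add_distrib, Finset.mul_sum, mul_smul_comm]
  rw [sum_sum_ite_add_eq _ hk (hk.trans (Nat.le_succ d))]

/-- Either of the two derivatives may hit the new factor, whence the 2. The commutator is 2(m+1)
times the bosonic part of the vector field in `realize_vectorField`; the fermionic part comes from
`joinFermion`. -/
theorem realize_joinBoson_mulBoson {m : ℕ} (hm : m < d) (v : Fock K) :
    realize K N (joinBoson K d (mulBoson K (Nat.succPNat m) v)) =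
      psumX K N (m + 1) • realize K N (joinBoson K d v) + (2 * ((m : K) + 1)) •
        ∑ a ∈ Finset.range d, ((a : K) + 1) • psumX K N (m + 1 + (a + 1)) •
          realize K N (derivBoson K (Nat.succPNat a) v) := by
  have e : ∀ a b : ℕ, (((a : K) + 1) * ((b : K) + 1)) • psumX K N (a + 1 + b + 1) •
        realize K N (derivBoson K (Nat.succPNat a) (derivBoson K (Nat.succPNat b)
          (mulBoson K (Nat.succPNat m) v))) =
      psumX K N (m + 1) • (((a : K) + 1) * ((b : K) + 1)) • psumX K N (a + 1 + b + 1) •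
        realize K N (derivBoson K (Nat.succPNat a) (derivBoson K (Nat.succPNat b) v))
      + (if a = m then ((m : K) + 1) • ((b : K) + 1) • psumX K N (m + 1 + (b + 1)) •
          realize K N (derivBoson K (Nat.succPNat b) v) else 0)
      + if b = m then ((m : K) + 1) • ((a : K) + 1) • psumX K N (m + 1 + (a + 1)) •
          realize K N (derivBoson K (Nat.succPNat a) v) else 0 := by
    intro a b
    have h1 : ∀ w : Fock K, realize K N (derivBoson K (Nat.succPNat a)
        (if Nat.succPNat b = Nat.succPNat m then w else 0)) =
        if b = m then realize K N (derivBoson K (Nat.succPNat a) w) else 0 := by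
      intro w
      simp only [Nat.succPNat_inj]
      split_ifs <;> simp
    rw [derivBoson_mulBoson, map_add, map_add, h1, realize_derivBoson_mulBoson, smul_add, smul_add,
      smul_add, smul_add]
    simp only [Nat.succPNat_inj, smul_ite, smul_zero]
    congr 1
    · congr 1
      · simp only [Nat.succPNat_coe, Nat.succ_eq_add_one]; module
      · split_ifs with h
        · subst h; rw [add_assoc (a + 1) b 1]; module
        · rfl
    · split_ifs with h
      · subst h; rw [show a + 1 + b + 1 = b + 1 + (a + 1) by ring]; module
      · rfl
  simp only [realize_joinBoson, e, Finset.sum_add_distrib, ← Finset.smul_sum, Finset.sum_ite_eq',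
    Finset.mem_range, if_pos hm]
  rw [Finset.sum_comm (f := fun a b : ℕ => if a = m then ((m : K) + 1) • ((b : K) + 1) •
    psumX K N (m + 1 + (b + 1)) • realize K N (derivBoson K (Nat.succPNat b) v) else 0)]
  simp only [Finset.sum_ite_eq', Finset.mem_range, if_pos hm, ← Finset.smul_sum]
  rw [add_assoc, ← add_smul, ← two_mul]

theorem realize_joinBoson_mulFermion [CharZero K] (k : ℕ) (v : Fock K) :
    realize K N (joinBoson K d (mulFermion K k v)) =
      psumTheta K N k * realize K N (joinBoson K d v) := by
  simp only [realize_joinBoson, derivBoson_mulFermion, realize_mulFermion, Finset.mul_sum,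
    mul_smul_comm]

theorem realize_joinFermion_mulBoson [CharZero K] {m : ℕ} (hm : m < d) (v : Fock K) :
    realize K N (joinFermion c d (mulBoson K (Nat.succPNat m) v)) =
      psumX K N (m + 1) • realize K N (joinFermion c d v) + ((m : K) + 1) •
        ∑ b ∈ Finset.range (d + 1), c b •
          (psumTheta K N (m + 1 + b) * realize K N (derivFermion K b v)) := by
  have e : ∀ a b : ℕ, (((a : K) + 1) * c b) • (psumTheta K N (a + 1 + b) *
        realize K N (derivFermion K b (derivBoson K (Nat.succPNat a)
          (mulBoson K (Nat.succPNat m) v)))) =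
      psumX K N (m + 1) • (((a : K) + 1) * c b) • (psumTheta K N (a + 1 + b) *
        realize K N (derivFermion K b (derivBoson K (Nat.succPNat a) v)))
      + if a = m then ((m : K) + 1) • c b • (psumTheta K N (m + 1 + b) *
          realize K N (derivFermion K b v)) else 0 := by
    intro a b
    have h1 : realize K N (derivFermion K b
        (if Nat.succPNat a = Nat.succPNat m then v else 0)) =
        if a = m then realize K N (derivFermion K b v) else 0 := by
      simp only [Nat.succPNat_inj]
      split_ifs <;> simp
    rw [derivBoson_mulBoson, map_add, map_add, h1, realize_derivFermion_mulBoson, mul_add,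
      smul_add, mul_smul_comm]
    congr 1
    · simp only [Nat.succPNat_coe, Nat.succ_eq_add_one]; module
    · split_ifs with h
      · subst h; module
      · simp
  simp only [realize_joinFermion, e, Finset.sum_add_distrib, ← Finset.smul_sum]
  rw [Finset.sum_comm (f := fun a b : ℕ => if a = m then ((m : K) + 1) • c b •
    (psumTheta K N (m + 1 + b) * realize K N (derivFermion K b v)) else 0)]
  simp only [Finset.sum_ite_eq', Finset.mem_range, if_pos hm, ← Finset.smul_sum]

/-- The commutator is c k times the odd vector field of `realize_oddVectorField`: c k = k together
with the prefactor 2 serves ℋ, and c k = 1 serves ℐ. -/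
theorem realize_joinFermion_mulFermion [CharZero K] {k : ℕ} (hk : k ≤ d) {S : Finset ℕ} {μ : Multiset ℕ+}
    (hS : ∀ x ∈ S, x < k) :
    realize K N (joinFermion c d (mulFermion K k (ket K S μ))) =
      psumTheta K N k * realize K N (joinFermion c d (ket K S μ))
      + c k • ∑ a ∈ Finset.range d, ((a : K) + 1) • (psumTheta K N (k + (a + 1)) *
        realize K N (derivBoson K (Nat.succPNat a) (ket K S μ))) := by
  simp only [realize_joinFermion, psumTheta_mul_realize_derivFermion_derivBoson hS, smul_add,
    smul_ite, smul_zero, Finset.sum_add_distrib, Finset.mul_sum, mul_smul_comm,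
    Finset.sum_ite_eq', Finset.mem_range, Nat.lt_succ_iff, if_pos hk, Finset.smul_sum]
  congr 1
  refine Finset.sum_congr rfl fun a _ => ?_
  rw [add_comm (a + 1) k]
  module

end realize

theorem isSymm_realize (v : Fock K) : IsSymm (realize K N v) := by
  intro σ
  have : (diagPerm K σ).toLinearMap ∘ₗ realize K N = realize K N := by
    refine fock_hom_ext fun S μ => ?_
    rw [LinearMap.comp_apply, realize, Finsupp.linearCombination_single, one_smul]
    exact isSymm_apply _ _ σ
  exact LinearMap.congr_fun this v

theorem hamiltonian_one [CharZero K] (β : K) : hamiltonian β N 1 = 0 := by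
  have h := hamiltonian_mul (K := K) (N := N) β (F := 1) (G := 1) (fun σ => map_one _)
    (fun σ => map_one _)
  simpa [fun i : Fin N => (isLeibniz_superXDeriv (K := K) i).map_one] using h

theorem chargeI_one [CharZero K] (β : K) : chargeI β N 1 1 = 0 := by
  have h := chargeI_smul_one (K := K) (N := N) β 1 (by rw [one_smul]; exact fun σ => map_one _)
  rwa [one_smul] at h

/-- Both sides vanish on 1 and satisfy the same recursion when a factor is added. The operator on
the left does not involve N: one operator on the Fock space governs all components of a family. -/
theorem realize_fockHamiltonian [CharZero K] (β c : K) (d : ℕ) (S : Finset ℕ) (μ : Multiset ℕ+)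
    (h : PartsLE d S μ) :
    realize K N (fockHamiltonian β c d (ket K S μ)) =
      hamiltonian β N (realize K N (ket K S μ))
        + (β * (c - (N : K))) • euler K N (realize K N (ket K S μ)) := by
  have he : euler K N = vectorField K N 0 := by simp [euler_eq_sum, vectorField]
  rw [he]
  simp only [fockHamiltonian, LinearMap.add_apply, LinearMap.smul_apply, map_add, map_smul,
    diagonal_ket]
  induction S, μ using ket_induction with
  | empty =>
    have h1 : vectorField K N 0 1 = 0 := (isLeibniz_vectorField 0).map_one
    simp [energy, realize_splitBoson, realize_splitFermion, realize_joinBoson,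
      realize_joinFermion, derivBoson_ket, derivFermion_ket, realize_ket, psumThetaProd_empty,
      hamiltonian_one, h1]
  | fermion k S hS ih =>
    obtain ⟨hk, h'⟩ := h.of_insert
    have hen : energy β c (insert k S, 0) = partEnergy β c k + energy β c (S, 0) := by
      simp only [energy, Finset.sum_insert fun hk => lt_irrefl k (hS k hk), add_assoc]
    rw [hen, ket_insert_max hS, realize_splitBoson_mulFermion,
      realize_splitFermion_mulFermion _ hk hS, realize_joinBoson_mulFermion,
      realize_joinFermion_mulFermion _ hk hS, realize_mulFermion,
      hamiltonian_psumTheta_mul β k (isSymm_realize _), vectorField_psumTheta_mul,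
      realize_oddVectorField k d S 0 h', zero_add]
    have ih := congrArg (psumTheta K N k * ·) (ih h')
    simp only [mul_add, mul_smul_comm] at ih
    -- The Euler term contributes β(c - N)k for a part k, which replaces N by c in the eigenvalue.
    have hp : partEnergy β c k = (k : K) ^ 2 + β * (k : K) * ((N : K) - (k : K))
        + β * (c - (N : K)) * (k : K) := by rw [partEnergy]; ring
    rw [hp]
    linear_combination (norm := module) ih
  | boson k S μ ih =>
    obtain ⟨hk, h'⟩ := h.of_cons
    obtain ⟨m, rfl⟩ : ∃ m, k = Nat.succPNat m := ⟨k.natPred, by simp⟩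
    have hk : m < d := hk
    have hen : energy β c (S, Nat.succPNat m ::ₘ μ) =
        partEnergy β c (m + 1) + energy β c (S, μ) := by
      simp only [energy, Multiset.map_cons, Multiset.sum_cons, Nat.succPNat_coe,
        Nat.succ_eq_add_one]
      ring
    rw [hen, ket_cons, realize_splitBoson_mulBoson hk, realize_splitFermion_mulBoson,
      realize_joinBoson_mulBoson hk, realize_joinFermion_mulBoson _ hk, realize_mulBoson]
    simp only [Nat.succPNat_coe, Nat.succ_eq_add_one]
    rw [hamiltonian_psumX_smul β m (isSymm_realize _), vectorField_psumX_smul,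
      realize_vectorField (m + 1) d S μ h', zero_add]
    have ih := congrArg (psumX K N (m + 1) • ·) (ih h')
    simp only [smul_add, smul_comm (psumX K N (m + 1)) (_ : K)] at ih
    have hp : partEnergy β c (m + 1) = ((m : K) + 1) ^ 2 + β * ((m : K) + 1) *
        ((N : K) - ((m : K) + 1)) + β * (c - (N : K)) * ((m : K) + 1) := by
      rw [partEnergy]; push_cast; ring
    rw [hp, Nat.cast_succ]
    linear_combination (norm := module) ih

theorem realize_fockCharge [CharZero K] (β : K) (d : ℕ) (S : Finset ℕ) (μ : Multiset ℕ+)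
    (h : PartsLE d S μ) :
    realize K N (fockCharge β d (ket K S μ)) = chargeI β N 1 (realize K N (ket K S μ)) := by
  simp only [fockCharge, LinearMap.add_apply, LinearMap.smul_apply, map_add, map_smul,
    diagonal_ket]
  induction S, μ using ket_induction with
  | empty =>
    simp [chargeEigenvalue, realize_splitFermion, realize_joinFermion, derivBoson_ket,
      derivFermion_ket, realize_ket, psumThetaProd_empty, chargeI_one]
  | fermion k S hS ih =>
    obtain ⟨hk, h'⟩ := h.of_insert
    -- A new odd factor contributes -β times the number of odd factors already present, by the
    -- fermion number term of the product rule; these add up to -β m(m-1)/2.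
    have hen : chargeEigenvalue β (insert k S, 0) =
        (k : K) * (1 - β) - β * (S.card : K) + chargeEigenvalue β (S, 0) := by
      have hkS : k ∉ S := fun hk => lt_irrefl k (hS k hk)
      simp only [chargeEigenvalue, Finset.sum_insert hkS, Finset.card_insert_of_notMem hkS,
        Nat.cast_succ]
      field_simp
      ring
    rw [hen, ket_insert_max hS, realize_splitFermion_mulFermion _ hk hS,
      realize_joinFermion_mulFermion _ hk hS, realize_mulFermion,
      chargeI_psumTheta_mul β k (isSymm_realize _), realize_oddVectorField k d S 0 h',
      fermionNumber_realize, mul_smul_comm]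
    have ih := congrArg (psumTheta K N k * ·) (ih h')
    simp only [mul_add, mul_smul_comm] at ih
    simp only [one_smul]
    linear_combination (norm := module) ih
  | boson k S μ ih =>
    obtain ⟨hk, h'⟩ := h.of_cons
    obtain ⟨m, rfl⟩ : ∃ m, k = Nat.succPNat m := ⟨k.natPred, by simp⟩
    have hk : m < d := hk
    have hen : chargeEigenvalue β (S, Nat.succPNat m ::ₘ μ) = chargeEigenvalue β (S, μ) := rfl
    rw [hen, ket_cons, realize_splitFermion_mulBoson, realize_joinFermion_mulBoson _ hk,
      realize_mulBoson]
    simp only [Nat.succPNat_coe, Nat.succ_eq_add_one]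
    rw [chargeI_psumX_smul β m (isSymm_realize _), realize_thetaVectorField (m + 1) d S μ h']
    have ih := congrArg (psumX K N (m + 1) • ·) (ih h')
    simp only [smul_add, smul_comm (psumX K N (m + 1)) (_ : K)] at ih
    simp only [one_smul]
    linear_combination (norm := module) ih

/-! ### The bilinear form on the Fock space -/

theorem Superpartition.z_eq_prod (L : Superpartition) {s : Finset ℕ+} (h : L.2.toFinset ⊆ s) :
    L.z = ∏ k ∈ s, (k : ℕ) ^ L.2.count k * (L.2.count k).factorial := by
  refine Finset.prod_subset h fun k _ hk => ?_
  rw [Multiset.mem_toFinset] at hk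
  simp [Multiset.count_eq_zero_of_notMem hk]

theorem Superpartition.z_cons (S : Finset ℕ) (n : ℕ+) (μ : Multiset ℕ+) :
    Superpartition.z (S, n ::ₘ μ) = n * (μ.count n + 1) * Superpartition.z (S, μ) := by
  have h : μ.toFinset ⊆ insert n μ.toFinset := Finset.subset_insert _ _
  rw [z_eq_prod (S, n ::ₘ μ) (s := insert n μ.toFinset) (by simp), z_eq_prod (S, μ) h,
    ← Finset.mul_prod_erase _ _ (Finset.mem_insert_self n _),
    ← Finset.mul_prod_erase _ _ (Finset.mem_insert_self n _)]
  simp only [Multiset.count_cons_self]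
  rw [Finset.prod_congr rfl fun k hk => by
    rw [Multiset.count_cons_of_ne (Finset.ne_of_mem_erase hk)], pow_succ, Nat.factorial_succ]
  ring

/-- The weight `z_Λ(β)`. -/
def formWeight (β : K) (L : Superpartition) : K := (β ^ L.length)⁻¹ * (L.z : K)

theorem formWeight_insert (β : K) {n : ℕ} {S : Finset ℕ} (μ : Multiset ℕ+) (h : n ∉ S) :
    formWeight β (insert n S, μ) = β⁻¹ * formWeight β (S, μ) := by
  have : Superpartition.z (insert n S, μ) = Superpartition.z (S, μ) := rfl
  rw [formWeight, formWeight, this, Superpartition.length, Superpartition.length,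
    Finset.card_insert_of_notMem h, add_right_comm, pow_succ, mul_inv]
  ring

theorem formWeight_cons (β : K) (S : Finset ℕ) (n : ℕ+) (μ : Multiset ℕ+) :
    formWeight β (S, n ::ₘ μ) = (n : K) / β * ((μ.count n : K) + 1) * formWeight β (S, μ) := by
  rw [formWeight, formWeight, Superpartition.z_cons, Superpartition.length, Superpartition.length,
    Multiset.card_cons, ← add_assoc, pow_succ, mul_inv]
  push_cast
  ring

/-- The bilinear form on the Fock space with `⟨Λ, Ω⟩ = z_Λ(β) δ_{ΛΩ}`. -/
def fockForm (β : K) : LinearMap.BilinForm K (Fock K) :=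
  Finsupp.linearCombination K fun L => formWeight β L • Finsupp.lapply L

theorem fockForm_ket (β : K) (S T : Finset ℕ) (μ ν : Multiset ℕ+) :
    fockForm β (ket K S μ) (ket K T ν) = if (S, μ) = (T, ν) then formWeight β (S, μ) else 0 := by
  rw [fockForm, Finsupp.linearCombination_single, one_smul, LinearMap.smul_apply,
    Finsupp.lapply_apply, Finsupp.single_apply]
  simp only [eq_comm (a := (T, ν)), smul_eq_mul, mul_ite, mul_one, mul_zero]

theorem fock_adjoint_ext {B : LinearMap.BilinForm K (Fock K)} {f g : Module.End K (Fock K)}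
    (h : ∀ S μ T ν, B (f (ket K S μ)) (ket K T ν) = B (ket K S μ) (g (ket K T ν))) (v u : Fock K) :
    B (f v) u = B v (g u) := by
  have : B ∘ₗ f = B.compl₂ g := fock_hom_ext fun S μ => fock_hom_ext fun T ν => h S μ T ν
  exact LinearMap.congr_fun (LinearMap.congr_fun this v) u

theorem fockForm_comm (β : K) (v u : Fock K) : fockForm β v u = fockForm β u v := by
  have : fockForm β = (fockForm β).flip := by
    refine fock_hom_ext fun S μ => fock_hom_ext fun T ν => ?_
    change _ = fockForm β (ket K T ν) (ket K S μ)
    rw [fockForm_ket, fockForm_ket]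
    split_ifs with h h' h'
    · rw [h]
    · exact absurd h.symm h'
    · exact absurd h'.symm h
    · rfl
  exact LinearMap.congr_fun (LinearMap.congr_fun this v) u

theorem fockForm_diagonal (β : K) (c : Superpartition → K) (v u : Fock K) :
    fockForm β (diagonal c v) u = fockForm β v (diagonal c u) := by
  refine fock_adjoint_ext (fun S μ T ν => ?_) v u
  rw [diagonal_ket, diagonal_ket, map_smul, map_smul, LinearMap.smul_apply, fockForm_ket]
  split_ifs with h
  · rw [h]
  · simp

/-- A further part n multiplies z_Λ(β) by n/β and by the new multiplicity of n; that multiplicity is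
exactly the coefficient which ∂_{p_n} produces. -/
theorem fockForm_mulBoson (β : K) (n : ℕ+) (v u : Fock K) :
    fockForm β (mulBoson K n v) u = (n : K) / β * fockForm β v (derivBoson K n u) := by
  rw [← smul_eq_mul, ← map_smul, ← LinearMap.smul_apply]
  refine fock_adjoint_ext (fun S μ T ν => ?_) v u
  rw [LinearMap.smul_apply, mulBoson_ket, derivBoson_ket, map_smul, map_smul, fockForm_ket,
    fockForm_ket, smul_eq_mul, smul_eq_mul]
  by_cases hn : n ∈ ν
  · obtain ⟨ν, rfl⟩ := Multiset.exists_cons_of_mem hn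
    simp only [Multiset.erase_cons_head, Prod.mk.injEq, Multiset.cons_inj_right,
      Multiset.count_cons_self]
    split_ifs with h
    · rw [formWeight_cons, h.2]; push_cast; ring
    · simp
  · rw [Multiset.count_eq_zero_of_notMem hn, if_neg]
    · simp
    · rintro h
      exact hn ((Prod.mk.inj h).2 ▸ Multiset.mem_cons_self n μ)

theorem fockForm_derivBoson [CharZero K] {β : K} (hβ : β ≠ 0) (n : ℕ+) (v u : Fock K) :
    fockForm β (derivBoson K n v) u = β / (n : K) * fockForm β v (mulBoson K n u) := by
  have hn : (n : K) ≠ 0 := Nat.cast_ne_zero.2 n.pos.ne'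
  rw [fockForm_comm, fockForm_comm β v, fockForm_mulBoson, ← mul_assoc,
    div_mul_div_cancel₀ hn, div_self hβ, one_mul]

/-- Inserting n into a set and erasing it again carry the same order sign, and an odd part changes
z_Λ(β) only by β⁻¹. -/
theorem fockForm_mulFermion (β : K) (n : ℕ) (v u : Fock K) :
    fockForm β (mulFermion K n v) u = β⁻¹ * fockForm β v (derivFermion K n u) := by
  rw [← smul_eq_mul, ← map_smul, ← LinearMap.smul_apply]
  refine fock_adjoint_ext (fun S μ T ν => ?_) v u
  rw [LinearMap.smul_apply, mulFermion_ket, derivFermion_ket]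
  by_cases hS : n ∈ S
  · rw [if_pos hS, map_zero, LinearMap.zero_apply]
    split_ifs with hT
    · rw [map_smul, map_smul, fockForm_ket, if_neg, smul_zero, smul_zero]
      rintro h
      exact Finset.notMem_erase n T ((Prod.mk.inj h).1 ▸ hS)
    · rw [smul_zero, map_zero]
  rw [if_neg hS, map_smul, LinearMap.smul_apply, fockForm_ket]
  by_cases hT : n ∈ T
  · rw [if_pos hT, map_smul, map_smul, fockForm_ket]
    by_cases h : S = T.erase n ∧ μ = ν
    · obtain ⟨rfl, rfl⟩ := h
      rw [if_pos rfl, if_pos (by rw [Finset.insert_erase hT]), formWeight_insert β μ hS,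
        orderSign_erase_self]
      simp only [smul_eq_mul]
      ring
    · rw [if_neg, if_neg]
      · simp
      · simpa using h
      · rintro h'
        obtain ⟨h1, h2⟩ := Prod.mk.inj h'
        exact h ⟨by rw [← h1, Finset.erase_insert hS], h2⟩
  · rw [if_neg hT, if_neg]
    · simp
    · rintro h
      exact hT ((Prod.mk.inj h).1 ▸ Finset.mem_insert_self n S)

theorem fockForm_derivFermion {β : K} (hβ : β ≠ 0) (n : ℕ) (v u : Fock K) :
    fockForm β (derivFermion K n v) u = β * fockForm β v (mulFermion K n u) := by
  rw [fockForm_comm, fockForm_comm β v, fockForm_mulFermion, mul_inv_cancel_left₀ hβ]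

theorem derivBoson_comm (m n : ℕ+) (v : Fock K) :
    derivBoson K m (derivBoson K n v) = derivBoson K n (derivBoson K m v) := by
  have : derivBoson K m ∘ₗ derivBoson K n = derivBoson K n ∘ₗ derivBoson K m := by
    refine fock_hom_ext fun S μ => ?_
    rcases eq_or_ne m n with rfl | h
    · rfl
    rw [LinearMap.comp_apply, LinearMap.comp_apply, derivBoson_ket, derivBoson_ket, map_smul,
      map_smul, derivBoson_ket, derivBoson_ket, Multiset.erase_comm,
      Multiset.count_erase_of_ne h, Multiset.count_erase_of_ne h.symm, smul_comm]
  exact LinearMap.congr_fun this v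

/-- Termwise: the adjoint of β(a+b) p_a p_b ∂_{p_{a+b}} has coefficient β(a+b)·(a/β)(b/β)·β/(a+b) =
ab. The two truncations run over the same index pairs, so adjointness is exact for every d. -/
theorem fockForm_splitBoson [CharZero K] {β : K} (hβ : β ≠ 0) (d : ℕ) (v u : Fock K) :
    β * fockForm β (splitBoson K d v) u = fockForm β v (joinBoson K d u) := by
  simp only [splitBoson, joinBoson, LinearMap.sum_apply, map_sum, Finset.mul_sum,
    LinearMap.smul_apply, map_smul, LinearMap.comp_apply, smul_eq_mul]
  refine Finset.sum_congr rfl fun a _ => Finset.sum_congr rfl fun b _ => ?_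
  have h : (a : K) + 1 + b + 1 ≠ 0 := by exact_mod_cast (a + 1 + b).succ_ne_zero
  rw [fockForm_mulBoson, fockForm_mulBoson, fockForm_derivBoson hβ,
    derivBoson_comm (Nat.succPNat a)]
  simp only [Nat.succPNat_coe, Nat.succ_eq_add_one, Nat.cast_add, Nat.cast_one]
  field_simp
  ring

theorem fockForm_splitFermion {β : K} (hβ : β ≠ 0) (c : ℕ → K) (d : ℕ) (v u : Fock K) :
    β * fockForm β (splitFermion c d v) u = fockForm β v (joinFermion c d u) := by
  simp only [splitFermion, joinFermion, LinearMap.sum_apply, map_sum, Finset.mul_sum,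
    LinearMap.smul_apply, map_smul, LinearMap.comp_apply, smul_eq_mul]
  refine Finset.sum_congr rfl fun a _ => Finset.sum_congr rfl fun b _ => ?_
  rw [fockForm_mulBoson, fockForm_mulFermion, fockForm_derivFermion hβ]
  simp only [Nat.succPNat_coe, Nat.succ_eq_add_one, Nat.cast_add, Nat.cast_one]
  field_simp

theorem fockForm_joinBoson [CharZero K] {β : K} (hβ : β ≠ 0) (d : ℕ) (v u : Fock K) :
    fockForm β (joinBoson K d v) u = β * fockForm β v (splitBoson K d u) := by
  rw [fockForm_comm, ← fockForm_splitBoson hβ, fockForm_comm]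

theorem fockForm_joinFermion {β : K} (hβ : β ≠ 0) (c : ℕ → K) (d : ℕ) (v u : Fock K) :
    fockForm β (joinFermion c d v) u = β * fockForm β v (splitFermion c d u) := by
  rw [fockForm_comm, ← fockForm_splitFermion hβ, fockForm_comm]

theorem fockForm_fockHamiltonian [CharZero K] {β : K} (hβ : β ≠ 0) (c : K) (d : ℕ)
    (v u : Fock K) :
    fockForm β (fockHamiltonian β c d v) u = fockForm β v (fockHamiltonian β c d u) := by
  simp only [fockHamiltonian, LinearMap.add_apply, LinearMap.smul_apply, map_add, map_smul,
    smul_eq_mul, fockForm_diagonal, mul_assoc, fockForm_splitBoson hβ, fockForm_splitFermion hβ,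
    fockForm_joinBoson hβ, fockForm_joinFermion hβ]
  ring

theorem fockForm_fockCharge {β : K} (hβ : β ≠ 0) (d : ℕ) (v u : Fock K) :
    fockForm β (fockCharge β d v) u = fockForm β v (fockCharge β d u) := by
  simp only [fockCharge, LinearMap.add_apply, LinearMap.smul_apply, map_add, map_smul,
    smul_eq_mul, fockForm_diagonal, fockForm_splitFermion hβ, fockForm_joinFermion hβ]
  ring

/-! ### Reversing the anticommuting factors -/

/-- The sign `(-1) ^ (m (m - 1) / 2)` of the reversal of `m` anticommuting factors. -/
def reverseSign (K : Type) [Field K] (L : Superpartition) : K :=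
  (-1) ^ (L.1.card * (L.1.card - 1) / 2)

theorem reverseSign_mul_self (L : Superpartition) : reverseSign K L * reverseSign K L = 1 := by
  rw [reverseSign, ← mul_pow]; simp

/-- The reversal of the anticommuting factors on the Fock space. -/
def reversal (K : Type) [Field K] : Module.End K (Fock K) := diagonal (reverseSign K)

/-- An operator that preserves the fermion number commutes with functions of this number. -/
def PreservesFermions (f : Module.End K (Fock K)) : Prop :=
  ∀ (g : ℕ → K) v, f (diagonal (fun L => g L.1.card) v) = diagonal (fun L => g L.1.card) (f v)

namespace PreservesFermions

variable {f f' : Module.End K (Fock K)}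

theorem add (h : PreservesFermions f) (h' : PreservesFermions f') : PreservesFermions (f + f') :=
  fun g v => by simp only [LinearMap.add_apply, map_add, h g, h' g]

theorem smul (h : PreservesFermions f) (r : K) : PreservesFermions (r • f) :=
  fun g v => by simp only [LinearMap.smul_apply, map_smul, h g]

theorem comp (h : PreservesFermions f) (h' : PreservesFermions f') :
    PreservesFermions (f ∘ₗ f') :=
  fun g v => by simp only [LinearMap.comp_apply, h' g, h g]

theorem sum {ι : Type*} {f : ι → Module.End K (Fock K)} (s : Finset ι)
    (h : ∀ i, PreservesFermions (f i)) : PreservesFermions (∑ i ∈ s, f i) :=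
  fun g v => by
    simp only [LinearMap.sum_apply, map_sum]
    exact Finset.sum_congr rfl fun i _ => h i g v

theorem of_ket {f : Module.End K (Fock K)}
    (h : ∀ (g : ℕ → K) S μ, g S.card • f (ket K S μ) =
      diagonal (fun L => g L.1.card) (f (ket K S μ))) : PreservesFermions f := by
  intro g v
  have : f ∘ₗ diagonal (fun L => g L.1.card) = diagonal (fun L => g L.1.card) ∘ₗ f :=
    fock_hom_ext fun S μ => by
      rw [LinearMap.comp_apply, LinearMap.comp_apply, diagonal_ket, map_smul, h]
  exact LinearMap.congr_fun this v

theorem diagonal (c : Superpartition → K) : PreservesFermions (diagonal c) :=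
  of_ket fun g S μ => by rw [diagonal_ket, map_smul, diagonal_ket, smul_comm]

theorem mulBoson (n : ℕ+) : PreservesFermions (mulBoson K n) :=
  of_ket fun g S μ => by rw [mulBoson_ket, diagonal_ket]

theorem derivBoson (n : ℕ+) : PreservesFermions (derivBoson K n) :=
  of_ket fun g S μ => by rw [derivBoson_ket, map_smul, diagonal_ket, smul_comm]

theorem mulFermion_comp_derivFermion (m n : ℕ) :
    PreservesFermions (mulFermion K m ∘ₗ derivFermion K n) :=
  of_ket fun g S μ => by
    rw [LinearMap.comp_apply, derivFermion_ket]
    split_ifs with hn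
    · rw [map_smul, mulFermion_ket]
      split_ifs with hm
      · simp
      · rw [map_smul, map_smul, diagonal_ket, Finset.card_insert_of_notMem hm,
          Finset.card_erase_add_one hn, smul_comm, smul_comm (orderSign K m _)]
    · simp

theorem splitBoson (d : ℕ) : PreservesFermions (splitBoson K d) :=
  sum _ fun _ => sum _ fun _ => smul ((mulBoson _).comp ((mulBoson _).comp (derivBoson _))) _

theorem joinBoson (d : ℕ) : PreservesFermions (joinBoson K d) :=
  sum _ fun _ => sum _ fun _ => smul ((mulBoson _).comp ((derivBoson _).comp (derivBoson _))) _

theorem splitFermion (c : ℕ → K) (d : ℕ) : PreservesFermions (splitFermion c d) :=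
  sum _ fun _ => sum _ fun _ =>
    smul ((mulBoson _).comp (mulFermion_comp_derivFermion _ _)) _

theorem joinFermion (c : ℕ → K) (d : ℕ) : PreservesFermions (joinFermion c d) :=
  sum _ fun a => sum _ fun b => by
    rw [← LinearMap.comp_assoc]
    exact smul ((mulFermion_comp_derivFermion _ _).comp (derivBoson _)) _

end PreservesFermions

/-- Every term removes as many odd factors as it adds, and the reversal sign is a function of their
number. -/
theorem fockHamiltonian_reversal (β c : K) (d : ℕ) (v : Fock K) :
    fockHamiltonian β c d (reversal K v) = reversal K (fockHamiltonian β c d v) :=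
  ((((PreservesFermions.diagonal _).add ((PreservesFermions.splitBoson d).smul β)).add
    ((PreservesFermions.splitFermion _ d).smul (2 * β))).add
      (PreservesFermions.joinBoson d)).add ((PreservesFermions.joinFermion _ d).smul 2)
    (fun m => (-1) ^ (m * (m - 1) / 2)) v

theorem fockCharge_reversal (β : K) (d : ℕ) (v : Fock K) :
    fockCharge β d (reversal K v) = reversal K (fockCharge β d v) :=
  (((PreservesFermions.diagonal _).add ((PreservesFermions.splitFermion _ d).smul β)).add
    (PreservesFermions.joinFermion _ d)) (fun m => (-1) ^ (m * (m - 1) / 2)) v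

theorem fermionicPowerSum_mul_fermionicPowerSum (m n : ℕ) :
    fermionicPowerSum K m * fermionicPowerSum K n =
      (-1 : K) • (fermionicPowerSum K n * fermionicPowerSum K m) := by
  refine Subtype.ext (funext fun N => ?_)
  change (fermionicPowerSum K m : ∀ N, Superpoly K N) N *
    (fermionicPowerSum K n : ∀ N, Superpoly K N) N =
      (-1 : K) • ((fermionicPowerSum K n : ∀ N, Superpoly K N) N *
        (fermionicPowerSum K m : ∀ N, Superpoly K N) N)
  rw [fermionicPowerSum_apply, fermionicPowerSum_apply, psumTheta_mul_psumTheta]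
  exact (neg_one_smul K (psumTheta K N n * psumTheta K N m)).symm

theorem powerSumRev_eq (L : Superpartition) :
    powerSumRev K L = reverseSign K L • powerSum K L := by
  have h : L.1.sort (· ≤ ·) = (L.1.sort (· ≥ ·)).reverse := by
    refine List.Perm.eq_of_pairwise' (r := (· ≤ ·)) (Finset.pairwise_sort _ _) ?_ ?_
    · rw [List.pairwise_reverse]
      exact Finset.pairwise_sort _ _
    · exact ((Finset.sort_perm_toList _ _).trans (Finset.sort_perm_toList _ _).symm).trans
        (List.reverse_perm _).symm
  rw [powerSumRev, h, list_prod_reverse_of_anticommute (K := K) _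
    fermionicPowerSum_mul_fermionicPowerSum, Finset.length_sort, smul_mul_assoc, powerSum,
    reverseSign]

/-! ### Coefficients with respect to the first pair of variables -/

/-- The coefficient of `x₀ ^ n`, a polynomial in the other variables. -/
def coeffX (K : Type) [Field K] (N n : ℕ) :
    MvPolynomial (Fin (N + 1)) K →ₗ[K] MvPolynomial (Fin N) K :=
  (Polynomial.lcoeff (MvPolynomial (Fin N) K) n).restrictScalars K ∘ₗ
    (finSuccEquiv K N).toLinearMap

theorem coeffX_apply (n : ℕ) (f : MvPolynomial (Fin (N + 1)) K) :
    coeffX K N n f = (finSuccEquiv K N f).coeff n := rfl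

theorem coeff_coeffX (n : ℕ) (f : MvPolynomial (Fin (N + 1)) K) (m : Fin N →₀ ℕ) :
    coeff m (coeffX K N n f) = coeff (m.cons n) f := finSuccEquiv_coeff_coeff m f n

theorem finSuccEquiv_rename_succ (f : MvPolynomial (Fin N) K) :
    finSuccEquiv K N (rename Fin.succ f) = Polynomial.C f := by
  induction f using MvPolynomial.induction_on with
  | C a => rw [rename_C, finSuccEquiv_apply, eval₂Hom_C]; rfl
  | add p q hp hq => rw [map_add, map_add, hp, hq, map_add]
  | mul_X p i hp => rw [map_mul, map_mul, hp, rename_X, finSuccEquiv_X_succ, map_mul]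

theorem psumX_succ_eq (k : ℕ) :
    psumX K (N + 1) k = X 0 ^ k + rename Fin.succ (psumX K N k) := by
  simp only [psumX, Fin.sum_univ_succ, map_sum, map_pow, rename_X]

theorem coeffX_X_zero_pow_mul (n k : ℕ) (f : MvPolynomial (Fin (N + 1)) K) :
    coeffX K N n (X 0 ^ k * f) = if k ≤ n then coeffX K N (n - k) f else 0 := by
  simp only [coeffX_apply, map_mul, map_pow, finSuccEquiv_X_zero, Polynomial.coeff_X_pow_mul']

theorem coeffX_rename_succ_mul (n : ℕ) (g : MvPolynomial (Fin N) K)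
    (f : MvPolynomial (Fin (N + 1)) K) :
    coeffX K N n (rename Fin.succ g * f) = g * coeffX K N n f := by
  simp only [coeffX_apply, map_mul, finSuccEquiv_rename_succ, Polynomial.coeff_C_mul]

theorem sum_X_pow_mul_coeffX {f : MvPolynomial (Fin (N + 1)) K} {B : ℕ} (hB : f.totalDegree < B) :
    ∑ n ∈ Finset.range B, X 0 ^ n * rename Fin.succ (coeffX K N n f) = f := by
  apply (finSuccEquiv K N).injective
  have hd : (finSuccEquiv K N f).natDegree < B :=
    (natDegree_finSuccEquiv f).trans_le (degreeOf_le_totalDegree f 0) |>.trans_lt hB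
  rw [map_sum, Polynomial.as_sum_range' (finSuccEquiv K N f) B hd]
  refine Finset.sum_congr rfl fun n _ => ?_
  rw [map_mul, map_pow, finSuccEquiv_X_zero, finSuccEquiv_rename_succ, coeffX_apply,
    ← Polynomial.C_mul_X_pow_eq_monomial, mul_comm]

/-- The permutation `Equiv.Perm.decomposeFin.symm (0, σ)` fixes the index 0 and acts as σ on the
remaining ones. -/
theorem coeffX_rename (n : ℕ) (σ : Equiv.Perm (Fin N)) (f : MvPolynomial (Fin (N + 1)) K) :
    coeffX K N n (rename (Equiv.Perm.decomposeFin.symm (0, σ)) f) =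
      rename σ (coeffX K N n f) := by
  have : (finSuccEquiv K N).toAlgHom.comp (rename (Equiv.Perm.decomposeFin.symm (0, σ))) =
      (Polynomial.mapAlgHom (rename σ)).comp (finSuccEquiv K N).toAlgHom := by
    refine MvPolynomial.algHom_ext fun i => ?_
    refine Fin.cases ?_ (fun j => ?_) i
    · simp [finSuccEquiv_X_zero]
    · simp [finSuccEquiv_X_succ]
  have h := congrArg (fun p => Polynomial.coeff p n) (DFunLike.congr_fun this f)
  simpa [coeffX_apply] using h

theorem coeffX_coeffX_swap (m n : ℕ) (f : MvPolynomial (Fin (N + 2)) K) :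
    coeffX K N m (coeffX K (N + 1) n (rename (Equiv.swap 0 1) f)) =
      coeffX K N n (coeffX K (N + 1) m f) := by
  ext s
  simp only [coeff_coeffX]
  have h : (s.cons m).cons n = Finsupp.mapDomain (Equiv.swap (0 : Fin (N + 2)) 1)
      ((s.cons n).cons m) := by
    ext i
    rw [← Equiv.apply_symm_apply (Equiv.swap (0 : Fin (N + 2)) 1) i,
      Finsupp.mapDomain_apply (Equiv.injective _), Equiv.symm_swap]
    refine Fin.cases ?_ (fun j => ?_) i
    · rw [Equiv.swap_apply_left, Equiv.swap_apply_right, Finsupp.cons_zero]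
      rw [← Fin.succ_zero_eq_one, Finsupp.cons_succ, Finsupp.cons_zero]
    · refine Fin.cases ?_ (fun l => ?_) j
      · rw [Fin.succ_zero_eq_one, Equiv.swap_apply_right, Equiv.swap_apply_left, Finsupp.cons_zero,
          ← Fin.succ_zero_eq_one, Finsupp.cons_succ, Finsupp.cons_zero]
      · have h0 : l.succ.succ ≠ (0 : Fin (N + 2)) := Fin.succ_ne_zero _
        have h1 : l.succ.succ ≠ (1 : Fin (N + 2)) := by
          rw [← Fin.succ_zero_eq_one]
          exact fun h => Fin.succ_ne_zero _ (Fin.succ_injective _ h)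
        rw [Equiv.swap_apply_of_ne_of_ne h0 h1, Equiv.swap_apply_of_ne_of_ne h0 h1]
        simp only [Finsupp.cons_succ]
  rw [h, coeff_rename_mapDomain _ (Equiv.injective _)]

theorem totalDegree_coeffX_add_le {n : ℕ} {f : MvPolynomial (Fin (N + 1)) K}
    (h : coeffX K N n f ≠ 0) : (coeffX K N n f).totalDegree + n ≤ f.totalDegree :=
  totalDegree_coeff_finSuccEquiv_add_le f n h

/-- The projection `θ₀ = 0` of the Grassmann algebra. -/
def dropTheta (K : Type) [Field K] (N : ℕ) :
    ExteriorAlgebra K (Fin (N + 1) → K) →ₐ[K] ExteriorAlgebra K (Fin N → K) :=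
  ExteriorAlgebra.map (LinearMap.funLeft K K Fin.succ)

/-- The inclusion of the Grassmann algebra that shifts the variables by one. -/
def shiftTheta (K : Type) [Field K] (N : ℕ) :
    ExteriorAlgebra K (Fin N → K) →ₐ[K] ExteriorAlgebra K (Fin (N + 1) → K) :=
  ExteriorAlgebra.map (LinearMap.pi (Fin.cases 0 fun i => LinearMap.proj i))

theorem dropTheta_ι (v : Fin (N + 1) → K) :
    dropTheta K N (ExteriorAlgebra.ι K v) = ExteriorAlgebra.ι K (fun i => v i.succ) := by
  rw [dropTheta, ExteriorAlgebra.map_apply_ι]; rfl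

theorem shiftTheta_dropTheta_ι (v : Fin (N + 1) → K) :
    shiftTheta K N (dropTheta K N (ExteriorAlgebra.ι K v)) =
      ExteriorAlgebra.ι K v - v 0 • theta K 0 := by
  rw [dropTheta_ι, shiftTheta, ExteriorAlgebra.map_apply_ι, theta, ← map_smul, ← map_sub]
  congr 1
  ext i
  refine Fin.cases ?_ (fun j => ?_) i <;> simp

theorem dropTheta_theta_zero : dropTheta K N (theta K 0) = 0 := by
  rw [theta, dropTheta_ι]
  rw [show (fun i : Fin N => (Pi.single 0 1 : Fin (N + 1) → K) i.succ) = 0 by ext i; simp, map_zero]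

theorem dropTheta_theta_succ (i : Fin N) : dropTheta K N (theta K i.succ) = theta K i := by
  rw [theta, dropTheta_ι, theta]
  congr 1
  ext j; simp [Pi.single_apply]

theorem dropTheta_thetaDeriv_succ (i : Fin N) (w : ExteriorAlgebra K (Fin (N + 1) → K)) :
    dropTheta K N (thetaDeriv K i.succ w) = thetaDeriv K i (dropTheta K N w) := by
  induction w using exteriorAlgebra_induction with
  | algebraMap r => rw [AlgHom.commutes, thetaDeriv_algebraMap, thetaDeriv_algebraMap, map_zero]
  | add a b ha hb => simp only [map_add, ha, hb]
  | ι_mul v w h =>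
    rw [thetaDeriv_ι_mul, map_sub, map_smul, map_mul, h, map_mul, dropTheta_ι, thetaDeriv_ι_mul]

/-- The Taylor expansion in θ₀, which stops after the linear term because θ₀² = 0. -/
theorem shift_drop_add (w : ExteriorAlgebra K (Fin (N + 1) → K)) :
    shiftTheta K N (dropTheta K N w) +
      theta K 0 * shiftTheta K N (dropTheta K N (thetaDeriv K 0 w)) = w := by
  induction w using exteriorAlgebra_induction with
  | algebraMap r => simp [thetaDeriv_algebraMap]
  | add a b ha hb =>
    conv_rhs => rw [← ha, ← hb]
    simp only [map_add, mul_add]; abel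
  | ι_mul v w h =>
    have h2 : theta K 0 * shiftTheta K N (dropTheta K N w) = theta K 0 * w := by
      conv_rhs => rw [← h, mul_add, ← mul_assoc, theta_mul_self, zero_mul, add_zero]
    have h3 : theta K 0 * ExteriorAlgebra.ι K v = -(ExteriorAlgebra.ι K v * theta K 0) :=
      ι_mul_ι_comm _ _
    rw [thetaDeriv_ι_mul]
    simp only [map_mul, map_sub, map_smul, shiftTheta_dropTheta_ι]
    conv_rhs => rw [← h]
    simp only [mul_sub, mul_add, sub_mul, smul_mul_assoc, mul_smul_comm, ← mul_assoc, h3,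
      theta_mul_self, neg_mul, smul_zero, zero_mul, sub_zero]
    abel

theorem dropTheta_map (σ : Equiv.Perm (Fin N)) (w : ExteriorAlgebra K (Fin (N + 1) → K)) :
    dropTheta K N (ExteriorAlgebra.map
      (LinearMap.funLeft K K (Equiv.Perm.decomposeFin.symm (0, σ)).symm) w) =
      ExteriorAlgebra.map (LinearMap.funLeft K K σ.symm) (dropTheta K N w) := by
  rw [dropTheta, ← AlgHom.comp_apply, ← AlgHom.comp_apply,
    ExteriorAlgebra.map_comp_map, ExteriorAlgebra.map_comp_map]
  congr 2

theorem dropTheta_dropTheta_swap (w : ExteriorAlgebra K (Fin (N + 2) → K)) :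
    dropTheta K N (dropTheta K (N + 1) (ExteriorAlgebra.map
      (LinearMap.funLeft K K (Equiv.swap 0 1).symm) w)) =
      dropTheta K N (dropTheta K (N + 1) w) := by
  rw [dropTheta, dropTheta, ← AlgHom.comp_apply, ← AlgHom.comp_apply, ← AlgHom.comp_apply,
    ExteriorAlgebra.map_comp_map, ExteriorAlgebra.map_comp_map]
  congr 2

/-- The coefficient of `x₀ ^ n` in the polynomial factor, together with a linear map on the
Grassmann factor. -/
def extract (n : ℕ) (E : ExteriorAlgebra K (Fin (N + 1) → K) →ₗ[K] ExteriorAlgebra K (Fin N → K)) :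
    Superpoly K (N + 1) →ₗ[K] Superpoly K N :=
  TensorProduct.map (coeffX K N n) E

/-- The coefficient of `x₀ ^ n` (with `θ₀ = 0`). -/
def extractX (K : Type) [Field K] (N n : ℕ) : Superpoly K (N + 1) →ₗ[K] Superpoly K N :=
  extract n (dropTheta K N).toLinearMap

/-- The coefficient of `θ₀ x₀ ^ n`. -/
def extractTheta (K : Type) [Field K] (N n : ℕ) : Superpoly K (N + 1) →ₗ[K] Superpoly K N :=
  extract n ((dropTheta K N).toLinearMap ∘ₗ thetaDeriv K 0)

theorem extractX_tmul (n : ℕ) (f : MvPolynomial (Fin (N + 1)) K)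
    (w : ExteriorAlgebra K (Fin (N + 1) → K)) :
    extractX K N n (f ⊗ₜ w) = coeffX K N n f ⊗ₜ dropTheta K N w := rfl

theorem extractTheta_tmul (n : ℕ) (f : MvPolynomial (Fin (N + 1)) K)
    (w : ExteriorAlgebra K (Fin (N + 1) → K)) :
    extractTheta K N n (f ⊗ₜ w) = coeffX K N n f ⊗ₜ dropTheta K N (thetaDeriv K 0 w) := rfl

theorem coeffX_zero_rename_finRotate (f : MvPolynomial (Fin (N + 1)) K) :
    coeffX K N 0 (rename (finRotate (N + 1)) f) =
      aeval (Fin.lastCases (0 : MvPolynomial (Fin N) K) X) f := by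
  rw [coeffX_apply]
  induction f using MvPolynomial.induction_on with
  | C a =>
    rw [rename_C, finSuccEquiv_apply, eval₂Hom_C, aeval_C]
    simp [MvPolynomial.algebraMap_eq]
  | add p q hp hq => rw [map_add, map_add, Polynomial.coeff_add, hp, hq, map_add]
  | mul_X p i hp =>
    rw [map_mul, map_mul, Polynomial.mul_coeff_zero, hp, map_mul, rename_X, aeval_X]
    congr 1
    refine Fin.lastCases ?_ (fun j => ?_) i
    · rw [finRotate_last, finSuccEquiv_X_zero, Polynomial.coeff_X_zero, Fin.lastCases_last]
    · rw [finRotate_apply, Fin.coeSucc_eq_succ, finSuccEquiv_X_succ, Polynomial.coeff_C_zero,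
        Fin.lastCases_castSucc]

theorem extractX_zero_diagPerm_finRotate (F : Superpoly K (N + 1)) :
    extractX K N 0 (diagPerm K (finRotate (N + 1)) F) = restrictVars K N F := by
  induction F using TensorProduct.induction_on with
  | zero => simp
  | add x y hx hy => simp only [map_add, hx, hy]
  | tmul f w =>
    rw [diagPerm, restrictVars, Algebra.TensorProduct.map_tmul, Algebra.TensorProduct.map_tmul,
      extractX_tmul, coeffX_zero_rename_finRotate, dropTheta, ← AlgHom.comp_apply,
      ExteriorAlgebra.map_comp_map]
    congr 3
    ext v i
    simp only [LinearMap.comp_apply, LinearMap.funLeft_apply]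
    have h : (finRotate (N + 1)).symm i.succ = i.castSucc := by
      rw [Equiv.symm_apply_eq, finRotate_apply, Fin.coeSucc_eq_succ]
    rw [h]

/-- Restriction kills the last pair of variables and extraction at n = 0 kills the first; a cyclic
rotation carries one to the other and fixes F. -/
theorem extractX_zero_of_isSymm {F : Superpoly K (N + 1)} (hF : IsSymm F) :
    extractX K N 0 F = restrictVars K N F := by
  rw [← extractX_zero_diagPerm_finRotate, hF]

theorem extract_psumX_smul (n k : ℕ)
    (E : ExteriorAlgebra K (Fin (N + 1) → K) →ₗ[K] ExteriorAlgebra K (Fin N → K))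
    (F : Superpoly K (N + 1)) :
    extract n E (psumX K (N + 1) k • F) =
      psumX K N k • extract n E F + if k ≤ n then extract (n - k) E F else 0 := by
  induction F using TensorProduct.induction_on with
  | zero => simp
  | add x y hx hy =>
    rw [smul_add, map_add, hx, hy, map_add, map_add, smul_add]
    split_ifs <;> abel
  | tmul f w =>
    simp only [extract, TensorProduct.smul_tmul', TensorProduct.map_tmul, smul_eq_mul,
      psumX_succ_eq, add_mul, map_add, coeffX_X_zero_pow_mul, coeffX_rename_succ_mul]
    split_ifs
    · rw [TensorProduct.add_tmul, add_comm]
    · rw [zero_add, add_zero]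

theorem psumTheta_mul_tmul (k : ℕ) (f : MvPolynomial (Fin N) K)
    (w : ExteriorAlgebra K (Fin N → K)) :
    psumTheta K N k * (f ⊗ₜ w) = ∑ i, (X i ^ k * f) ⊗ₜ[K] (theta K i * w) := by
  rw [psumTheta, Finset.sum_mul]
  refine Finset.sum_congr rfl fun i _ => ?_
  rw [thetaVar, TensorProduct.smul_tmul', Algebra.TensorProduct.tmul_mul_tmul, smul_eq_mul,
    mul_one]
  rfl

theorem coeffX_X_succ_pow_mul (n k : ℕ) (i : Fin N) (f : MvPolynomial (Fin (N + 1)) K) :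
    coeffX K N n (X i.succ ^ k * f) = X i ^ k * coeffX K N n f := by
  rw [← coeffX_rename_succ_mul, map_pow, rename_X]

theorem extractX_psumTheta_mul (n k : ℕ) (F : Superpoly K (N + 1)) :
    extractX K N n (psumTheta K (N + 1) k * F) = psumTheta K N k * extractX K N n F := by
  induction F using TensorProduct.induction_on with
  | zero => simp
  | add x y hx hy => simp only [mul_add, map_add, hx, hy]
  | tmul f w =>
    rw [psumTheta_mul_tmul, Fin.sum_univ_succ, map_add, map_sum, extractX_tmul, extractX_tmul,
      map_mul (dropTheta K N), dropTheta_theta_zero, zero_mul, TensorProduct.tmul_zero, zero_add,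
      psumTheta_mul_tmul]
    refine Finset.sum_congr rfl fun i _ => ?_
    rw [extractX_tmul, map_mul (dropTheta K N), dropTheta_theta_succ, coeffX_X_succ_pow_mul]

theorem extractTheta_psumTheta_mul (n k : ℕ) (F : Superpoly K (N + 1)) :
    extractTheta K N n (psumTheta K (N + 1) k * F) =
      (if k ≤ n then extractX K N (n - k) F else 0) - psumTheta K N k * extractTheta K N n F := by
  induction F using TensorProduct.induction_on with
  | zero => simp
  | add x y hx hy =>
    rw [mul_add, map_add, hx, hy, map_add, map_add, mul_add]
    split_ifs <;> abel
  | tmul f w =>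
    rw [psumTheta_mul_tmul, Fin.sum_univ_succ, map_add, map_sum, extractTheta_tmul,
      thetaDeriv_theta_mul_self, map_sub, map_mul (dropTheta K N), dropTheta_theta_zero, zero_mul, sub_zero,
      extractTheta_tmul, psumTheta_mul_tmul, coeffX_X_zero_pow_mul, sub_eq_add_neg,
      ← Finset.sum_neg_distrib]
    congr 1
    · split_ifs
      · rw [extractX_tmul]
      · rw [TensorProduct.zero_tmul]
    · refine Finset.sum_congr rfl fun i _ => ?_
      rw [extractTheta_tmul, thetaDeriv_theta_mul_of_ne (Fin.succ_ne_zero i).symm, map_neg,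
        map_mul (dropTheta K N), dropTheta_theta_succ, coeffX_X_succ_pow_mul, TensorProduct.tmul_neg]

theorem extractX_diagPerm (n : ℕ) (σ : Equiv.Perm (Fin N)) (F : Superpoly K (N + 1)) :
    extractX K N n (diagPerm K (Equiv.Perm.decomposeFin.symm (0, σ)) F) =
      diagPerm K σ (extractX K N n F) := by
  induction F using TensorProduct.induction_on with
  | zero => simp
  | add x y hx hy => simp only [map_add, hx, hy]
  | tmul f w =>
    rw [diagPerm, diagPerm, Algebra.TensorProduct.map_tmul, extractX_tmul, extractX_tmul,
      Algebra.TensorProduct.map_tmul, coeffX_rename, dropTheta_map]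

theorem extractTheta_diagPerm (n : ℕ) (σ : Equiv.Perm (Fin N)) (F : Superpoly K (N + 1)) :
    extractTheta K N n (diagPerm K (Equiv.Perm.decomposeFin.symm (0, σ)) F) =
      diagPerm K σ (extractTheta K N n F) := by
  induction F using TensorProduct.induction_on with
  | zero => simp
  | add x y hx hy => simp only [map_add, hx, hy]
  | tmul f w =>
    have h := map_thetaDeriv (Equiv.Perm.decomposeFin.symm (0, σ)) 0 w
    rw [Equiv.Perm.decomposeFin_symm_apply_zero] at h
    rw [diagPerm, diagPerm, Algebra.TensorProduct.map_tmul, extractTheta_tmul, extractTheta_tmul,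
      Algebra.TensorProduct.map_tmul, coeffX_rename, ← h, dropTheta_map]

theorem extractX_extractX_swap (m n : ℕ) (F : Superpoly K (N + 2)) :
    extractX K N m (extractX K (N + 1) n (diagPerm K (Equiv.swap 0 1) F)) =
      extractX K N n (extractX K (N + 1) m F) := by
  induction F using TensorProduct.induction_on with
  | zero => simp
  | add x y hx hy => simp only [map_add, hx, hy]
  | tmul f w =>
    rw [diagPerm, Algebra.TensorProduct.map_tmul, extractX_tmul, extractX_tmul, extractX_tmul,
      extractX_tmul, coeffX_coeffX_swap, dropTheta_dropTheta_swap]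

theorem dropTheta_thetaDeriv_dropTheta (w : ExteriorAlgebra K (Fin (N + 2) → K)) :
    dropTheta K N (thetaDeriv K 0 (dropTheta K (N + 1) w)) =
      dropTheta K N (dropTheta K (N + 1) (thetaDeriv K 1 w)) := by
  rw [← dropTheta_thetaDeriv_succ, Fin.succ_zero_eq_one]

theorem extractX_extractTheta_swap (m n : ℕ) (F : Superpoly K (N + 2)) :
    extractX K N m (extractTheta K (N + 1) n (diagPerm K (Equiv.swap 0 1) F)) =
      extractTheta K N n (extractX K (N + 1) m F) := by
  induction F using TensorProduct.induction_on with
  | zero => simp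
  | add x y hx hy => simp only [map_add, hx, hy]
  | tmul f w =>
    have h := map_thetaDeriv (Equiv.swap 0 1) 1 w
    rw [Equiv.swap_apply_right] at h
    rw [diagPerm, Algebra.TensorProduct.map_tmul, extractTheta_tmul, extractX_tmul, extractX_tmul,
      extractTheta_tmul, coeffX_coeffX_swap, ← h, dropTheta_dropTheta_swap,
      dropTheta_thetaDeriv_dropTheta]

/-- Exchanging the first two pairs of variables exchanges the order of the two extractions; the sign
is that of the anticommuting derivatives ∂_{θ₀} and ∂_{θ₁}. -/
theorem extractTheta_extractTheta_swap (m n : ℕ) (F : Superpoly K (N + 2)) :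
    extractTheta K N m (extractTheta K (N + 1) n (diagPerm K (Equiv.swap 0 1) F)) =
      -extractTheta K N n (extractTheta K (N + 1) m F) := by
  induction F using TensorProduct.induction_on with
  | zero => simp
  | add x y hx hy => simp only [map_add, hx, hy]; abel
  | tmul f w =>
    have h0 := map_thetaDeriv (Equiv.swap 0 1) 0 (thetaDeriv K 1 w)
    have h1 := map_thetaDeriv (Equiv.swap 0 1) 1 w
    rw [Equiv.swap_apply_right] at h1
    rw [Equiv.swap_apply_left] at h0
    rw [diagPerm, Algebra.TensorProduct.map_tmul, extractTheta_tmul, extractTheta_tmul,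
      extractTheta_tmul, extractTheta_tmul, coeffX_coeffX_swap, dropTheta_thetaDeriv_dropTheta,
      dropTheta_thetaDeriv_dropTheta, ← h1, ← h0, dropTheta_dropTheta_swap, thetaDeriv_comm,
      map_neg, map_neg, TensorProduct.tmul_neg]

/-- Reconstruction of a superpolynomial from its coefficients. -/
def assemble (n : ℕ) (w : ExteriorAlgebra K (Fin (N + 1) → K)) :
    Superpoly K N →ₗ[K] Superpoly K (N + 1) :=
  TensorProduct.map (LinearMap.mulLeft K (X 0 ^ n) ∘ₗ (rename Fin.succ).toLinearMap)
    (LinearMap.mulLeft K w ∘ₗ (shiftTheta K N).toLinearMap)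

theorem assemble_tmul (n : ℕ) (w : ExteriorAlgebra K (Fin (N + 1) → K))
    (f : MvPolynomial (Fin N) K) (u : ExteriorAlgebra K (Fin N → K)) :
    assemble n w (f ⊗ₜ u) = (X 0 ^ n * rename Fin.succ f) ⊗ₜ (w * shiftTheta K N u) := rfl

/-- The expansion in x₀ and θ₀. All sufficiently large truncations are required to work, so that the
bounds of two summands can be merged. -/
theorem exists_sum_assemble (F : Superpoly K (N + 1)) : ∃ B, ∀ B' ≥ B,
    ∑ n ∈ Finset.range B', (assemble n 1 (extractX K N n F) +
      assemble n (theta K 0) (extractTheta K N n F)) = F := by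
  induction F using TensorProduct.induction_on with
  | zero => exact ⟨0, fun B' _ => by simp⟩
  | add x y hx hy =>
    obtain ⟨B, hB⟩ := hx
    obtain ⟨C, hC⟩ := hy
    refine ⟨max B C, fun B' h => ?_⟩
    conv_rhs => rw [← hB B' (le_of_max_le_left h), ← hC B' (le_of_max_le_right h)]
    rw [← Finset.sum_add_distrib]
    refine Finset.sum_congr rfl fun n _ => ?_
    simp only [map_add]
    abel
  | tmul f w =>
    refine ⟨f.totalDegree + 1, fun B' h => ?_⟩
    simp only [extractX_tmul, extractTheta_tmul, assemble_tmul, one_mul, ← TensorProduct.tmul_add,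
      shift_drop_add, ← TensorProduct.sum_tmul]
    rw [sum_X_pow_mul_coeffX h]

theorem eq_zero_of_extract_eq_zero {F : Superpoly K (N + 1)} (hX : ∀ n, extractX K N n F = 0)
    (hT : ∀ n, extractTheta K N n F = 0) : F = 0 := by
  obtain ⟨B, hB⟩ := exists_sum_assemble F
  rw [← hB B le_rfl]
  exact Finset.sum_eq_zero fun n _ => by rw [hX, hT, map_zero, map_zero, add_zero]

theorem extract_mem_degreeLE (n d : ℕ)
    (E : ExteriorAlgebra K (Fin (N + 1) → K) →ₗ[K] ExteriorAlgebra K (Fin N → K))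
    {F : Superpoly K (N + 1)} (hF : F ∈ degreeLE K (N + 1) (d + n)) :
    extract n E F ∈ degreeLE K N d := by
  revert hF
  suffices h : degreeLE K (N + 1) (d + n) ≤ (degreeLE K N d).comap (extract n E) from fun hF => h hF
  rw [degreeLE, Submodule.span_le]
  rintro _ ⟨f, g, hf, rfl⟩
  rw [SetLike.mem_coe, Submodule.mem_comap, extract, TensorProduct.map_tmul]
  by_cases h : coeffX K N n f = 0
  · rw [h, TensorProduct.zero_tmul]; exact zero_mem _
  · exact Submodule.subset_span ⟨_, _, by have := totalDegree_coeffX_add_le h; omega, rfl⟩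

theorem extract_eq_zero_of_lt {n d : ℕ} (hd : d < n)
    (E : ExteriorAlgebra K (Fin (N + 1) → K) →ₗ[K] ExteriorAlgebra K (Fin N → K))
    {F : Superpoly K (N + 1)} (hF : F ∈ degreeLE K (N + 1) d) :
    extract n E F = 0 := by
  revert hF
  suffices h : degreeLE K (N + 1) d ≤ LinearMap.ker (extract n E) from fun hF => h hF
  rw [degreeLE, Submodule.span_le]
  rintro _ ⟨f, g, hf, rfl⟩
  rw [SetLike.mem_coe, LinearMap.mem_ker, extract, TensorProduct.map_tmul]
  by_cases h : coeffX K N n f = 0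
  · rw [h, TensorProduct.zero_tmul]
  · have := totalDegree_coeffX_add_le h
    omega

/-! ### The power sums are linearly independent -/

/-- The vectors of the Fock space whose superpartitions have length less than `k - 1`. -/
def shorter (K : Type) [Field K] (k : ℕ) : Submodule K (Fock K) :=
  Finsupp.supported K K {L : Superpartition | L.length + 1 < k}

theorem shorter_mono {j k : ℕ} (h : j ≤ k) : shorter K j ≤ shorter K k :=
  Finsupp.supported_mono fun _ hL => lt_of_lt_of_le hL h

theorem ket_mem_shorter {S : Finset ℕ} {μ : Multiset ℕ+} {k : ℕ} (h : S.card + μ.card + 1 < k) :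
    ket K S μ ∈ shorter K k :=
  Finsupp.single_mem_supported K _ h

theorem shorter_le {k : ℕ} {p : Submodule K (Fock K)}
    (h : ∀ S μ, S.card + Multiset.card μ + 1 < k → ket K S μ ∈ p) : shorter K k ≤ p := by
  rw [shorter, Finsupp.supported_eq_span_single, Submodule.span_le]
  rintro _ ⟨L, hL, rfl⟩
  exact h L.1 L.2 hL

theorem mulBoson_mem_shorter (n : ℕ+) {k : ℕ} {v : Fock K} (hv : v ∈ shorter K k) :
    mulBoson K n v ∈ shorter K (k + 1) := by
  have : shorter K k ≤ (shorter K (k + 1)).comap (mulBoson K n) := shorter_le fun S μ h => by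
    rw [Submodule.mem_comap, mulBoson_ket]
    exact ket_mem_shorter (by rw [Multiset.card_cons]; omega)
  exact this hv

theorem mulFermion_mem_shorter (n : ℕ) {k : ℕ} {v : Fock K} (hv : v ∈ shorter K k) :
    mulFermion K n v ∈ shorter K (k + 1) := by
  have : shorter K k ≤ (shorter K (k + 1)).comap (mulFermion K n) := shorter_le fun S μ h => by
    rw [Submodule.mem_comap, mulFermion_ket]
    split_ifs with hn
    · exact zero_mem _
    · exact Submodule.smul_mem _ _
        (ket_mem_shorter (by rw [Finset.card_insert_of_notMem hn]; omega))
  exact this hv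

theorem derivBoson_mem_shorter (n : ℕ+) {k : ℕ} {v : Fock K} (hv : v ∈ shorter K (k + 1)) :
    derivBoson K n v ∈ shorter K k := by
  have : shorter K (k + 1) ≤ (shorter K k).comap (derivBoson K n) := shorter_le fun S μ h => by
    rw [Submodule.mem_comap, derivBoson_ket]
    by_cases hn : n ∈ μ
    · have := Multiset.card_erase_add_one hn
      exact Submodule.smul_mem _ _ (ket_mem_shorter (by omega))
    · rw [Multiset.count_eq_zero_of_notMem hn, Nat.cast_zero, zero_smul]
      exact zero_mem _
  exact this hv

theorem derivFermion_mem_shorter (n : ℕ) {k : ℕ} {v : Fock K} (hv : v ∈ shorter K (k + 1)) :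
    derivFermion K n v ∈ shorter K k := by
  have : shorter K (k + 1) ≤ (shorter K k).comap (derivFermion K n) := shorter_le fun S μ h => by
    rw [Submodule.mem_comap, derivFermion_ket]
    split_ifs with hn
    · have := Finset.card_erase_add_one hn
      exact Submodule.smul_mem _ _ (ket_mem_shorter (by omega))
    · exact zero_mem _
  exact this hv

theorem isSymm_realize_ket (S : Finset ℕ) (μ : Multiset ℕ+) : IsSymm (realize K N (ket K S μ)) := by
  rw [realize, Finsupp.linearCombination_single, one_smul]
  exact isSymm_apply _ _

theorem restrictVars_realize_ket (S : Finset ℕ) (μ : Multiset ℕ+) :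
    restrictVars K N (realize K (N + 1) (ket K S μ)) = realize K N (ket K S μ) := by
  rw [realize, realize, Finsupp.linearCombination_single, Finsupp.linearCombination_single,
    one_smul, one_smul]
  exact (mem_symmetricSuperfunctions.1 (powerSum K (S, μ)).2).2.1 N

theorem extractX_zero_realize_ket (S : Finset ℕ) (μ : Multiset ℕ+) :
    extractX K N 0 (realize K (N + 1) (ket K S μ)) = realize K N (ket K S μ) := by
  rw [extractX_zero_of_isSymm (isSymm_realize_ket S μ), restrictVars_realize_ket]

theorem extractX_psumX_smul (n k : ℕ) (F : Superpoly K (N + 1)) :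
    extractX K N n (psumX K (N + 1) k • F) =
      psumX K N k • extractX K N n F + if k ≤ n then extractX K N (n - k) F else 0 :=
  extract_psumX_smul n k _ F

theorem extractTheta_psumX_smul (n k : ℕ) (F : Superpoly K (N + 1)) :
    extractTheta K N n (psumX K (N + 1) k • F) =
      psumX K N k • extractTheta K N n F + if k ≤ n then extractTheta K N (n - k) F else 0 :=
  extract_psumX_smul n k _ F

/-- A version that includes n = 0, where extraction is restriction and changes nothing. The
induction steps below need it: a factor p_k may absorb the entire power x₀ⁿ, leaving the index n - k
= 0. The remainder is allowed to be longer by one. -/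
theorem extractX_realize_of_succ {S : Finset ℕ} {μ : Multiset ℕ+}
    (h : ∀ n : ℕ+, ∃ w ∈ shorter K (S.card + μ.card), ∀ M,
      extractX K M n (realize K (M + 1) (ket K S μ)) =
        realize K M (derivBoson K n (ket K S μ) + w)) (n : ℕ) :
    ∃ w ∈ shorter K (S.card + μ.card + 1), ∀ M,
      extractX K M n (realize K (M + 1) (ket K S μ)) =
        realize K M ((if n = 0 then ket K S μ else 0) + w) := by
  rcases Nat.eq_zero_or_pos n with rfl | hn
  · exact ⟨0, zero_mem _, fun M => by rw [extractX_zero_realize_ket, if_pos rfl, add_zero]⟩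
  · obtain ⟨w, hw, h⟩ := h ⟨n, hn⟩
    refine ⟨derivBoson K ⟨n, hn⟩ (ket K S μ) + w, add_mem (derivBoson_mem_shorter _
      (ket_mem_shorter (Nat.lt_succ_self _))) (shorter_mono (Nat.le_succ _) hw), fun M => ?_⟩
    rw [if_neg hn.ne', zero_add, ← h M]
    rfl

/-- By p_k = x₀^k + (p_k in the rest), the coefficient of x₀ⁿ sums over the sets of bosonic factors
whose parts add up to n. Single factors give ∂_{p_n}, and sets of at least two shorten the product
by two or more, which is what `shorter` at the length of the product expresses. The remainder w must
not depend on the number of variables. -/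
theorem extractX_realize_ket [CharZero K] (S : Finset ℕ) (μ : Multiset ℕ+) :
    ∀ n : ℕ+, ∃ w ∈ shorter K (S.card + μ.card), ∀ M,
      extractX K M n (realize K (M + 1) (ket K S μ)) =
        realize K M (derivBoson K n (ket K S μ) + w) := by
  induction S, μ using ket_induction with
  | empty =>
    refine fun n => ⟨0, zero_mem _, fun M => ?_⟩
    rw [add_zero, derivBoson_ket, Multiset.count_zero, Nat.cast_zero, zero_smul, map_zero,
      realize_ket, Multiset.map_zero, Multiset.prod_zero, one_smul, psumThetaProd_empty,
      Algebra.TensorProduct.one_def, extractX_tmul, coeffX_apply, map_one, Polynomial.coeff_one,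
      if_neg n.pos.ne', TensorProduct.zero_tmul]
  | fermion k S hS ih =>
    intro n
    obtain ⟨w, hw, h⟩ := ih n
    refine ⟨mulFermion K k w, ?_, fun M => ?_⟩
    · have := mulFermion_mem_shorter k hw
      rwa [Finset.card_insert_of_notMem fun hk => lt_irrefl k (hS k hk), add_right_comm]
    · rw [ket_insert_max hS, realize_mulFermion, extractX_psumTheta_mul, h, derivBoson_mulFermion,
        ← map_add, realize_mulFermion]
  | boson k S μ ih =>
    intro n
    obtain ⟨w, hw, h⟩ := ih n
    obtain ⟨w', hw', h'⟩ := extractX_realize_of_succ ih (n - k)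
    refine ⟨mulBoson K k w + if (k : ℕ) ≤ n then w' else 0, ?_, fun M => ?_⟩
    · rw [Multiset.card_cons, ← add_assoc]
      refine add_mem (mulBoson_mem_shorter k hw) ?_
      split_ifs
      exacts [hw', zero_mem _]
    · rw [ket_cons, realize_mulBoson, extractX_psumX_smul, h, h', derivBoson_mulBoson,
        ← realize_mulBoson, map_add (mulBoson K k)]
      by_cases hk : (k : ℕ) ≤ n
      · rw [if_pos hk, if_pos hk, ← map_add]
        congr 1
        by_cases hkn : n = k
        · rw [if_pos hkn, if_pos (by rw [hkn, Nat.sub_self])]; abel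
        · have : (n : ℕ) ≠ k := fun e => hkn (PNat.coe_injective e)
          rw [if_neg hkn, if_neg (by omega)]; abel
      · rw [if_neg hk, if_neg hk, add_zero, add_zero, if_neg (fun e => hk (by rw [e])), add_zero]

/-- Exactly one odd factor supplies θ₀. If it also supplies all of x₀ⁿ, the result is ∂_{p̃_n};
otherwise bosonic factors are absorbed as well and the product becomes shorter by two or more. -/
theorem extractTheta_realize_ket [CharZero K] (S : Finset ℕ) (μ : Multiset ℕ+) :
    ∀ n : ℕ, ∃ w ∈ shorter K (S.card + μ.card), ∀ M,
      extractTheta K M n (realize K (M + 1) (ket K S μ)) =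
        realize K M (derivFermion K n (ket K S μ) + w) := by
  induction S, μ using ket_induction with
  | empty =>
    refine fun n => ⟨0, zero_mem _, fun M => ?_⟩
    rw [add_zero, derivFermion_ket, if_neg (Finset.notMem_empty n), map_zero,
      realize_ket, Multiset.map_zero, Multiset.prod_zero, one_smul, psumThetaProd_empty,
      Algebra.TensorProduct.one_def, extractTheta_tmul, thetaDeriv, CliffordAlgebra.contractLeft_one, map_zero, TensorProduct.tmul_zero]
  | fermion k S hS ih =>
    intro n
    obtain ⟨w, hw, h⟩ := ih n
    obtain ⟨w', hw', h'⟩ := extractX_realize_of_succ (extractX_realize_ket (K := K) S 0) (n - k)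
    have hc : (insert k S).card = S.card + 1 :=
      Finset.card_insert_of_notMem fun hk => lt_irrefl k (hS k hk)
    refine ⟨-mulFermion K k w + if k ≤ n then w' else 0, ?_, fun M => ?_⟩
    · rw [hc, add_right_comm]
      refine add_mem (neg_mem (mulFermion_mem_shorter k hw)) ?_
      split_ifs
      exacts [hw', zero_mem _]
    · rw [ket_insert_max hS, realize_mulFermion, extractTheta_psumTheta_mul, h, h',
        derivFermion_mulFermion_of_max hS, ← realize_mulFermion, map_add (mulFermion K k)]
      by_cases hk : k ≤ n
      · rw [if_pos hk, if_pos hk, ← map_sub]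
        congr 1
        by_cases hkn : n = k
        · rw [if_pos hkn, if_pos (by rw [hkn, Nat.sub_self])]; abel
        · rw [if_neg hkn, if_neg (by omega)]; abel
      · rw [if_neg hk, if_neg hk, add_zero, if_neg (fun e => hk (by rw [e])), add_zero,
          ← neg_add, map_neg, zero_sub]
  | boson k S μ ih =>
    intro n
    obtain ⟨w, hw, h⟩ := ih n
    obtain ⟨w', hw', h'⟩ := ih (n - k)
    refine ⟨mulBoson K k w + if (k : ℕ) ≤ n then derivFermion K (n - k) (ket K S μ) + w' else 0,
      ?_, fun M => ?_⟩
    · rw [Multiset.card_cons, ← add_assoc]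
      refine add_mem (mulBoson_mem_shorter k hw) ?_
      split_ifs
      · exact add_mem (derivFermion_mem_shorter _ (ket_mem_shorter (Nat.lt_succ_self _)))
          (shorter_mono (Nat.le_succ _) hw')
      · exact zero_mem _
    · rw [ket_cons, realize_mulBoson, extractTheta_psumX_smul, h, h', derivFermion_mulBoson,
        ← realize_mulBoson]
      split_ifs <;> simp only [map_add, map_zero, add_assoc]

theorem extract_realize {D : Module.End K (Fock K)}
    {κ : ∀ M, Superpoly K (M + 1) →ₗ[K] Superpoly K M}
    (h : ∀ S μ, ∃ w ∈ shorter K (S.card + Multiset.card μ), ∀ M,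
      κ M (realize K (M + 1) (ket K S μ)) = realize K M (D (ket K S μ) + w))
    {k : ℕ} {v : Fock K} (hv : v ∈ shorter K (k + 2)) :
    ∃ w ∈ shorter K k, ∀ M, κ M (realize K (M + 1) v) = realize K M (D v + w) := by
  rw [shorter, Finsupp.supported_eq_span_single] at hv
  induction hv using Submodule.span_induction with
  | mem x hx =>
    obtain ⟨L, hL, rfl⟩ := hx
    obtain ⟨w, hw, h⟩ := h L.1 L.2
    have hL : L.1.card + L.2.card + 1 < k + 2 := hL
    exact ⟨w, shorter_mono (by omega) hw, h⟩
  | zero => exact ⟨0, zero_mem _, fun M => by simp⟩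
  | add x y _ _ hx hy =>
    obtain ⟨w, hw, h⟩ := hx
    obtain ⟨w', hw', h'⟩ := hy
    exact ⟨w + w', add_mem hw hw', fun M => by simp only [map_add, h, h']; abel⟩
  | smul c x _ hx =>
    obtain ⟨w, hw, h⟩ := hx
    exact ⟨c • w, Submodule.smul_mem _ c hw, fun M => by simp only [map_smul, h, map_add, smul_add]⟩

theorem derivBoson_apply (n : ℕ+) (v : Fock K) (S : Finset ℕ) (μ : Multiset ℕ+) :
    derivBoson K n v (S, μ) = ((μ.count n : K) + 1) * v (S, n ::ₘ μ) := by
  have : Finsupp.lapply (S, μ) ∘ₗ derivBoson K n =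
      ((μ.count n : K) + 1) • Finsupp.lapply (S, n ::ₘ μ) := by
    refine fock_hom_ext fun T ν => ?_
    simp only [LinearMap.comp_apply, LinearMap.smul_apply, derivBoson_ket, map_smul,
      Finsupp.lapply_apply, Finsupp.single_apply, smul_eq_mul, Prod.mk.injEq]
    by_cases hn : n ∈ ν
    · obtain ⟨ν, rfl⟩ := Multiset.exists_cons_of_mem hn
      simp only [Multiset.erase_cons_head, Multiset.cons_inj_right, Multiset.count_cons_self]
      split_ifs with h
      · rw [h.2]; push_cast; rfl
      · simp
    · rw [Multiset.count_eq_zero_of_notMem hn, if_neg (c := T = S ∧ ν = n ::ₘ μ)]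
      · simp
      · rintro ⟨_, rfl⟩
        exact hn (Multiset.mem_cons_self n μ)
  exact LinearMap.congr_fun this v

theorem derivFermion_apply {n : ℕ} (v : Fock K) {S : Finset ℕ} (hS : n ∉ S) (μ : Multiset ℕ+) :
    derivFermion K n v (S, μ) = orderSign K n S * v (insert n S, μ) := by
  have : Finsupp.lapply (S, μ) ∘ₗ derivFermion K n =
      orderSign K n S • Finsupp.lapply (insert n S, μ) := by
    refine fock_hom_ext fun T ν => ?_
    simp only [LinearMap.comp_apply, LinearMap.smul_apply, derivFermion_ket,
      Finsupp.lapply_apply, Finsupp.single_apply, smul_eq_mul, Prod.mk.injEq]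
    by_cases hn : n ∈ T
    · obtain ⟨T, hT, rfl⟩ : ∃ T', n ∉ T' ∧ insert n T' = T :=
        ⟨T.erase n, Finset.notMem_erase n T, Finset.insert_erase hn⟩
      rw [if_pos (Finset.mem_insert_self n T), Finset.erase_insert hT, orderSign_insert_self,
        Finsupp.smul_apply, Finsupp.single_apply]
      by_cases h : T = S
      · subst h; simp
      · rw [if_neg (by simp [h]), if_neg]
        · simp
        · rintro ⟨h', _⟩
          exact h (by rw [← Finset.erase_insert hT, h', Finset.erase_insert hS])
    · rw [if_neg hn, if_neg (c := T = insert n S ∧ ν = μ)]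
      · simp
      · rintro ⟨rfl, _⟩
        exact hn (Finset.mem_insert_self n S)
  exact LinearMap.congr_fun this v

/-- Induction on the maximal length. A coefficient extraction sends v to Dv + w, with D = ∂_{p_n} or
∂_{p̃_n}; by induction Dv = -w, so the component of Dv of the largest possible length vanishes for
every D. Hence the longest component of v vanishes, as it is recovered from its derivatives. -/
theorem realize_injective_of_shorter [CharZero K] (k : ℕ) :
    ∀ v ∈ shorter K (k + 1), (∀ M, realize K M v = 0) → v = 0 := by
  induction k with
  | zero =>
    intro v hv _
    ext L
    exact (Finsupp.mem_supported' K v).1 hv L fun h => by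
      have : L.length + 1 < 0 + 1 := h
      omega
  | succ k ih =>
    intro v hv h0
    have hX : ∀ n, derivBoson K n v ∈ shorter K k := fun n => by
      obtain ⟨w, hw, h⟩ := extract_realize (fun S μ => extractX_realize_ket S μ n) hv
      have := ih _ (add_mem (derivBoson_mem_shorter n hv) (shorter_mono (Nat.le_succ k) hw))
        fun M => by rw [← h, h0, map_zero]
      rw [eq_neg_of_add_eq_zero_left this]
      exact neg_mem hw
    have hT : ∀ n, derivFermion K n v ∈ shorter K k := fun n => by
      obtain ⟨w, hw, h⟩ := extract_realize (fun S μ => extractTheta_realize_ket S μ n) hv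
      have := ih _ (add_mem (derivFermion_mem_shorter n hv) (shorter_mono (Nat.le_succ k) hw))
        fun M => by rw [← h, h0, map_zero]
      rw [eq_neg_of_add_eq_zero_left this]
      exact neg_mem hw
    refine ih v ((Finsupp.mem_supported' K v).2 ?_) h0
    rintro ⟨S, μ⟩ hL
    by_cases hL2 : S.card + μ.card = k
    · rcases Multiset.empty_or_exists_mem μ with rfl | ⟨n, hn⟩
      · rcases S.eq_empty_or_nonempty with rfl | ⟨n, hn⟩
        · have hk : k = 0 := by simpa using hL2.symm
          subst hk
          -- Length 0 is the one case without a derivative: v is a constant, and it is read off in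
          -- zero variables.
          have hv' : v = Finsupp.single (∅, 0) (v (∅, 0)) := by
            ext ⟨T, ν⟩
            rw [Finsupp.single_apply]
            split_ifs with h
            · rw [h]
            · refine (Finsupp.mem_supported' K v).1 hv _ fun h' => h ?_
              have h' : T.card + ν.card + 1 < 0 + 1 + 1 := h'
              have hT : T.card = 0 := by omega
              have hν : ν.card = 0 := by omega
              rw [Finset.card_eq_zero.1 hT, Multiset.card_eq_zero.1 hν]
          have h1 := h0 0
          rw [hv', realize, Finsupp.linearCombination_single, powerSum_apply, Multiset.map_zero,
            Multiset.prod_zero, one_smul, psumThetaProd_empty] at h1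
          exact (smul_eq_zero.1 h1).resolve_right one_ne_zero
        · have h1 := (Finsupp.mem_supported' K _).1 (hT n) (S.erase n, 0) fun h' => by
            have h' : (S.erase n).card + Multiset.card (0 : Multiset ℕ+) + 1 < k := h'
            have := Finset.card_erase_add_one hn
            omega
          rw [derivFermion_apply v (Finset.notMem_erase n S), Finset.insert_erase hn] at h1
          exact (mul_eq_zero.1 h1).resolve_left fun h => by
            simpa [h] using orderSign_mul_self (K := K) n (S.erase n)
      · have h1 := (Finsupp.mem_supported' K _).1 (hX n) (S, μ.erase n) fun h' => by
          have h' : S.card + (μ.erase n).card + 1 < k := h'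
          have := Multiset.card_erase_add_one hn
          omega
        rw [derivBoson_apply, Multiset.cons_erase hn] at h1
        exact (mul_eq_zero.1 h1).resolve_left (Nat.cast_add_one_ne_zero _)
    · refine (Finsupp.mem_supported' K v).1 hv _ fun h' => hL ?_
      have h' : S.card + μ.card + 1 < k + 1 + 1 := h'
      change S.card + μ.card + 1 < k + 1
      omega

theorem eq_zero_of_realize_eq_zero [CharZero K] {v : Fock K} (h : ∀ M, realize K M v = 0) :
    v = 0 := by
  refine realize_injective_of_shorter (v.support.sup Superpartition.length + 1) v ?_ h
  refine (Finsupp.mem_supported K v).2 fun L hL => ?_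
  have := Finset.le_sup (f := Superpartition.length) hL
  change L.length + 1 < _
  omega

/-! ### Coefficients of symmetric superfunctions -/

theorem extractX_comm (m n : ℕ) {F : Superpoly K (N + 2)} (hF : IsSymm F) :
    extractX K N m (extractX K (N + 1) n F) = extractX K N n (extractX K (N + 1) m F) := by
  rw [← extractX_extractX_swap m n, hF]

theorem extractX_extractTheta_comm (m n : ℕ) {F : Superpoly K (N + 2)} (hF : IsSymm F) :
    extractX K N m (extractTheta K (N + 1) n F) = extractTheta K N n (extractX K (N + 1) m F) := by
  rw [← extractX_extractTheta_swap m n, hF]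

theorem extractTheta_anticomm (m n : ℕ) {F : Superpoly K (N + 2)} (hF : IsSymm F) :
    extractTheta K N m (extractTheta K (N + 1) n F) =
      -extractTheta K N n (extractTheta K (N + 1) m F) := by
  rw [← extractTheta_extractTheta_swap m n, hF]

theorem extractX_zero_apply (F : symmetricSuperfunctions K) (M : ℕ) :
    extractX K M 0 ((F : ∀ N, Superpoly K N) (M + 1)) = (F : ∀ N, Superpoly K N) M := by
  rw [extractX_zero_of_isSymm (isSymm_apply F _)]
  exact (mem_symmetricSuperfunctions.1 F.2).2.1 M

/-- On symmetric superpolynomials restriction is the extraction at n = 0, so compatibility with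
restriction becomes commutation of two extractions. -/
theorem extract_family_mem {κ : ∀ M, Superpoly K (M + 1) →ₗ[K] Superpoly K M}
    (hσ : ∀ M (σ : Equiv.Perm (Fin M)) F,
      κ M (diagPerm K (Equiv.Perm.decomposeFin.symm (0, σ)) F) = diagPerm K σ (κ M F))
    (hκ : ∀ M F, IsSymm F → extractX K M 0 (κ (M + 1) F) = κ M (extractX K (M + 1) 0 F))
    (hd : ∀ M d F, F ∈ degreeLE K (M + 1) d → κ M F ∈ degreeLE K M d)
    (F : symmetricSuperfunctions K) :
    (fun M => κ M ((F : ∀ N, Superpoly K N) (M + 1))) ∈ symmetricSuperfunctions K := by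
  have hs : ∀ M, IsSymm (κ M ((F : ∀ N, Superpoly K N) (M + 1))) := fun M σ => by
    rw [← hσ, isSymm_apply F]
  obtain ⟨d, hF⟩ := (mem_symmetricSuperfunctions.1 F.2).2.2
  refine mem_symmetricSuperfunctions.2 ⟨hs, fun M => ?_, d, fun M => hd M d _ (hF (M + 1))⟩
  rw [← extractX_zero_of_isSymm (hs (M + 1)), hκ M _ (isSymm_apply F _), extractX_zero_apply]

theorem extract_mem_degreeLE_self (n d : ℕ)
    (E : ExteriorAlgebra K (Fin (N + 1) → K) →ₗ[K] ExteriorAlgebra K (Fin N → K))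
    {F : Superpoly K (N + 1)} (hF : F ∈ degreeLE K (N + 1) d) :
    extract n E F ∈ degreeLE K N d :=
  extract_mem_degreeLE n d E (degreeLE_mono K _ (Nat.le_add_right d n) hF)

/-- The coefficient of `x ^ n` of an additional pair of variables. -/
def lowerX (K : Type) [Field K] (n : ℕ) : Module.End K (symmetricSuperfunctions K) where
  toFun F := ⟨fun M => extractX K M n ((F : ∀ N, Superpoly K N) (M + 1)),
    extract_family_mem (fun _ σ F => extractX_diagPerm n σ F)
      (fun _ _ hF => extractX_comm 0 n hF)
      (fun _ d _ hF => extract_mem_degreeLE_self n d _ hF) F⟩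
  map_add' _ _ := Subtype.ext (funext fun M => map_add (extractX K M n) _ _)
  map_smul' c _ := Subtype.ext (funext fun M => map_smul (extractX K M n) c _)

/-- The coefficient of `θ x ^ n` of an additional pair of variables. -/
def lowerTheta (K : Type) [Field K] (n : ℕ) : Module.End K (symmetricSuperfunctions K) where
  toFun F := ⟨fun M => extractTheta K M n ((F : ∀ N, Superpoly K N) (M + 1)),
    extract_family_mem (fun _ σ F => extractTheta_diagPerm n σ F)
      (fun _ _ hF => extractX_extractTheta_comm 0 n hF)
      (fun _ d _ hF => extract_mem_degreeLE_self n d _ hF) F⟩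
  map_add' _ _ := Subtype.ext (funext fun M => map_add (extractTheta K M n) _ _)
  map_smul' c _ := Subtype.ext (funext fun M => map_smul (extractTheta K M n) c _)

theorem lowerX_comm (m n : ℕ) : Commute (lowerX K m) (lowerX K n) :=
  LinearMap.ext fun F => Subtype.ext (funext fun _ => extractX_comm m n (isSymm_apply F _))

theorem lowerX_lowerTheta_comm (m n : ℕ) : Commute (lowerX K m) (lowerTheta K n) :=
  LinearMap.ext fun F =>
    Subtype.ext (funext fun _ => extractX_extractTheta_comm m n (isSymm_apply F _))

theorem lowerTheta_anticomm (m n : ℕ) :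
    lowerTheta K m * lowerTheta K n = (-1 : K) • (lowerTheta K n * lowerTheta K m) :=
  LinearMap.ext fun F => Subtype.ext (funext fun M =>
    (extractTheta_anticomm m n (isSymm_apply F _)).trans
      (neg_one_smul K (extractTheta K M n (extractTheta K (M + 1) m
        ((F : ∀ N, Superpoly K N) (M + 2))))).symm)

/-- The iterated coefficient at a superpartition. -/
def lowerWord (K : Type) [Field K] (L : Superpartition) :
    Module.End K (symmetricSuperfunctions K) :=
  ((L.1.sort (· ≥ ·)).map (lowerTheta K)).prod *
    ((L.2.sort (· ≥ ·)).map fun n : ℕ+ => lowerX K n).prod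

theorem lowerWord_mul_lowerX (S : Finset ℕ) (μ : Multiset ℕ+) (n : ℕ+) :
    lowerWord K (S, μ) * lowerX K n = lowerWord K (S, n ::ₘ μ) := by
  rw [lowerWord, lowerWord, mul_assoc]
  congr 1
  have hp : ((n ::ₘ μ).sort (· ≥ ·)).Perm (n :: μ.sort (· ≥ ·)) := by
    rw [← Multiset.coe_eq_coe, Multiset.sort_eq, ← Multiset.cons_coe, Multiset.sort_eq]
  rw [List.Perm.prod_eq' (hp.map fun n : ℕ+ => lowerX K n), List.map_cons, List.prod_cons]
  · refine (Commute.list_prod_left _ _ fun y hy => ?_).eq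
    obtain ⟨m, _, rfl⟩ := List.mem_map.1 hy
    exact lowerX_comm m n
  · rw [List.pairwise_map]
    exact List.pairwise_of_forall fun a b => lowerX_comm a b

theorem lowerWord_mul_lowerTheta [CharZero K] (S : Finset ℕ) (μ : Multiset ℕ+) (n : ℕ) :
    ∃ c : K, lowerWord K (S, μ) * lowerTheta K n = c • lowerWord K (insert n S, μ) := by
  have h1 : ((μ.sort (· ≥ ·)).map fun n : ℕ+ => lowerX K n).prod * lowerTheta K n =
      lowerTheta K n * ((μ.sort (· ≥ ·)).map fun n : ℕ+ => lowerX K n).prod := by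
    refine (Commute.list_prod_left _ _ fun y hy => ?_).eq
    obtain ⟨m, _, rfl⟩ := List.mem_map.1 hy
    exact lowerX_lowerTheta_comm m n
  rw [lowerWord, lowerWord, mul_assoc, h1, ← mul_assoc,
    list_prod_mul_of_anticommute (K := K) _ lowerTheta_anticomm,
    mul_sort_prod_of_anticommute (K := K) _ lowerTheta_anticomm]
  split_ifs
  · exact ⟨0, by rw [smul_zero, zero_mul, zero_smul]⟩
  · exact ⟨_, by rw [smul_smul, smul_mul_assoc]⟩

/-- The coefficients of F_{M+1} in its first pair of variables are the M-variable components of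
`lowerX K n F` and `lowerTheta K n F`. The iterated coefficients of these are, up to scalars,
iterated coefficients of F, so induction on M applies; for n = 0 the coefficient of x₀ⁿ is F_M
itself. -/
theorem eq_zero_of_lowerWord_eq_zero [CharZero K] (M : ℕ) : ∀ F : symmetricSuperfunctions K,
    (∀ L, (lowerWord K L F : ∀ N, Superpoly K N) 0 = 0) → (F : ∀ N, Superpoly K N) M = 0 := by
  induction M with
  | zero =>
    intro F h
    simpa [lowerWord] using h (∅, 0)
  | succ M ih =>
    intro F h
    refine eq_zero_of_extract_eq_zero (fun n => ?_) fun n => ?_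
    · rcases Nat.eq_zero_or_pos n with rfl | hn
      · rw [extractX_zero_apply, ih F h]
      · refine ih (lowerX K n F) fun L => ?_
        have := LinearMap.congr_fun (lowerWord_mul_lowerX (K := K) L.1 L.2 ⟨n, hn⟩) F
        exact (congrArg (fun G : symmetricSuperfunctions K => (G : ∀ N, Superpoly K N) 0)
          this).trans (h _)
    · refine ih (lowerTheta K n F) fun L => ?_
      obtain ⟨c, hc⟩ := lowerWord_mul_lowerTheta (K := K) L.1 L.2 n
      have := LinearMap.congr_fun hc F
      rw [LinearMap.smul_apply, Module.End.mul_apply] at this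
      rw [show (L.1, L.2) = L from rfl] at this
      rw [this]
      change c • (lowerWord K (insert n L.1, L.2) F : ∀ N, Superpoly K N) 0 = 0
      rw [h, smul_zero]

/-! ### Symmetric superfunctions of bounded degree -/

/-- The symmetric superfunctions of degree at most `d`. -/
def boundedDegree (K : Type) [Field K] (d : ℕ) : Submodule K (symmetricSuperfunctions K) where
  carrier := {F | ∀ N, (F : ∀ N, Superpoly K N) N ∈ degreeLE K N d}
  add_mem' hF hG N := add_mem (hF N) (hG N)
  zero_mem' N := zero_mem (degreeLE K N d)
  smul_mem' c _ hF N := (degreeLE K N d).smul_mem c (hF N)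

/-- Each operator lowers the degree bound by its weight and kills what has smaller degree. The two
assertions are proved together, since the second needs the bound on the degree left after the later
factors of the list have acted. -/
theorem list_prod_mem_boundedDegree {ι : Type*} (f : ι → Module.End K (symmetricSuperfunctions K))
    (wt : ι → ℕ)
    (hf : ∀ i d, ∀ F ∈ boundedDegree K (d + wt i), f i F ∈ boundedDegree K d)
    (hf0 : ∀ i d, d < wt i → ∀ F ∈ boundedDegree K d, f i F = 0) (l : List ι) (d : ℕ) :
    (∀ F ∈ boundedDegree K (d + (l.map wt).sum), (l.map f).prod F ∈ boundedDegree K d) ∧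
    (d < (l.map wt).sum → ∀ F ∈ boundedDegree K d, (l.map f).prod F = 0) := by
  induction l generalizing d with
  | nil => exact ⟨fun F hF => hF, fun h => absurd h (Nat.not_lt_zero d)⟩
  | cons a l ih =>
    simp only [List.map_cons, List.prod_cons, List.sum_cons, Module.End.mul_apply]
    refine ⟨fun F hF => hf a d _ ((ih _).1 F (by rwa [add_assoc])), fun h F hF => ?_⟩
    by_cases hlt : d < (l.map wt).sum
    · rw [(ih d).2 hlt F hF, map_zero]
    · refine hf0 a (d - (l.map wt).sum) (by omega) _ ((ih _).1 F ?_)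
      rwa [Nat.sub_add_cancel (not_lt.1 hlt)]

/-- The degree of `p_Λ` in the commuting variables: the sum of all parts. -/
def Superpartition.weight (L : Superpartition) : ℕ :=
  ∑ n ∈ L.1, n + (L.2.map fun n : ℕ+ => (n : ℕ)).sum

theorem Superpartition.weight_eq (L : Superpartition) :
    L.weight = ((L.1.sort (· ≥ ·)).map id).sum +
      ((L.2.sort (· ≥ ·)).map fun n : ℕ+ => (n : ℕ)).sum := by
  rw [weight]
  congr 1
  · rw [← Multiset.sum_coe, ← Multiset.map_coe, Finset.sort_eq]; rfl
  · rw [← Multiset.sum_coe, ← Multiset.map_coe, Multiset.sort_eq]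

theorem lowerWord_eq_zero {d : ℕ} {L : Superpartition} (h : d < L.weight)
    {F : symmetricSuperfunctions K} (hF : F ∈ boundedDegree K d) : lowerWord K L F = 0 := by
  have hX := list_prod_mem_boundedDegree (fun n : ℕ+ => lowerX K n) (fun n : ℕ+ => (n : ℕ))
    (fun n d F hF N => extract_mem_degreeLE (n : ℕ) d _ (hF (N + 1)))
    (fun n d h F hF => Subtype.ext (funext fun N => extract_eq_zero_of_lt h _ (hF (N + 1))))
    (L.2.sort (· ≥ ·))
  have hT := list_prod_mem_boundedDegree (lowerTheta K) id
    (fun n d F hF N => extract_mem_degreeLE (n : ℕ) d _ (hF (N + 1)))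
    (fun n d h F hF => Subtype.ext (funext fun N => extract_eq_zero_of_lt h _ (hF (N + 1))))
    (L.1.sort (· ≥ ·))
  rw [L.weight_eq] at h
  rw [lowerWord, Module.End.mul_apply]
  by_cases h' : d < ((L.2.sort (· ≥ ·)).map fun n : ℕ+ => (n : ℕ)).sum
  · rw [(hX d).2 h' F hF, map_zero]
  · refine (hT (d - ((L.2.sort (· ≥ ·)).map fun n : ℕ+ => (n : ℕ)).sum)).2 (by omega) _
      ((hX _).1 F ?_)
    rwa [Nat.sub_add_cancel (not_lt.1 h')]

theorem mul_mem_boundedDegree {c d : ℕ} {F G : symmetricSuperfunctions K}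
    (hF : F ∈ boundedDegree K c) (hG : G ∈ boundedDegree K d) :
    F * G ∈ boundedDegree K (c + d) := fun N => mul_mem_degreeLE (hF N) (hG N)

theorem one_mem_boundedDegree : (1 : symmetricSuperfunctions K) ∈ boundedDegree K 0 :=
  fun N => by
    have := algebraMap_mem_degreeLE (K := K) N 1
    rw [map_one] at this
    exact this

theorem list_prod_map_mem_boundedDegree {ι : Type*} {f : ι → symmetricSuperfunctions K}
    {wt : ι → ℕ} (hf : ∀ i, f i ∈ boundedDegree K (wt i)) (l : List ι) :
    (l.map f).prod ∈ boundedDegree K (l.map wt).sum := by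
  induction l with
  | nil => exact one_mem_boundedDegree
  | cons a l ih =>
    simp only [List.map_cons, List.prod_cons, List.sum_cons]
    exact mul_mem_boundedDegree (hf a) ih

theorem powerSum_mem_boundedDegree (L : Superpartition) :
    powerSum K L ∈ boundedDegree K L.weight := by
  rw [L.weight_eq]
  refine mul_mem_boundedDegree (list_prod_map_mem_boundedDegree (fun n N => ?_) _)
    (list_prod_map_mem_boundedDegree (fun n N => ?_) _)
  · change ∑ i : Fin N, thetaVar K i * xVar K i ^ n ∈ degreeLE K N n
    refine Submodule.sum_mem (degreeLE K N n) fun i _ => ?_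
    have := mul_mem_degreeLE (thetaVar_mem_degreeLE K i) (xVar_pow_mem_degreeLE K i n)
    rwa [zero_add] at this
  · change ∑ i : Fin N, xVar K i ^ (n : ℕ) ∈ degreeLE K N n
    exact Submodule.sum_mem (degreeLE K N n) fun i _ => xVar_pow_mem_degreeLE K i n

theorem finite_weight_le (d : ℕ) : {L : Superpartition | L.weight ≤ d}.Finite := by
  let e : ℕ ↪ ℕ+ := ⟨Nat.succPNat, Nat.succPNat_injective⟩
  -- In weight at most d the positive parts lie in 1, …, d and each occurs at most d times, so μ is
  -- contained in d copies of {1, …, d}.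
  let s : Multiset ℕ+ := d • ((Finset.range d).map e).val
  refine ((Finset.finite_toSet ((Finset.range (d + 1)).powerset)).prod
    (Set.finite_Iic s)).subset ?_
  rintro ⟨S, μ⟩ h
  have h : ∑ n ∈ S, n + (μ.map fun n : ℕ+ => (n : ℕ)).sum ≤ d := h
  refine ⟨(?_ : S ∈ _), (?_ : μ ∈ _)⟩
  · rw [Finset.mem_coe, Finset.mem_powerset]
    intro n hn
    have := Finset.single_le_sum (f := fun n : ℕ => n) (fun _ _ => Nat.zero_le _) hn
    rw [Finset.mem_range]
    omega
  · rw [Set.mem_Iic, Multiset.le_iff_count]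
    intro n
    by_cases hn : n ∈ μ
    · have h1 : (n : ℕ) ≤ (μ.map fun n : ℕ+ => (n : ℕ)).sum :=
        Multiset.single_le_sum (fun _ _ => Nat.zero_le _) _ (Multiset.mem_map_of_mem _ hn)
      have h2 : μ.count n ≤ (μ.map fun n : ℕ+ => (n : ℕ)).sum := by
        refine (Multiset.count_le_card n μ).trans ?_
        rw [← Multiset.card_map (fun n : ℕ+ => (n : ℕ)) μ]
        have := Multiset.card_nsmul_le_sum (s := μ.map fun n : ℕ+ => (n : ℕ)) (a := 1) fun x hx => by
          obtain ⟨m, _, rfl⟩ := Multiset.mem_map.1 hx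
          exact m.pos
        simpa using this
      have h3 : n ∈ (Finset.range d).map e :=
        Finset.mem_map.2 ⟨n.natPred, Finset.mem_range.2 (by
          have := PNat.natPred_add_one n; omega), PNat.succPNat_natPred n⟩
      rw [Multiset.count_nsmul, Multiset.count_eq_one_of_mem (Finset.nodup _) h3]
      omega
    · rw [Multiset.count_eq_zero_of_notMem hn]
      exact Nat.zero_le _

/-! ### The power sums form a basis -/

/-- The linear map sending the basis vector of a superpartition `Λ` to `p_Λ`. -/
def expand (K : Type) [Field K] : Fock K →ₗ[K] symmetricSuperfunctions K :=
  Finsupp.linearCombination K (powerSum K)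

theorem expand_ket (L : Superpartition) : expand K (Finsupp.single L 1) = powerSum K L := by
  rw [expand, Finsupp.linearCombination_single, one_smul]

theorem expand_apply (v : Fock K) (N : ℕ) :
    (expand K v : ∀ N, Superpoly K N) N = realize K N v := by
  induction v using Finsupp.induction_linear with
  | zero => rw [map_zero, map_zero]; rfl
  | add v w hv hw => rw [map_add, map_add, ← hv, ← hw]; rfl
  | single L c =>
    rw [expand, realize, Finsupp.linearCombination_single, Finsupp.linearCombination_single]; rfl

theorem expand_injective [CharZero K] : Function.Injective (expand K) := by
  rw [injective_iff_map_eq_zero]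
  intro v hv
  refine eq_zero_of_realize_eq_zero fun M => ?_
  rw [← expand_apply, hv]
  rfl

theorem exists_superpoly_zero_linear (K : Type) [Field K] :
    ∃ e : Superpoly K 0 →ₗ[K] K, ∀ F, F = e F • (1 : Superpoly K 0) := by
  refine ⟨(TensorProduct.lid K K).toLinearMap ∘ₗ TensorProduct.map
    (isEmptyAlgEquiv K (Fin 0)).toLinearMap ExteriorAlgebra.algebraMapInv.toLinearMap,
    fun F => ?_⟩
  induction F using TensorProduct.induction_on with
  | zero => simp
  | add x y hx hy => rw [map_add, add_smul, ← hx, ← hy]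
  | tmul f w =>
    have hf : f = algebraMap K _ (isEmptyAlgEquiv K (Fin 0) f) := by
      apply (isEmptyAlgEquiv K (Fin 0)).injective
      rw [AlgEquiv.commutes]; rfl
    have hw : w = algebraMap K _ (ExteriorAlgebra.algebraMapInv w) := by
      induction w using exteriorAlgebra_induction with
      | algebraMap r => rw [ExteriorAlgebra.algebraMap_leftInverse]
      | add a b ha hb => rw [map_add, map_add, ← ha, ← hb]
      | ι_mul v a _ => rw [Subsingleton.elim v 0, map_zero, zero_mul, map_zero, map_zero]
    conv_lhs => rw [hf, hw, Algebra.algebraMap_eq_smul_one, Algebra.algebraMap_eq_smul_one,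
      TensorProduct.smul_tmul_smul, ← Algebra.TensorProduct.one_def]
    rfl

theorem expand_mapDomain_mem {d : ℕ} (c : {L : Superpartition | L.weight ≤ d} →₀ K) :
    expand K (Finsupp.mapDomain Subtype.val c) ∈ boundedDegree K d := by
  induction c using Finsupp.induction_linear with
  | zero => rw [Finsupp.mapDomain_zero, map_zero]; exact zero_mem _
  | add x y hx hy => rw [Finsupp.mapDomain_add, map_add]; exact add_mem hx hy
  | single L r =>
    rw [Finsupp.mapDomain_single, expand, Finsupp.linearCombination_single]
    exact Submodule.smul_mem _ r fun N =>
      degreeLE_mono K N L.2 (powerSum_mem_boundedDegree L.1 N)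

/-- A dimension count in degree at most d. The iterated coefficients of weight at most d embed this
space into K^P, where P is the finite set of superpartitions of weight at most d, and it already
contains the independent elements p_Λ with Λ ∈ P. -/
theorem expand_surjective [CharZero K] : Function.Surjective (expand K) := by
  intro F
  obtain ⟨d, hF⟩ : ∃ d, F ∈ boundedDegree K d := (mem_symmetricSuperfunctions.1 F.2).2.2
  obtain ⟨e, he⟩ := exists_superpoly_zero_linear K
  have : Finite {L : Superpartition | L.weight ≤ d} := finite_weight_le d
  let P := {L : Superpartition | L.weight ≤ d}
  let κ : symmetricSuperfunctions K →ₗ[K] (P → K) := LinearMap.pi fun L =>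
    e ∘ₗ LinearMap.proj (φ := fun N => Superpoly K N) 0 ∘ₗ
      (symmetricSuperfunctions K).val.toLinearMap ∘ₗ lowerWord K L.1
  have hκ : ∀ G ∈ boundedDegree K d, κ G = 0 → G = 0 := by
    intro G hG h
    refine Subtype.ext (funext fun M => eq_zero_of_lowerWord_eq_zero M G fun L => ?_)
    by_cases hL : L.weight ≤ d
    · rw [he ((lowerWord K L G : ∀ N, Superpoly K N) 0)]
      have : e ((lowerWord K L G : ∀ N, Superpoly K N) 0) = 0 := congrFun h ⟨L, hL⟩
      rw [this, zero_smul]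
    · rw [lowerWord_eq_zero (not_le.1 hL) hG]
      rfl
  -- An injective endomorphism of K^P is surjective, which provides a combination of the p_Λ with
  -- the same coefficients as F.
  let A : (P → K) →ₗ[K] (P → K) := κ ∘ₗ expand K ∘ₗ Finsupp.lmapDomain K K Subtype.val ∘ₗ
    (Finsupp.linearEquivFunOnFinite K K P).symm.toLinearMap
  have hA : Function.Injective A := by
    rw [injective_iff_map_eq_zero]
    intro c hc
    have h1 := hκ _ (expand_mapDomain_mem ((Finsupp.linearEquivFunOnFinite K K P).symm c)) hc
    have h2 := expand_injective (h1.trans (map_zero _).symm)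
    have h3 := Finsupp.mapDomain_injective Subtype.val_injective
      (h2.trans Finsupp.mapDomain_zero.symm)
    exact (LinearEquiv.map_eq_zero_iff _).1 h3
  obtain ⟨c, hc⟩ := LinearMap.injective_iff_surjective.1 hA (κ F)
  refine ⟨Finsupp.mapDomain Subtype.val ((Finsupp.linearEquivFunOnFinite K K P).symm c), ?_⟩
  have h1 := (boundedDegree K d).add_mem (expand_mapDomain_mem
    ((Finsupp.linearEquivFunOnFinite K K P).symm c)) ((boundedDegree K d).smul_mem (-1) hF)
  rw [← sub_eq_zero, sub_eq_add_neg, ← neg_one_smul K F]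
  refine hκ _ h1 ?_
  rw [map_add, map_smul, neg_one_smul, ← sub_eq_add_neg, sub_eq_zero]
  exact hc

/-- The Fock space is isomorphic to the space of symmetric superfunctions. -/
def expandEquiv (K : Type) [Field K] [CharZero K] : Fock K ≃ₗ[K] symmetricSuperfunctions K :=
  LinearEquiv.ofBijective (expand K) ⟨expand_injective, expand_surjective⟩

/-! ### The combinatorial form -/

/-- The combinatorial scalar product. -/
def combinatorialForm [CharZero K] (β : K) :
    LinearMap.BilinForm K (symmetricSuperfunctions K) :=
  (fockForm β).compl₁₂ (reversal K ∘ₗ (expandEquiv K).symm.toLinearMap)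
    (expandEquiv K).symm.toLinearMap

theorem combinatorialForm_expand [CharZero K] (β : K) (v w : Fock K) :
    combinatorialForm β (expand K v) (expand K w) = fockForm β (reversal K v) w := by
  change fockForm β (reversal K ((expandEquiv K).symm (expandEquiv K v)))
    ((expandEquiv K).symm (expandEquiv K w)) = _
  rw [LinearEquiv.symm_apply_apply, LinearEquiv.symm_apply_apply]

theorem isCombinatorialForm_combinatorialForm [CharZero K] (β : K) :
    IsCombinatorialForm β (combinatorialForm β) := by
  intro L M
  have hL : reversal K (Finsupp.single L 1) = reverseSign K L • ket K L.1 L.2 :=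
    diagonal_ket L.1 L.2 _
  rw [powerSumRev_eq, map_smul, LinearMap.smul_apply, ← expand_ket, ← expand_ket,
    combinatorialForm_expand, hL, map_smul, LinearMap.smul_apply, smul_smul, reverseSign_mul_self,
    one_smul]
  exact fockForm_ket β L.1 M.1 L.2 M.2

/-- The prescribed pairings involve reversed products on the left; these are ± the p_Λ, so both
arguments run over a basis. -/
theorem IsCombinatorialForm.eq [CharZero K] {β : K}
    {B B' : LinearMap.BilinForm K (symmetricSuperfunctions K)} (h : IsCombinatorialForm β B)
    (h' : IsCombinatorialForm β B') : B' = B := by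
  have key : B'.compl₁₂ (expand K) (expand K) = B.compl₁₂ (expand K) (expand K) := by
    refine fock_hom_ext fun S μ => fock_hom_ext fun T ν => ?_
    rw [LinearMap.compl₁₂_apply, LinearMap.compl₁₂_apply, expand_ket, expand_ket]
    have hp : powerSum K (S, μ) = reverseSign K (S, μ) • powerSumRev K (S, μ) := by
      rw [powerSumRev_eq, smul_smul, reverseSign_mul_self, one_smul]
    rw [hp, map_smul, map_smul, LinearMap.smul_apply, LinearMap.smul_apply, h, h']
  refine LinearMap.ext fun F => LinearMap.ext fun G => ?_
  obtain ⟨v, rfl⟩ := expand_surjective F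
  obtain ⟨w, rfl⟩ := expand_surjective G
  exact LinearMap.congr_fun (LinearMap.congr_fun key v) w

/-! ### Self-adjointness -/

/-- The vectors of the Fock space whose superpartitions have parts at most `d`. -/
def partsLE (K : Type) [Field K] (d : ℕ) : Submodule K (Fock K) :=
  Finsupp.supported K K {L : Superpartition | PartsLE d L.1 L.2}

theorem partsLE_mono {c d : ℕ} (h : c ≤ d) : partsLE K c ≤ partsLE K d :=
  Finsupp.supported_mono fun _ hL => ⟨fun n hn => (hL.1 n hn).trans h,
    fun n hn => (hL.2 n hn).trans h⟩

theorem exists_mem_partsLE (v : Fock K) : ∃ d, v ∈ partsLE K d := by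
  refine ⟨v.support.sup Superpartition.weight, (Finsupp.mem_supported K v).2 fun L hL => ?_⟩
  have h : ∑ n ∈ L.1, n + (L.2.map fun n : ℕ+ => (n : ℕ)).sum ≤
    v.support.sup Superpartition.weight := Finset.le_sup (f := Superpartition.weight) hL
  refine ⟨fun n hn => ?_, fun n hn => ?_⟩
  · have := Finset.single_le_sum (f := fun n : ℕ => n) (fun _ _ => Nat.zero_le _) hn
    omega
  · have : (n : ℕ) ≤ (L.2.map fun n : ℕ+ => (n : ℕ)).sum :=
      Multiset.single_le_sum (fun _ _ => Nat.zero_le _) _ (Multiset.mem_map_of_mem _ hn)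
    omega

theorem eq_of_eq_on_partsLE {A : Type*} [AddCommGroup A] [Module K A] {f g : Fock K →ₗ[K] A}
    {d : ℕ} (h : ∀ S μ, PartsLE d S μ → f (ket K S μ) = g (ket K S μ)) {v : Fock K}
    (hv : v ∈ partsLE K d) : f v = g v := by
  rw [partsLE, Finsupp.supported_eq_span_single] at hv
  refine LinearMap.eqOn_span' (f := f) (g := g) ?_ hv
  rintro _ ⟨L, hL, rfl⟩
  exact h L.1 L.2 hL

theorem familyH_expand [CharZero K] (β : K) (n d : ℕ) {v : Fock K} (hv : v ∈ partsLE K d) :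
    familyH β n (expand K v : ∀ M, Superpoly K M) = expand K (fockHamiltonian β n d v) := by
  funext M
  rw [expand_apply]
  change (hamiltonian β M + (β * ((n : K) - M)) • euler K M)
    ((expand K v : ∀ M, Superpoly K M) M) = _
  rw [expand_apply]
  exact (eq_of_eq_on_partsLE (f := realize K M ∘ₗ fockHamiltonian β n d)
    (g := (hamiltonian β M + (β * ((n : K) - M)) • euler K M) ∘ₗ realize K M)
    (fun S μ h => realize_fockHamiltonian β n d S μ h) hv).symm

theorem familyI_expand [CharZero K] (β : K) (d : ℕ) {v : Fock K} (hv : v ∈ partsLE K d) :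
    familyI β (expand K v : ∀ M, Superpoly K M) = expand K (fockCharge β d v) := by
  funext M
  rw [expand_apply]
  change chargeI β M 1 ((expand K v : ∀ M, Superpoly K M) M) = _
  rw [expand_apply]
  exact (eq_of_eq_on_partsLE (f := realize K M ∘ₗ fockCharge β d)
    (g := chargeI β M 1 ∘ₗ realize K M) (fun S μ h => realize_fockCharge β d S μ h) hv).symm

/-- An operator on families that is given on the Fock space by operators that are self-adjoint and
commute with the reversal restricts to a self-adjoint operator on symmetric superfunctions. -/
theorem exists_selfAdjoint_restriction [CharZero K] (β : K)
    (T : Module.End K (∀ M, Superpoly K M)) (f : ℕ → Module.End K (Fock K))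
    (hT : ∀ d, ∀ v ∈ partsLE K d, T (expand K v : ∀ M, Superpoly K M) = expand K (f d v))
    (hf : ∀ d v w, fockForm β (f d v) w = fockForm β v (f d w))
    (hr : ∀ d v, f d (reversal K v) = reversal K (f d v)) :
    ∃ H : Module.End K (symmetricSuperfunctions K),
      (∀ F, (H F : ∀ M, Superpoly K M) = T F) ∧ (combinatorialForm β).IsSelfAdjoint H := by
  have hmem : ∀ F ∈ Subalgebra.toSubmodule (symmetricSuperfunctions K),
      T F ∈ Subalgebra.toSubmodule (symmetricSuperfunctions K) := by
    intro F hF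
    obtain ⟨v, hv⟩ := expand_surjective ⟨F, hF⟩
    obtain ⟨d, hd⟩ := exists_mem_partsLE v
    have : F = (expand K v : ∀ M, Superpoly K M) := by rw [hv]
    rw [this, hT d v hd]
    exact (expand K (f d v)).2
  let H : Module.End K (symmetricSuperfunctions K) := T.restrict hmem
  have hH : ∀ d, ∀ v ∈ partsLE K d, H (expand K v) = expand K (f d v) :=
    fun d v hv => Subtype.ext (hT d v hv)
  refine ⟨H, fun F => rfl, fun F G => ?_⟩
  obtain ⟨v, rfl⟩ := expand_surjective F
  obtain ⟨w, rfl⟩ := expand_surjective G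
  obtain ⟨c, hc⟩ := exists_mem_partsLE v
  obtain ⟨d, hd⟩ := exists_mem_partsLE w
  -- A common truncation is taken for both vectors. The reversal occurs in the left argument only,
  -- so the operator has to be moved through it before the adjointness on the Fock space applies.
  rw [hH (max c d) v (partsLE_mono (le_max_left c d) hc),
    hH (max c d) w (partsLE_mono (le_max_right c d) hd), combinatorialForm_expand,
    combinatorialForm_expand, ← hr, hf]

end Superspace

end

/-! ### The proposition over the field of rational functions in β -/

theorem mainTheorem4 :
    ∃ B : LinearMap.BilinForm (RatFunc ℚ) (Superspace.symmetricSuperfunctions (RatFunc ℚ)),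
      (Superspace.IsCombinatorialForm RatFunc.X B ∧
        ∀ B', Superspace.IsCombinatorialForm RatFunc.X B' → B' = B) ∧
      (∀ N : ℕ,
        ∃ H : Module.End (RatFunc ℚ) (Superspace.symmetricSuperfunctions (RatFunc ℚ)),
          (∀ F, (H F : ∀ M : ℕ, Superspace.Superpoly (RatFunc ℚ) M) =
            Superspace.familyH RatFunc.X N F) ∧
          B.IsSelfAdjoint H) ∧
      ∃ I : Module.End (RatFunc ℚ) (Superspace.symmetricSuperfunctions (RatFunc ℚ)),
        (∀ F, (I F : ∀ M : ℕ, Superspace.Superpoly (RatFunc ℚ) M) =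
          Superspace.familyI RatFunc.X F) ∧
        B.IsSelfAdjoint I := by
  have hX : (RatFunc.X : RatFunc ℚ) ≠ 0 := RatFunc.X_ne_zero
  have : CharZero (RatFunc ℚ) := algebraRat.charZero _
  have hB := Superspace.isCombinatorialForm_combinatorialForm (RatFunc.X : RatFunc ℚ)
  refine ⟨Superspace.combinatorialForm RatFunc.X, ⟨hB, fun B' h => hB.eq h⟩, fun N => ?_, ?_⟩
  · exact Superspace.exists_selfAdjoint_restriction _ _
      (fun d => Superspace.fockHamiltonian RatFunc.X (N : RatFunc ℚ) d)
      (fun d v hv => Superspace.familyH_expand _ N d hv)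
      (fun d v w => Superspace.fockForm_fockHamiltonian hX _ d v w)
      (fun d v => Superspace.fockHamiltonian_reversal _ _ d v)
  · exact Superspace.exists_selfAdjoint_restriction _ _
      (fun d => Superspace.fockCharge RatFunc.X d)
      (fun d v hv => Superspace.familyI_expand _ d hv)
      (fun d v w => Superspace.fockForm_fockCharge hX d v w)
      (fun d v => Superspace.fockCharge_reversal _ d v)
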